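/- **Setting.** Let $n\ge 0$. The $n$-party Bell scenario is the directed acyclic graph with the $2n+1$ nodes $s,x_1,\dots,x_n,a_1,\dots,a_n$ and exactly the edges $s\to a_i$ and $x_i\to a_i$ ($1\le i\le n$). Every node $v$ carries an outcome variable $o[v]$ with values in a finite set $O_v$. Let $P(o[a_1\ldots a_n x_1\ldots x_n s])$ be a probability distribution on the joint outcomes; $P(o[U])$ denotes its marginal on a set $U$ of nodes, and $P(o[U]\,|\,o[W])$ the conditional probability. **Quantum correlations.** For a complex Hilbert space $\mathcal H$ of arbitrary (finite or infinite) dimension let $\mathcal S(\mathcal H)$ be its space of trace class operators. A quantum operation from $\mathcal H$ to $\mathcal K$ is a completely positive linear map $\mathcal S(\mathcal H)\to\mathcal S(\mathcal K)$; a quantum instrument with outcome set $O$ is a family of quantum operations indexed by $O$ whose sum is trace-preserving. A distribution $P$ of outcomes at the nodes of a finite directed acyclic graph $G=(V,E)$ is a *quantum correlation* if there are Hilbert spaces $\mathcal H_e$ for all edges $e\in E$ and, for every node $v$, a quantum instrument $(f_v(o))_{o\in O_v}$ from $\bigotimes_{e\text{ into }v}\mathcal H_e$ to $\bigotimes_{e\text{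 out of }v}\mathcal H_e$ (completed Hilbert space tensor products, the empty one being $\mathbb C$) such that, for every joint outcome $o$, the probability $P(o)$ is the value of the diagram $G$ whose edges are labelled by the $\mathcal H_e$ and whose nodes are labelled by the $f_v(o[v])$. This value is the number obtained by composing the operations along the edges: one starts from $1\in\mathcal S(\mathbb C)=\mathbb C$ and applies the operations stage by stage, each stage executing all nodes all of whose parents have been executed, as the tensor product of the operations at these nodes with the identity on the other systems present. **Proposition.** In the $n$-party Bell scenario, $P(o[a_1\ldots a_n x_1\ldots x_n s])$ is a quantum correlation if and only if both of the following hold. 1. (Free will equation) For all values of the outcome variables, $$P(o[x_1\ldots x_n s]) = P(o[x_1])\cdots P(o[x_n])\,P(o[s]).$$ 2. (Quantum model) There are Hilbert spaces $\mathcal H_1,\dots,\mathcal H_n$ of arbitrary dimension, unit vectors $|\psi_{o[s]}\rangle\in\mathcal H_1\otimes\cdots\otimes\mathcal H_n$ for $o[s]\in O_s$, and bounded positive operators $E^{o[x_i]}_{o[a_i]}$ on $\mathcal H_i$ for $o[x_i]\in O_{x_i}$, $o[a_i]\in O_{a_i}$ (not depending on $o[s]$) with $\sum_{o[a_i]}E^{o[x_i]}_{o[a_i]}=\mathbb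 1_{\mathcal H_i}$ for every $i$ and $o[x_i]$, such that $$P(o[a_1\ldots a_n]\,|\,o[x_1\ldots x_n s]) = \langle\psi_{o[s]}|\,E^{o[x_1]}_{o[a_1]}\otimes\cdots\otimes E^{o[x_n]}_{o[a_n]}\,|\psi_{o[s]}\rangle$$ for all joint outcomes with $P(o[x_i])>0$ for all $i$ and $P(o[s])>0$. -/

import Mathlib

open scoped InnerProductSpace ComplexOrder

universe u v

noncomputable section

/-! ### Hilbert spaces and their tensor products -/

/-- A complex Hilbert space of arbitrary dimension. -/
structure HilbSp where
  carrier : Type u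
  [normed : NormedAddCommGroup carrier]
  [innerProd : InnerProductSpace ℂ carrier]
  [complete : CompleteSpace carrier]

namespace HilbSp

instance : CoeSort HilbSp.{u} (Type u) := ⟨HilbSp.carrier⟩

attribute [instance] HilbSp.normed HilbSp.innerProd HilbSp.complete

end HilbSp

lemma HilbSp.posSemidef_prod_gram {ι : Type} {H : ι → HilbSp.{u}} {m : ℕ} (x : Fin m → ∀ i, H i) (s : Finset ι) :
    (Matrix.of fun j k => ∏ i ∈ s, ⟪x j i, x k i⟫_ℂ).PosSemidef := by
  classical
  induction s using Finset.induction_on with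
  | empty =>
    have h : (Matrix.of fun j k => ∏ i ∈ (∅ : Finset ι), ⟪x j i, x k i⟫_ℂ) =
        Matrix.gram ℂ (fun _ : Fin m => (1 : ℂ)) := by
      ext j k
      simp [Matrix.gram]
    rw [h]
    exact Matrix.posSemidef_gram ℂ _
  | insert i s hi ih =>
    have h : (Matrix.of fun j k => ∏ i ∈ insert i s, ⟪x j i, x k i⟫_ℂ) =
        (Matrix.gram ℂ (fun k => x k i)).hadamard
          (Matrix.of fun j k => ∏ i ∈ s, ⟪x j i, x k i⟫_ℂ) := by
      ext j k
      simp [Matrix.gram, Finset.prod_insert hi]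
    rw [h]
    exact (Matrix.posSemidef_gram ℂ _).hadamard ih

lemma HilbSp.posSemidef_prod_gram_sub {ι : Type} {H : ι → HilbSp.{u}} {m : ℕ}
    (x : Fin m → ∀ i, H i) (A : ∀ i, H i →L[ℂ] H i) (s : Finset ι) :
    (((∏ i ∈ s, ‖A i‖ ^ 2 : ℝ) • Matrix.of fun j k => ∏ i ∈ s, ⟪x j i, x k i⟫_ℂ) -
      Matrix.of fun j k => ∏ i ∈ s, ⟪A i (x j i), A i (x k i)⟫_ℂ).PosSemidef := by
  classical
  induction s using Finset.induction_on with
  | empty =>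
    simp only [Finset.prod_empty, one_smul, sub_self]
    exact Matrix.PosSemidef.zero
  | insert i s hi ih =>
    have h1 := Matrix.posSemidef_opNorm_smul_gram_sub_gram (𝕜 := ℂ) (fun k => x k i) (A i)
    have hN : ((∏ j ∈ s, ‖A j‖ ^ 2 : ℝ) •
        Matrix.of fun j k => ∏ i ∈ s, ⟪x j i, x k i⟫_ℂ).PosSemidef := by
      refine (HilbSp.posSemidef_prod_gram x s).smul ?_
      positivity
    have hM := Matrix.posSemidef_gram ℂ (A i ∘ fun k => x k i)
    have h := (h1.hadamard hN).add (hM.hadamard ih)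
    refine (congrArg Matrix.PosSemidef ?_).mpr h
    ext j k
    simp only [Finset.prod_insert hi, Matrix.sub_apply, Matrix.smul_apply, Matrix.of_apply,
      Matrix.add_apply, Matrix.hadamard_apply, Matrix.gram_apply, Function.comp_apply,
      Complex.real_smul]
    push_cast
    ring

section AlgebraicTensor

variable {ι : Type} (H : ι → HilbSp.{u})

/-- The algebraic tensor product of a finite family of Hilbert spaces. (A type synonym, since
Mathlib already puts the projective seminorm on `PiTensorProduct`.) -/
def AlgTensor : Type u := PiTensorProduct ℂ (fun i => (H i : Type u))

instance : AddCommGroup (AlgTensor H) :=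
  inferInstanceAs (AddCommGroup (PiTensorProduct ℂ (fun i => (H i : Type u))))

instance : Module ℂ (AlgTensor H) :=
  inferInstanceAs (Module ℂ (PiTensorProduct ℂ (fun i => (H i : Type u))))

/-- The elementary tensor `⨂ᵢ xᵢ`. -/
def AlgTensor.tprod : MultilinearMap ℂ (fun i => (H i : Type u)) (AlgTensor H) :=
  PiTensorProduct.tprod ℂ

variable {H}

lemma AlgTensor.exists_sum (z : AlgTensor H) :
    ∃ (m : ℕ) (c : Fin m → ℂ) (x : Fin m → ∀ i, H i),
      z = ∑ k, c k • AlgTensor.tprod H (x k) := by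
  have hz : z ∈ Submodule.span ℂ (Set.range (AlgTensor.tprod H)) :=
    Submodule.eq_top_iff'.1
      (PiTensorProduct.span_tprod_eq_top (R := ℂ) (s := fun i => (H i : Type u))) z
  obtain ⟨m, c, g, hg⟩ := Submodule.mem_span_set'.1 hz
  choose x hx using fun k => (g k).2
  exact ⟨m, c, x, by simp only [hx, hg]⟩

/-- The operator `⨂ᵢ Aᵢ` on the algebraic tensor product. -/
def AlgTensor.map (A : ∀ i, H i →L[ℂ] H i) : AlgTensor H →ₗ[ℂ] AlgTensor H :=
  PiTensorProduct.map (fun i => (A i : H i →ₗ[ℂ] H i))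

lemma AlgTensor.map_tprod (A : ∀ i, H i →L[ℂ] H i) (x : ∀ i, H i) :
    AlgTensor.map A (AlgTensor.tprod H x) = AlgTensor.tprod H (fun i => A i (x i)) :=
  PiTensorProduct.map_tprod _ _

variable [Fintype ι]

/-- The linear functional `⨂ᵢ yᵢ ↦ ∏ᵢ ⟪xᵢ, yᵢ⟫`. -/
def AlgTensor.functional (x : ∀ i, H i) : AlgTensor H →ₗ[ℂ] ℂ :=
  PiTensorProduct.lift
    ((MultilinearMap.mkPiAlgebra ℂ ι ℂ).compLinearMap (fun i => innerₛₗ ℂ (x i)))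

lemma AlgTensor.functional_tprod (x y : ∀ i, H i) :
    AlgTensor.functional x (AlgTensor.tprod H y) = ∏ i, ⟪x i, y i⟫_ℂ := by
  unfold AlgTensor.functional AlgTensor.tprod
  erw [PiTensorProduct.lift.tprod]
  simp

lemma AlgTensor.star_functional_sum {m : ℕ} (c : Fin m → ℂ) (y : Fin m → ∀ i, H i)
    (x : ∀ i, H i) :
    star (AlgTensor.functional x (∑ k, c k • AlgTensor.tprod H (y k))) =
      ∑ k, star (c k) * AlgTensor.functional (y k) (AlgTensor.tprod H x) := by
  simp only [map_sum, map_smul, AlgTensor.functional_tprod, smul_eq_mul, star_sum, star_mul',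
    star_prod]
  refine Finset.sum_congr rfl fun k _ => ?_
  congr 1
  exact Finset.prod_congr rfl fun i _ => inner_conj_symm _ _

/-- The sesquilinear form with value `∏ᵢ ⟪yᵢ, xᵢ⟫` at `(⨂ᵢ xᵢ, ⨂ᵢ yᵢ)`, linear in the first slot and
antilinear in the second. -/
def AlgTensor.form : AlgTensor H →ₗ[ℂ] (AlgTensor H →ₛₗ[starRingEnd ℂ] ℂ) :=
  PiTensorProduct.lift
    { toFun := fun x =>
        { toFun := fun z => star (AlgTensor.functional x z)
          map_add' := fun a b => by simp
          map_smul' := fun c a => by simp }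
      map_update_add' := by
        intro _ x i a b
        ext z
        obtain ⟨m, c, y, rfl⟩ := AlgTensor.exists_sum z
        simp only [LinearMap.coe_mk, AddHom.coe_mk, LinearMap.add_apply,
          AlgTensor.star_functional_sum, MultilinearMap.map_update_add, map_add, mul_add,
          Finset.sum_add_distrib]
      map_update_smul' := by
        intro _ x i r a
        ext z
        obtain ⟨m, c, y, rfl⟩ := AlgTensor.exists_sum z
        simp only [LinearMap.coe_mk, AddHom.coe_mk, LinearMap.smul_apply,
          AlgTensor.star_functional_sum, MultilinearMap.map_update_smul, map_smul, smul_eq_mul,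
          Finset.mul_sum]
        exact Finset.sum_congr rfl fun k _ => by ring }

lemma AlgTensor.form_tprod (x : ∀ i, H i) (z : AlgTensor H) :
    AlgTensor.form (AlgTensor.tprod H x) z = star (AlgTensor.functional x z) := by
  unfold AlgTensor.form AlgTensor.tprod
  erw [PiTensorProduct.lift.tprod]
  rfl

lemma AlgTensor.form_tprod_tprod (x y : ∀ i, H i) :
    AlgTensor.form (AlgTensor.tprod H x) (AlgTensor.tprod H y) = ∏ i, ⟪y i, x i⟫_ℂ := by
  rw [AlgTensor.form_tprod, AlgTensor.functional_tprod, star_prod]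
  exact Finset.prod_congr rfl fun i _ => inner_conj_symm _ _

lemma AlgTensor.form_sum_sum {m l : ℕ} (c : Fin m → ℂ) (x : Fin m → ∀ i, H i)
    (d : Fin l → ℂ) (y : Fin l → ∀ i, H i) :
    AlgTensor.form (∑ k, c k • AlgTensor.tprod H (x k)) (∑ j, d j • AlgTensor.tprod H (y j)) =
      ∑ j, ∑ k, star (d j) * c k * ∏ i, ⟪y j i, x k i⟫_ℂ := by
  simp only [map_sum, map_smulₛₗ, LinearMap.sum_apply, LinearMap.smul_apply,
    AlgTensor.form_tprod_tprod, smul_eq_mul, RingHom.id_apply, Finset.mul_sum]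
  refine Finset.sum_congr rfl fun j _ => Finset.sum_congr rfl fun k _ => ?_
  rw [mul_assoc]
  rfl

/-- The standard inner product on the algebraic tensor product,
`⟪⨂ᵢ xᵢ, ⨂ᵢ yᵢ⟫ = ∏ᵢ ⟪xᵢ, yᵢ⟫`. -/
instance AlgTensor.core : PreInnerProductSpace.Core ℂ (AlgTensor H) where
  inner x y := AlgTensor.form y x
  conj_inner_symm x y := by
    obtain ⟨m, c, a, rfl⟩ := AlgTensor.exists_sum x
    obtain ⟨l, d, b, rfl⟩ := AlgTensor.exists_sum y
    rw [AlgTensor.form_sum_sum, AlgTensor.form_sum_sum]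
    simp only [map_sum, map_mul, map_prod, inner_conj_symm]
    rw [Finset.sum_comm]
    refine Finset.sum_congr rfl fun j _ => Finset.sum_congr rfl fun k _ => ?_
    simp [mul_comm]
  re_inner_nonneg x := by
    obtain ⟨m, c, a, rfl⟩ := AlgTensor.exists_sum x
    rw [AlgTensor.form_sum_sum]
    have h := (HilbSp.posSemidef_prod_gram a Finset.univ).re_dotProduct_nonneg c
    convert h using 2
    simp only [dotProduct, Matrix.mulVec, Matrix.of_apply, Pi.star_apply, Finset.mul_sum]
    refine Finset.sum_congr rfl fun j _ => Finset.sum_congr rfl fun k _ => ?_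
    ring
  add_left x y z := by simp
  smul_left x y r := by simp

instance AlgTensor.seminormed : SeminormedAddCommGroup (AlgTensor H) :=
  InnerProductSpace.Core.toSeminormedAddCommGroup (𝕜 := ℂ)

instance AlgTensor.innerProd : InnerProductSpace ℂ (AlgTensor H) := .ofCore _

lemma AlgTensor.inner_def (x y : AlgTensor H) : ⟪x, y⟫_ℂ = AlgTensor.form y x := rfl

lemma AlgTensor.norm_map_le (A : ∀ i, H i →L[ℂ] H i) (z : AlgTensor H) :
    ‖AlgTensor.map A z‖ ≤ (∏ i, ‖A i‖) * ‖z‖ := by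
  have key : ‖AlgTensor.map A z‖ ^ 2 ≤ ((∏ i, ‖A i‖) * ‖z‖) ^ 2 := by
    rw [mul_pow, ← Finset.prod_pow, @norm_sq_eq_re_inner ℂ, @norm_sq_eq_re_inner ℂ _ _ _ _ z]
    obtain ⟨m, c, x, rfl⟩ := AlgTensor.exists_sum z
    have h := (HilbSp.posSemidef_prod_gram_sub x A Finset.univ).re_dotProduct_nonneg c
    simp only [map_sum, map_smul, AlgTensor.map_tprod]
    rw [AlgTensor.inner_def, AlgTensor.inner_def, AlgTensor.form_sum_sum, AlgTensor.form_sum_sum]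
    rw [← sub_nonneg]
    convert h using 1
    rw [← RCLike.re_ofReal_mul, ← map_sub]
    congr 1
    simp only [dotProduct, Matrix.mulVec, Matrix.of_apply, Pi.star_apply, Matrix.sub_apply,
      Matrix.smul_apply, Finset.mul_sum, Complex.real_smul]
    rw [← Finset.sum_sub_distrib]
    refine Finset.sum_congr rfl fun j _ => ?_
    rw [← Finset.sum_sub_distrib]
    refine Finset.sum_congr rfl fun k _ => ?_
    simp only [RCLike.ofReal_eq_complex_ofReal]
    ring
  exact le_of_sq_le_sq key (by positivity)

end AlgebraicTensor

section HilbertTensor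

variable {ι : Type} [Fintype ι]


/-- The Hilbert space tensor product `⨂ᵢ Hᵢ` of a finite family: the completion of the algebraic
tensor product. For the empty family it is one-dimensional. -/
def HilbSp.tensor (H : ι → HilbSp.{u}) : HilbSp.{u} :=
  { carrier := UniformSpace.Completion (AlgTensor H) }

/-- The elementary tensor `⨂ᵢ xᵢ`. -/
def HilbSp.tprod {H : ι → HilbSp.{u}} (x : ∀ i, H i) : HilbSp.tensor H :=
  ((AlgTensor.tprod H x : AlgTensor H) : UniformSpace.Completion (AlgTensor H))

lemma HilbSp.inner_tprod {H : ι → HilbSp.{u}} (x y : ∀ i, H i) :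
    ⟪HilbSp.tprod x, HilbSp.tprod y⟫_ℂ = ∏ i, ⟪x i, y i⟫_ℂ := by
  refine (UniformSpace.Completion.inner_coe (𝕜 := ℂ) (E := AlgTensor H) _ _).trans ?_
  exact AlgTensor.form_tprod_tprod y x

/-- The tensor product `⨂ᵢ Aᵢ` of bounded operators. -/
def HilbSp.tensorMap {H : ι → HilbSp.{u}} (A : ∀ i, H i →L[ℂ] H i) :
    HilbSp.tensor H →L[ℂ] HilbSp.tensor H :=
  ((AlgTensor.map A).mkContinuous (∏ i, ‖A i‖) (AlgTensor.norm_map_le A)).completion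

lemma HilbSp.tensorMap_tprod {H : ι → HilbSp.{u}} (A : ∀ i, H i →L[ℂ] H i) (x : ∀ i, H i) :
    HilbSp.tensorMap A (HilbSp.tprod x) = HilbSp.tprod (fun i => A i (x i)) := by
  refine (ContinuousLinearMap.completion_apply_coe _ _).trans ?_
  exact congrArg _ (AlgTensor.map_tprod A x)

lemma HilbSp.dense_span_tprod (H : ι → HilbSp.{u}) :
    Dense (Submodule.span ℂ (Set.range (HilbSp.tprod (H := H))) : Set (HilbSp.tensor H)) := by
  refine Dense.mono ?_ (UniformSpace.Completion.denseRange_coe (α := AlgTensor H))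
  rintro _ ⟨z, rfl⟩
  obtain ⟨m, c, x, rfl⟩ := AlgTensor.exists_sum z
  have h : ((∑ k, c k • AlgTensor.tprod H (x k) : AlgTensor H) :
      UniformSpace.Completion (AlgTensor H)) =
      ∑ k, c k • (HilbSp.tprod (x k) : UniformSpace.Completion (AlgTensor H)) := by
    refine (map_sum (UniformSpace.Completion.toComplL (𝕜 := ℂ) (E := AlgTensor H)) _ _).trans ?_
    exact Finset.sum_congr rfl fun k _ =>
      map_smul (UniformSpace.Completion.toComplL (𝕜 := ℂ) (E := AlgTensor H)) _ _
  rw [h]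
  exact Submodule.sum_mem _ fun k _ =>
    Submodule.smul_mem _ _ (Submodule.subset_span ⟨x k, rfl⟩)

end HilbertTensor
/-! ### Trace class operators and quantum operations -/

/-- `T` is trace class, in the form `T = ∑ₖ |xₖ⟩⟨yₖ|` with `∑ₖ ‖xₖ‖ ‖yₖ‖ < ∞` (on a Hilbert space
this is the same as the summability of the singular values of `T`). -/
def IsTraceClass (H : HilbSp.{u}) (T : H →L[ℂ] H) : Prop :=
  ∃ x y : ℕ → H, Summable (fun k => ‖x k‖ * ‖y k‖) ∧
    ∀ z, HasSum (fun k => ⟪y k, z⟫_ℂ • x k) (T z)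

lemma IsTraceClass.add {H : HilbSp.{u}} {S T : H →L[ℂ] H} (hS : IsTraceClass H S)
    (hT : IsTraceClass H T) : IsTraceClass H (S + T) := by
  obtain ⟨x, y, hxy, h⟩ := hS
  obtain ⟨x', y', hxy', h'⟩ := hT
  let e : ℕ ≃ ℕ ⊕ ℕ := Equiv.natSumNatEquivNat.symm
  refine ⟨Sum.elim x x' ∘ e, Sum.elim y y' ∘ e, ?_, fun z => ?_⟩
  · refine (e.summable_iff (f := fun k => ‖Sum.elim x x' k‖ * ‖Sum.elim y y' k‖)).2 ?_
    exact (hxy.hasSum.sum (f := fun k => ‖Sum.elim x x' k‖ * ‖Sum.elim y y' k‖)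
      hxy'.hasSum).summable
  · refine (e.hasSum_iff (f := fun k => ⟪Sum.elim y y' k, z⟫_ℂ • Sum.elim x x' k)).2 ?_
    exact (h z).sum (f := fun k => ⟪Sum.elim y y' k, z⟫_ℂ • Sum.elim x x' k) (h' z)

/-- The space `𝒮(H)` of trace class operators. -/
def TraceClass (H : HilbSp.{u}) : Submodule ℂ (H →L[ℂ] H) where
  carrier := {T | IsTraceClass H T}
  add_mem' := IsTraceClass.add
  zero_mem' := ⟨0, 0, by simp, fun z => by simp⟩
  smul_mem' := by
    rintro c T ⟨x, y, hxy, h⟩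
    refine ⟨fun k => c • x k, y, ?_, fun z => ?_⟩
    · simpa [norm_smul, mul_assoc] using hxy.mul_left ‖c‖
    · have h2 := (h z).const_smul c
      simpa [smul_comm c] using h2

/-- The trace of an operator, computed in an orthonormal basis (for trace class operators the choice
of the basis is irrelevant). -/
def opTrace {H : HilbSp.{u}} (T : H →L[ℂ] H) : ℂ :=
  ∑' i, ⟪(exists_hilbertBasis ℂ H).choose_spec.choose i,
    T ((exists_hilbertBasis ℂ H).choose_spec.choose i)⟫_ℂ

/-- A quantum operation from `H` to `K`: a completely positive linear map `Φ : 𝒮(H) → 𝒮(K)`, that is,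
one for which every positive `n × n` block operator `(T i j)` on `Hⁿ` is sent to a positive block
operator `(Φ (T i j))` on `Kⁿ`. -/
structure QuantumOp (H : HilbSp.{u}) (K : HilbSp.{v}) where
  toFun : TraceClass H →ₗ[ℂ] TraceClass K
  completelyPositive : ∀ (n : ℕ) (T : Fin n → Fin n → TraceClass H),
    (∀ x : Fin n → H, 0 ≤ ∑ i, ∑ j, ⟪x i, (T i j : H →L[ℂ] H) (x j)⟫_ℂ) →
    ∀ y : Fin n → K, 0 ≤ ∑ i, ∑ j, ⟪y i, (toFun (T i j) : K →L[ℂ] K) (y j)⟫_ℂ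

/-- A quantum instrument: a family of quantum operations, indexed by the outcomes, whose sum is
trace preserving. -/
def IsInstrument {H : HilbSp.{u}} {K : HilbSp.{u}} {O : Type v} [Fintype O]
    (f : O → QuantumOp H K) : Prop :=
  ∀ T : TraceClass H,
    opTrace (∑ a, ((f a).toFun T : K →L[ℂ] K)) = opTrace (T : H →L[ℂ] H)

/-! ### Causal structures -/

/-- A causal structure: a directed acyclic graph. -/
structure CausalGraph (V : Type) where
  adj : V → V → Prop
  acyclic : ∀ v, ¬ Relation.TransGen adj v v

namespace CausalGraph

variable {V : Type} [Fintype V] (G : CausalGraph V)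

/-- The edges `src → tar`. -/
def Edge : Type := {p : V × V // G.adj p.1 p.2}

variable {G} in
/-- The source node of an edge. -/
def Edge.src (e : G.Edge) : V := e.1.1

variable {G} in
/-- The target node of an edge. -/
def Edge.tar (e : G.Edge) : V := e.1.2

open Classical in
instance : Fintype G.Edge := inferInstanceAs (Fintype {p : V × V // G.adj p.1 p.2})

open Classical in
/-- The edges coming in at `v`. -/
def incoming (v : V) : Finset G.Edge := {e | e.tar = v}

open Classical in
/-- The edges going out of `v`. -/
def outgoing (v : V) : Finset G.Edge := {e | e.src = v}

open Classical in
/-- The nodes that are executed before stage `k`: none for `k = 0`, and up to stage `k + 1` all those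
nodes whose parents were executed before stage `k`. -/
def executed : ℕ → Finset V
  | 0 => ∅
  | k + 1 => {v | ∀ u, G.adj u v → u ∈ executed k}

open Classical in
/-- The nodes executed (in parallel) at stage `k`. -/
def layer (k : ℕ) : Finset V := G.executed (k + 1) \ G.executed k

open Classical in
/-- The edges that carry a system right before stage `k`: those leading from an executed node to a
node that is not yet executed. -/
def cut (k : ℕ) : Finset G.Edge := {e | e.src ∈ G.executed k ∧ e.tar ∉ G.executed k}

open Classical in
/-- The edges whose systems pass by stage `k` unaffected. -/
def passing (k : ℕ) : Finset G.Edge := {e | e.src ∈ G.executed k ∧ e.tar ∉ G.executed (k + 1)}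

variable {G}

/-- The composite system `⨂_{e ∈ S} H_e` carried by a set `S` of edges. -/
def system (H : G.Edge → HilbSp.{u}) (S : Finset G.Edge) : HilbSp.{u} :=
  HilbSp.tensor (fun e : S => H e)

/-- The elementary tensor `⨂_{e ∈ S} x_e`. -/
def elementary {H : G.Edge → HilbSp.{u}} (S : Finset G.Edge) (x : ∀ e, H e) : system H S :=
  HilbSp.tprod (fun e : S => x e)

/-- If the edge set `C` is the disjoint union of sets `S v`, `v ∈ L`, and a set `D`, this says that
the operator `T` on `⨂_{e ∈ C} H_e` is the tensor product of the operators `A v` on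
`⨂_{e ∈ S v} H_e`, `v ∈ L`, and `B` on `⨂_{e ∈ D} H_e`. -/
def IsTensorOp {H : G.Edge → HilbSp.{u}} (L : Finset V) (S : V → Finset G.Edge)
    (D C : Finset G.Edge) (A : ∀ v, system H (S v) →L[ℂ] system H (S v))
    (B : system H D →L[ℂ] system H D) (T : system H C →L[ℂ] system H C) : Prop :=
  ∀ x y : ∀ e, H e, ⟪elementary C x, T (elementary C y)⟫_ℂ =
    (∏ v ∈ L, ⟪elementary (S v) x, A v (elementary (S v) y)⟫_ℂ) *
      ⟪elementary D x, B (elementary D y)⟫_ℂ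

/-- The quantum operation `F` is the parallel composition of the operations `g v` at all nodes `v` of
stage `k`, together with the identity on the passing systems: it sends every product operator
`(⨂_v A_v) ⊗ B` to `(⨂_v g_v(A_v)) ⊗ B`. -/
def IsParallel {H : G.Edge → HilbSp.{u}} (k : ℕ)
    (g : ∀ v, QuantumOp (system H (G.incoming v)) (system H (G.outgoing v)))
    (F : QuantumOp (system H (G.cut k)) (system H (G.cut (k + 1)))) : Prop :=
  ∀ (A : ∀ v, TraceClass (system H (G.incoming v))) (B : TraceClass (system H (G.passing k)))
    (T : TraceClass (system H (G.cut k))),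
    IsTensorOp (G.layer k) G.incoming (G.passing k) (G.cut k) (fun v => (A v).1) B.1 T.1 →
    IsTensorOp (G.layer k) G.outgoing (G.passing k) (G.cut (k + 1))
      (fun v => ((g v).toFun (A v)).1) B.1 (F.toFun T).1

/-- The number `p` is the value of the diagram `G` with the systems `H e` on its edges and the
quantum operations `g v` at its nodes: starting from the scalar `1` (as an operator on the empty
tensor product), the nodes are executed stage by stage, and `p` is the resulting scalar. -/
def HasValue {H : G.Edge → HilbSp.{u}}
    (g : ∀ v, QuantumOp (system H (G.incoming v)) (system H (G.outgoing v))) (p : ℂ) : Prop :=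
  ∃ (F : ∀ k, QuantumOp (system H (G.cut k)) (system H (G.cut (k + 1))))
    (ω : ∀ k, TraceClass (system H (G.cut k))),
    (∀ k, IsParallel k g (F k)) ∧ (ω 0).1 = ContinuousLinearMap.id ℂ _ ∧
      (∀ k, ω (k + 1) = (F k).toFun (ω k)) ∧ opTrace (ω (Fintype.card V)).1 = p

variable (G)

/-- `P` is a quantum correlation on `G`: there are Hilbert spaces on the edges and quantum
instruments at the nodes such that `P(o)` is the value of the resulting diagram. -/
def IsQuantumCorrelation {O : V → Type v} [∀ v, Fintype (O v)] (P : (∀ v, O v) → ℝ) : Prop :=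
  ∃ (H : G.Edge → HilbSp.{u})
    (f : ∀ v, O v → QuantumOp (system H (G.incoming v)) (system H (G.outgoing v))),
    (∀ v, IsInstrument (f v)) ∧ ∀ o, HasValue (fun v => f v (o v)) (P o : ℂ)

end CausalGraph

/-! ### Marginals and the Bell scenario -/

section Marginals

variable {V : Type} [Fintype V] [DecidableEq V] {O : V → Type v} [∀ v, Fintype (O v)]

open Classical in
/-- The marginal probability `P(o[U])` of the values that the outcome tuple `o` has on `U`. -/
def marginal (P : (∀ v, O v) → ℝ) (U : Set V) (o : ∀ v, O v) : ℝ :=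
  ∑ o' : ∀ v, O v with ∀ v ∈ U, o' v = o v, P o'

/-- The conditional probability `P(o[U] | o[W])`. -/
def condProb (P : (∀ v, O v) → ℝ) (U W : Set V) (o : ∀ v, O v) : ℝ :=
  marginal P (U ∪ W) o / marginal P W o

end Marginals

/-- The nodes of the `n`-party Bell scenario. -/
inductive BellNode (n : ℕ) where
  | source : BellNode n
  | setting (i : Fin n) : BellNode n
  | outcome (i : Fin n) : BellNode n
  deriving DecidableEq, Fintype

namespace BellNode

/-- The edges `s → aᵢ` and `xᵢ → aᵢ`. -/
inductive Adj {n : ℕ} : BellNode n → BellNode n → Prop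
  | source (i : Fin n) : Adj source (outcome i)
  | setting (i : Fin n) : Adj (setting i) (outcome i)

variable {n : ℕ} {O : BellNode n → Type v} [∀ v, Fintype (O v)]

/-- The free will equation `P(o[x₁ … xₙ s]) = P(o[x₁]) ⋯ P(o[xₙ]) P(o[s])`. -/
def FreeWill (P : (∀ v, O v) → ℝ) : Prop :=
  ∀ o, marginal P (Set.range setting ∪ {source}) o =
    (∏ i, marginal P {setting i} o) * marginal P {source} o

/-- `P(o[a₁ … aₙ] | o[x₁ … xₙ s]) = ⟨ψ_{o[s]}| E^{o[x₁]}_{o[a₁]} ⊗ ⋯ ⊗ E^{o[xₙ]}_{o[aₙ]} |ψ_{o[s]}⟩`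
for unit vectors `ψ` and POVMs `E` on Hilbert spaces of arbitrary dimension, for all outcomes with
`P(o[xᵢ]) > 0` and `P(o[s]) > 0`. -/
def HasQuantumModel (P : (∀ v, O v) → ℝ) : Prop :=
  ∃ (H : Fin n → HilbSp.{u}) (ψ : O source → HilbSp.tensor H)
    (E : ∀ i, O (setting i) → O (outcome i) → (H i →L[ℂ] H i)),
    (∀ s, ‖ψ s‖ = 1) ∧
    (∀ i x a, (E i x a).IsPositive) ∧
    (∀ i x, ∑ a, E i x a = ContinuousLinearMap.id ℂ (H i)) ∧
    ∀ o, (∀ i, 0 < marginal P {setting i} o) → 0 < marginal P {source} o →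
      (condProb P (Set.range outcome) (Set.range setting ∪ {source}) o : ℂ) =
        ⟪ψ (o source),
          HilbSp.tensorMap (fun i => E i (o (setting i)) (o (outcome i))) (ψ (o source))⟫_ℂ

end BellNode

/-- The causal structure of the `n`-party Bell scenario. -/
def bellScenario (n : ℕ) : CausalGraph (BellNode n) where
  adj := BellNode.Adj
  acyclic := by
    intro v hv
    obtain ⟨u, h, hu⟩ := Relation.TransGen.head'_iff.1 hv
    rcases Relation.ReflTransGen.cases_tail hu with rfl | ⟨w, -, hw⟩
    · cases h
    · cases h <;> cases hw

end

/-! The diagram has only two stages that matter: the source and the settings emit systems, then the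
parties consume them.

From correlation to model. Let the source with outcome s emit ρ_s on the systems of the edges s →
aᵢ, and let the setting xᵢ = x emit σ_{i,x} on the edge xᵢ → aᵢ; both are unnormalised states. For a
party, T ↦ tr f_a(T ⊗ σ_{i,x}) is a positive functional on trace class operators. Operations are
merely completely positive linear maps, without any continuity assumption, so it has to be shown
that such functionals are bounded (`TraceClass.exists_bound_of_positive`) and of the form T ↦ tr(E
T) with E bounded and positive (`TraceClass.exists_density_of_positive`). The same result applied to
the whole second stage gives an operator M, and comparison on product rank one operators yields M =
⨂ᵢ Eᵢ, although the stage is specified on product operators only. Expanding ρ_s = ∑ₖ |φₖ⟩⟨φₖ| gives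
P(o) = ∑ₖ ⟨φₖ|⨂ᵢ Eᵢ|φₖ⟩ (`exists_mixture_of_isQuantumCorrelation`). As the instruments preserve the
trace, ∑ₐ E_{i,x,a} = q_i(x) 1 with q_i(x) = tr σ_{i,x}. Summing over the aᵢ leaves p(s) ∏ᵢ q_i(xᵢ),
which is the free will equation. Dividing by the weights gives POVMs and a mixed state. The mixture
becomes the pure state ∑ₖ φₖ ⊗ eₖ ⊗ ⋯ ⊗ eₖ when each party receives an ancilla ℓ² on which its
measurement acts trivially (`HilbSp.exists_purification`).

From model to correlation. The edge xᵢ → aᵢ carries a classical register with an orthonormal basis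
indexed by the values of xᵢ. Setting i prepares the basis vector of x with weight P(x), the source
prepares ψ_s with weight P(s), and party i reads its register and measures the corresponding POVM
(`isQuantumCorrelation_of_registers`). All operations, including the global ones for the stages, are
of the form "measure an effect, prepare a vector". The free will equation turns the resulting
weights times the model probability into P. -/

noncomputable section

set_option linter.unusedSectionVars false

/-! ### Vectors and operators determined by total families -/

section DenseFamilies

variable {J K E F : Type*} [NormedAddCommGroup E] [InnerProductSpace ℂ E] [CompleteSpace E]
  [NormedAddCommGroup F] [InnerProductSpace ℂ F] [CompleteSpace F]

lemma eq_of_inner_dense_family {a : J → E}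
    (ha : Dense (Submodule.span ℂ (Set.range a) : Set E)) {z z' : E}
    (h : ∀ j, ⟪a j, z⟫_ℂ = ⟪a j, z'⟫_ℂ) : z = z' := by
  refine ext_inner_left ℂ fun w => ?_
  have hcl : IsClosed {w : E | ⟪w, z⟫_ℂ = ⟪w, z'⟫_ℂ} :=
    isClosed_eq (by fun_prop) (by fun_prop)
  refine hcl.closure_subset_iff.2 ?_ (ha w)
  intro w hw
  induction hw using Submodule.span_induction with
  | mem x hx => obtain ⟨j, rfl⟩ := hx; exact h j
  | zero => simp
  | add x y _ _ hx hy =>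
    simp only [Set.mem_ofPred_eq, inner_add_left] at *
    rw [hx, hy]
  | smul c x _ hx =>
    simp only [Set.mem_ofPred_eq, inner_smul_left] at *
    rw [hx]

lemma ContinuousLinearMap.eq_of_dense_family {a : J → E}
    (ha : Dense (Submodule.span ℂ (Set.range a) : Set E)) {S T : E →L[ℂ] F}
    (h : ∀ j, S (a j) = T (a j)) : S = T :=
  ContinuousLinearMap.ext_on ha (by rintro _ ⟨j, rfl⟩; exact h j)

lemma ContinuousLinearMap.eq_of_inner_dense_family {a : J → E} {b : K → F}
    (ha : Dense (Submodule.span ℂ (Set.range a) : Set E))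
    (hb : Dense (Submodule.span ℂ (Set.range b) : Set F)) {S T : E →L[ℂ] F}
    (h : ∀ i j, ⟪b i, S (a j)⟫_ℂ = ⟪b i, T (a j)⟫_ℂ) : S = T :=
  ContinuousLinearMap.eq_of_dense_family ha fun j =>
    _root_.eq_of_inner_dense_family hb fun i => h i j

lemma ContinuousLinearMap.adjoint_apply_eq_of_dense_family {a : J → E}
    (ha : Dense (Submodule.span ℂ (Set.range a) : Set E)) {V : E →L[ℂ] F} {z : F} {w : E}
    (h : ∀ j, ⟪V (a j), z⟫_ℂ = ⟪a j, w⟫_ℂ) : V.adjoint z = w :=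
  _root_.eq_of_inner_dense_family ha fun j => by
    rw [ContinuousLinearMap.adjoint_inner_right, h]

/-- A family whose Gram matrix is `c` times that of a total family is its image under a bounded
operator which multiplies inner products by `c`. -/
lemma exists_map_of_gram {a : J → E} {b : J → F}
    (ha : Dense (Submodule.span ℂ (Set.range a) : Set E)) {c : ℝ} (hc : 0 ≤ c)
    (h : ∀ i j, ⟪b i, b j⟫_ℂ = c * ⟪a i, a j⟫_ℂ) :
    ∃ V : E →L[ℂ] F, (∀ j, V (a j) = b j) ∧ (∀ u v, ⟪V u, V v⟫_ℂ = c * ⟪u, v⟫_ℂ) := by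
  let e := Finsupp.linearCombination ℂ a
  let f := Finsupp.linearCombination ℂ b
  have hin : ∀ x y, ⟪f x, f y⟫_ℂ = c * ⟪e x, e y⟫_ℂ := by
    intro x y
    simp only [e, f, Finsupp.linearCombination_apply, Finsupp.sum, sum_inner, inner_sum,
      inner_smul_left, inner_smul_right, h, Finset.mul_sum]
    refine Finset.sum_congr rfl fun i _ => Finset.sum_congr rfl fun j _ => ?_
    ring
  -- The family `a` may be linearly dependent; this bound makes `f` vanish wherever `e` does, so
  -- that `f` descends to the span and extends continuously.
  have hnorm : ∀ x, ‖f x‖ ≤ √c * ‖e x‖ := by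
    intro x
    have h1 := hin x x
    rw [inner_self_eq_norm_sq_to_K, inner_self_eq_norm_sq_to_K] at h1
    have h2 : ‖f x‖ ^ 2 = c * ‖e x‖ ^ 2 := by
      have := congrArg Complex.re h1
      simpa [← Complex.ofReal_pow] using this
    rw [← Real.sqrt_sq (norm_nonneg (f x)), h2, Real.sqrt_mul hc, Real.sqrt_sq (norm_nonneg _)]
  have hd : DenseRange e := by
    have : Set.range e = (Submodule.span ℂ (Set.range a) : Set E) := by
      rw [← Finsupp.range_linearCombination]; rfl
    rw [DenseRange, this]; exact ha
  have hVe : ∀ x, f.extendOfNorm e (e x) = f x := LinearMap.extendOfNorm_eq hd ⟨_, hnorm⟩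
  refine ⟨f.extendOfNorm e, fun j => ?_, fun u v => ?_⟩
  · have := hVe (Finsupp.single j 1)
    simpa [e, f] using this
  · refine hd.induction_on₂ (p := fun u v => ⟪f.extendOfNorm e u, f.extendOfNorm e v⟫_ℂ = c * ⟪u, v⟫_ℂ)
      (isClosed_eq (by fun_prop) (by fun_prop)) (fun x y => ?_) u v
    rw [hVe, hVe, hin]

end DenseFamilies

/-! ### Rank one expansions and the trace -/

section TraceClass

/-- `T = ∑ₖ |xₖ⟩⟨yₖ|` with `∑ₖ ‖xₖ‖ ‖yₖ‖ < ∞`. -/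
def HasRankOneSum {E F ι : Type*} [NormedAddCommGroup E] [InnerProductSpace ℂ E]
    [NormedAddCommGroup F] [InnerProductSpace ℂ F]
    (T : E →L[ℂ] F) (x : ι → F) (y : ι → E) : Prop :=
  Summable (fun k => ‖x k‖ * ‖y k‖) ∧ ∀ z, HasSum (fun k => ⟪y k, z⟫_ℂ • x k) (T z)

namespace HasRankOneSum

variable {ι E F E' F' : Type*} [NormedAddCommGroup E] [InnerProductSpace ℂ E] [CompleteSpace E]
  [NormedAddCommGroup F] [InnerProductSpace ℂ F] [CompleteSpace F]
  [NormedAddCommGroup E'] [InnerProductSpace ℂ E'] [CompleteSpace E']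
  [NormedAddCommGroup F'] [InnerProductSpace ℂ F'] [CompleteSpace F']
  {T : E →L[ℂ] F} {x : ι → F} {y : ι → E}

lemma conj (h : HasRankOneSum T x y) (A : F →L[ℂ] F') (B : E' →L[ℂ] E) :
    HasRankOneSum (A ∘L T ∘L B) (fun k => A (x k)) (fun k => B.adjoint (y k)) := by
  constructor
  · refine Summable.of_nonneg_of_le (fun k => by positivity) (fun k => ?_)
      (h.1.mul_left (‖A‖ * ‖B.adjoint‖))
    calc ‖A (x k)‖ * ‖B.adjoint (y k)‖ ≤ (‖A‖ * ‖x k‖) * (‖B.adjoint‖ * ‖y k‖) := by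
          gcongr <;> exact ContinuousLinearMap.le_opNorm _ _
      _ = _ := by ring
  · intro z
    have := A.hasSum (h.2 (B z))
    simpa [ContinuousLinearMap.adjoint_inner_left] using this

lemma comp_left (h : HasRankOneSum T x y) (A : F →L[ℂ] F') :
    HasRankOneSum (A ∘L T) (fun k => A (x k)) y := by
  have := h.conj A (ContinuousLinearMap.id ℂ E)
  rwa [ContinuousLinearMap.adjoint_id] at this

lemma hasSum_inner (h : HasRankOneSum T x y) (w : F) (z : E) :
    HasSum (fun k => ⟪w, x k⟫_ℂ * ⟪y k, z⟫_ℂ) ⟪w, T z⟫_ℂ := by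
  have := (innerSL ℂ w).hasSum (h.2 z)
  simpa [mul_comm] using this

/-- Every absolutely summable family of rank one operators has a sum. -/
lemma exists_of_summable (h : Summable (fun k => ‖x k‖ * ‖y k‖)) :
    ∃ T : E →L[ℂ] F, HasRankOneSum T x y := by
  have hs : Summable (fun k => InnerProductSpace.rankOne ℂ (x k) (y k)) :=
    Summable.of_norm (by simpa using h)
  refine ⟨∑' k, InnerProductSpace.rankOne ℂ (x k) (y k), h, fun z => ?_⟩
  have := (ContinuousLinearMap.apply ℂ F z).hasSum hs.hasSum
  simpa using this

lemma extend {κ : Type*} (h : HasRankOneSum T x y) {e : ι → κ} (he : Function.Injective e) :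
    HasRankOneSum T (Function.extend e x 0) (Function.extend e y 0) := by
  constructor
  · have : (fun k => ‖Function.extend e x 0 k‖ * ‖Function.extend e y 0 k‖) =
        Function.extend e (fun k => ‖x k‖ * ‖y k‖) 0 := by
      funext k
      by_cases hk : ∃ a, e a = k
      · obtain ⟨a, rfl⟩ := hk; simp [he.extend_apply]
      · simp [Function.extend_apply' _ _ _ hk]
    rw [this]
    exact (summable_extend_zero he).2 h.1
  · intro z
    have : (fun k => ⟪Function.extend e y 0 k, z⟫_ℂ • Function.extend e x 0 k) =
        Function.extend e (fun k => ⟪y k, z⟫_ℂ • x k) 0 := by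
      funext k
      by_cases hk : ∃ a, e a = k
      · obtain ⟨a, rfl⟩ := hk; simp [he.extend_apply]
      · simp [Function.extend_apply' _ _ _ hk]
    rw [this]
    exact (hasSum_extend_zero he).2 (h.2 z)

lemma restrict_support (h : HasRankOneSum T x y) :
    HasRankOneSum T (fun k : {k // ‖x k‖ * ‖y k‖ ≠ 0} => x k) (fun k => y k) := by
  refine ⟨h.1.subtype _, fun z => ?_⟩
  have := (hasSum_subtype_iff_of_support_subset (f := fun k => ⟪y k, z⟫_ℂ • x k)
    (s := {k | ‖x k‖ * ‖y k‖ ≠ 0}) (a := T z) ?_).2 (h.2 z)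
  · exact this
  · intro k hk hk'
    simp only [mul_eq_zero, norm_eq_zero] at hk'
    rcases hk' with h' | h' <;> simp [h'] at hk

/-- The index set may be taken to be `ℕ`. -/
lemma exists_nat (h : HasRankOneSum T x y) : ∃ (s : Set ι) (e : s → ℕ), Function.Injective e ∧
    HasRankOneSum T (Function.extend e (fun k : s => x k) 0)
      (Function.extend e (fun k : s => y k) 0) := by
  -- A summable family has countable support, so the nonzero terms can be numbered and the other
  -- places filled with zeros.
  have hc : (Function.support (fun k => ‖x k‖ * ‖y k‖)).Countable := h.1.countable_support
  have := hc.to_subtype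
  obtain ⟨e, he⟩ := exists_injective_nat (Function.support (fun k => ‖x k‖ * ‖y k‖))
  exact ⟨_, e, he, h.restrict_support.extend he⟩

end HasRankOneSum

variable {H : HilbSp.{u}} {ι : Type*}

lemma HasRankOneSum.isTraceClass {T : H →L[ℂ] H} {x y : ι → H} (h : HasRankOneSum T x y) :
    IsTraceClass H T := by
  obtain ⟨s, e, -, h'⟩ := h.exists_nat
  exact ⟨_, _, h'⟩

lemma HilbertBasis.sum_norm_inner_mul_le {κ E : Type*} [NormedAddCommGroup E]
    [InnerProductSpace ℂ E] (b : HilbertBasis κ ℂ E) (x y : E) (s : Finset κ) :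
    ∑ i ∈ s, ‖⟪b i, x⟫_ℂ‖ * ‖⟪b i, y⟫_ℂ‖ ≤ ‖x‖ * ‖y‖ := by
  refine (Real.sum_mul_le_sqrt_mul_sqrt _ _ _).trans ?_
  gcongr
  · exact Real.sqrt_le_iff.2 ⟨norm_nonneg _, b.orthonormal.sum_inner_products_le x⟩
  · exact Real.sqrt_le_iff.2 ⟨norm_nonneg _, b.orthonormal.sum_inner_products_le y⟩

/-- Interchange of summations in the double family ⟪y k, b i⟫ ⟪b i, x k⟫, which is absolutely
summable by Cauchy–Schwarz and Bessel. Summing over i first gives ⟪y k, x k⟫ by Parseval, summing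
over k first gives the diagonal entries of T. Hence the trace depends neither on the basis nor on
the expansion. -/
lemma HasRankOneSum.hasSum_basis {κ E : Type*} [NormedAddCommGroup E]
    [InnerProductSpace ℂ E] [CompleteSpace E] (b : HilbertBasis κ ℂ E) {T : E →L[ℂ] E}
    {x y : ι → E} (h : HasRankOneSum T x y) :
    Summable (fun k => ⟪y k, x k⟫_ℂ) ∧ HasSum (fun i => ⟪b i, T (b i)⟫_ℂ) (∑' k, ⟪y k, x k⟫_ℂ) := by
  have hs : Summable (fun p : ι × κ => ⟪y p.1, b p.2⟫_ℂ * ⟪b p.2, x p.1⟫_ℂ) := by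
    refine Summable.of_norm ?_
    have hle : ∀ k (s : Finset κ), ∑ i ∈ s, ‖⟪y k, b i⟫_ℂ * ⟪b i, x k⟫_ℂ‖ ≤ ‖x k‖ * ‖y k‖ := by
      intro k s
      refine le_trans (le_of_eq ?_) (b.sum_norm_inner_mul_le (x k) (y k) s)
      refine Finset.sum_congr rfl fun i _ => ?_
      rw [norm_mul, mul_comm, norm_inner_symm (y k)]
    refine (summable_prod_of_nonneg (fun _ => norm_nonneg _)).2 ⟨fun k => ?_, ?_⟩
    · exact summable_of_sum_le (fun _ => norm_nonneg _) (hle k)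
    · refine Summable.of_nonneg_of_le (fun k => tsum_nonneg fun _ => norm_nonneg _) (fun k => ?_) h.1
      exact Real.tsum_le_of_sum_le (fun _ => norm_nonneg _) (hle k)
  have h1 : HasSum (fun k => ⟪y k, x k⟫_ℂ) _ :=
    hs.hasSum.prod_fiberwise fun k => b.hasSum_inner_mul_inner (y k) (x k)
  refine ⟨h1.summable, ?_⟩
  rw [h1.tsum_eq]
  have hs' := hs.prod_symm
  have h2 : HasSum (fun i => ⟪b i, T (b i)⟫_ℂ) (∑' p : κ × ι, ⟪y p.2, b p.1⟫_ℂ * ⟪b p.1, x p.2⟫_ℂ) := by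
    refine hs'.hasSum.prod_fiberwise fun i => ?_
    simpa [mul_comm] using h.hasSum_inner (b i) (b i)
  convert h2 using 1
  exact ((Equiv.prodComm κ ι).tsum_eq _).symm

lemma HasRankOneSum.hasSum_opTrace {T : H →L[ℂ] H} {x y : ι → H} (h : HasRankOneSum T x y) :
    HasSum (fun k => ⟪y k, x k⟫_ℂ) (opTrace T) := by
  obtain ⟨h1, h2⟩ := h.hasSum_basis (exists_hilbertBasis ℂ H).choose_spec.choose
  rw [opTrace, h2.tsum_eq]
  exact h1.hasSum

lemma hasSum_inner_opTrace {κ : Type*} (b : HilbertBasis κ ℂ H) {T : H →L[ℂ] H}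
    (hT : IsTraceClass H T) : HasSum (fun i => ⟪b i, T (b i)⟫_ℂ) (opTrace T) := by
  obtain ⟨x, y, h⟩ := hT
  have h : HasRankOneSum T x y := h
  have := (h.hasSum_basis b).2
  rwa [h.hasSum_opTrace.tsum_eq] at this

lemma IsTraceClass.conj {H K : HilbSp.{u}} {T : H →L[ℂ] H} (hT : IsTraceClass H T)
    (A : H →L[ℂ] K) (B : K →L[ℂ] H) : IsTraceClass K (A ∘L T ∘L B) := by
  obtain ⟨x, y, h⟩ := hT
  exact (HasRankOneSum.conj (T := T) h A B).isTraceClass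

lemma IsTraceClass.comp_left {T : H →L[ℂ] H} (hT : IsTraceClass H T)
    (A : H →L[ℂ] H) : IsTraceClass H (A ∘L T) := by
  obtain ⟨x, y, h⟩ := hT
  exact (HasRankOneSum.comp_left (T := T) h A).isTraceClass

/-- A rank one expansion of T turns both traces into the same series ∑ₖ ⟪y k, B (A (x k))⟫. -/
lemma opTrace_comp_comm {H K : HilbSp.{u}} {T : H →L[ℂ] H} (hT : IsTraceClass H T)
    (A : H →L[ℂ] K) (B : K →L[ℂ] H) : opTrace (A ∘L T ∘L B) = opTrace (B ∘L A ∘L T) := by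
  obtain ⟨x, y, h⟩ := hT
  have h : HasRankOneSum T x y := h
  have h1 := (h.conj A B).hasSum_opTrace
  have h2 := ((h.comp_left A).comp_left B).hasSum_opTrace
  simp only [ContinuousLinearMap.adjoint_inner_left] at h1
  exact h1.unique h2

/-- The trace as a linear functional on the trace class operators. -/
def TraceClass.trace (H : HilbSp.{u}) : TraceClass H →ₗ[ℂ] ℂ where
  toFun T := opTrace T.1
  map_add' S T := by
    obtain ⟨w, b, -⟩ := exists_hilbertBasis ℂ H
    refine (hasSum_inner_opTrace b (S + T).2).unique ?_
    simpa [inner_add_right] using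
      (hasSum_inner_opTrace b S.2).add (hasSum_inner_opTrace b T.2)
  map_smul' c T := by
    obtain ⟨w, b, -⟩ := exists_hilbertBasis ℂ H
    refine (hasSum_inner_opTrace b (c • T).2).unique ?_
    simpa [inner_smul_right] using (hasSum_inner_opTrace b T.2).mul_left c

lemma TraceClass.trace_apply (T : TraceClass H) : TraceClass.trace H T = opTrace T.1 := rfl

lemma hasRankOneSum_rankOne {E F : Type*} [NormedAddCommGroup E] [InnerProductSpace ℂ E]
    [NormedAddCommGroup F] [InnerProductSpace ℂ F] (x : F) (y : E) :
    HasRankOneSum (InnerProductSpace.rankOne ℂ x y) (fun _ : Unit => x) (fun _ => y) :=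
  ⟨(hasSum_unique _).summable, fun _ => hasSum_unique _⟩

/-- The rank one operator `|x⟩⟨y|` as a trace class operator. -/
def TraceClass.rankOne (x y : H) : TraceClass H :=
  ⟨InnerProductSpace.rankOne ℂ x y, (hasRankOneSum_rankOne x y).isTraceClass⟩

lemma TraceClass.coe_rankOne (x y : H) :
    (TraceClass.rankOne x y).1 = InnerProductSpace.rankOne ℂ x y := rfl

lemma opTrace_rankOne (x y : H) : opTrace (InnerProductSpace.rankOne ℂ x y) = ⟪y, x⟫_ℂ :=
  (hasRankOneSum_rankOne x y).hasSum_opTrace.unique (hasSum_unique _)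

/-- The compression `A T B` of a trace class operator. -/
def TraceClass.conj {H K : HilbSp.{u}} (A : H →L[ℂ] K) (B : K →L[ℂ] H) :
    TraceClass H →ₗ[ℂ] TraceClass K where
  toFun T := ⟨A ∘L T.1 ∘L B, T.2.conj A B⟩
  map_add' S T := by ext; simp
  map_smul' c T := by ext; simp

end TraceClass

/-! ### Positive trace class operators and positive functionals -/

section Positivity

variable {H K : HilbSp.{u}} {ι κ : Type*}

lemma ContinuousLinearMap.isPositive_of_inner_nonneg {E : Type*} [NormedAddCommGroup E]
    [InnerProductSpace ℂ E] {T : E →L[ℂ] E} (h : ∀ x, 0 ≤ ⟪x, T x⟫_ℂ) : T.IsPositive := by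
  refine (ContinuousLinearMap.isPositive_iff_complex T).2 fun x => ?_
  have h1 := h x
  rw [Complex.le_def] at h1
  rw [← inner_conj_symm]
  constructor
  · apply Complex.ext
    · rw [RCLike.re_eq_complex_re, Complex.ofReal_re]
    · rw [Complex.ofReal_im, Complex.conj_im, ← h1.2, Complex.zero_im, neg_zero]
  · rw [RCLike.re_eq_complex_re, Complex.conj_re]
    exact h1.1

lemma inner_mul_inner_swap_nonneg {E : Type*} [NormedAddCommGroup E] [InnerProductSpace ℂ E]
    (x y : E) : 0 ≤ ⟪x, y⟫_ℂ * ⟪y, x⟫_ℂ := by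
  rw [← inner_conj_symm y x]
  exact mul_star_self_nonneg _

lemma opTrace_nonneg {T : H →L[ℂ] H} (hT : IsTraceClass H T) (hp : T.IsPositive) :
    0 ≤ opTrace T := by
  obtain ⟨w, b, -⟩ := exists_hilbertBasis ℂ H
  exact (hasSum_inner_opTrace b hT).nonneg fun i => hp.inner_nonneg_right _

/-- A self-adjoint square root of a positive operator. -/
lemma ContinuousLinearMap.IsPositive.exists_sqrt {T : H →L[ℂ] H} (hT : T.IsPositive) :
    ∃ S : H →L[ℂ] H, S.adjoint = S ∧ S ∘L S = T := by
  have h0 : 0 ≤ T := (ContinuousLinearMap.nonneg_iff_isPositive T).2 hT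
  refine ⟨CFC.sqrt T, ?_, CFC.sqrt_mul_sqrt_self T h0⟩
  have := (ContinuousLinearMap.nonneg_iff_isPositive _).1 (CFC.sqrt_nonneg T)
  exact this.isSelfAdjoint.adjoint_eq

/-- A positive trace class operator is a sum `∑ₖ |φₖ⟩⟨φₖ|`. -/
lemma IsTraceClass.exists_hasRankOneSum_self {T : H →L[ℂ] H} (hT : IsTraceClass H T)
    (hp : T.IsPositive) : ∃ φ : ℕ → H, HasRankOneSum T φ φ := by
  obtain ⟨w, b, -⟩ := exists_hilbertBasis ℂ H
  obtain ⟨S, hS, hSS⟩ := hp.exists_sqrt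
  have hin : ∀ x z, ⟪S x, z⟫_ℂ = ⟪x, S z⟫_ℂ := fun x z => by
    rw [← ContinuousLinearMap.adjoint_inner_right, hS]
  -- As T = S² with S self-adjoint, expanding S z in the basis gives T z = ∑ᵢ ⟪S bᵢ, z⟫ S bᵢ, and ∑ᵢ
  -- ‖S bᵢ‖² is the trace of T.
  have h : HasRankOneSum T (fun i => S (b i)) (fun i => S (b i)) := by
    constructor
    · have h1 := (hasSum_inner_opTrace b hT).summable
      have h2 := (Complex.hasSum_re h1.hasSum).summable
      convert h2 using 2 with i
      rw [← hSS, ContinuousLinearMap.comp_apply, ← hin, inner_self_eq_norm_sq_to_K]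
      simp [pow_two]
    · intro z
      have h1 := S.hasSum (b.hasSum_repr (S z))
      rw [← hSS]
      simpa [b.repr_apply_apply, hin] using h1
  obtain ⟨s, e, -, h'⟩ := h.exists_nat
  exact ⟨_, h'⟩

/-- The remainder is a sum of positive rank one terms. This is what allows a positive functional to
be estimated on the tails of an expansion. -/
lemma HasRankOneSum.isPositive_sub_sum {E : Type*} [NormedAddCommGroup E]
    [InnerProductSpace ℂ E] {T : E →L[ℂ] E} {φ : ι → E} (h : HasRankOneSum T φ φ)
    (s : Finset ι) : (T - ∑ k ∈ s, InnerProductSpace.rankOne ℂ (φ k) (φ k)).IsPositive := by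
  refine ContinuousLinearMap.isPositive_of_inner_nonneg fun z => ?_
  have h1 := (innerSL ℂ z).hasSum (h.2 z)
  simp only [innerSL_apply_apply] at h1
  rw [sub_apply, inner_sub_right, sub_nonneg]
  have h2 := sum_le_hasSum s (fun k _ => ?_) h1
  · simpa [sum_apply, inner_sum] using h2
  · rw [inner_smul_right]
    exact inner_mul_inner_swap_nonneg _ _

lemma HasRankOneSum.isPositive {E : Type*} [NormedAddCommGroup E]
    [InnerProductSpace ℂ E] {T : E →L[ℂ] E} {φ : ι → E} (h : HasRankOneSum T φ φ) :
    T.IsPositive := by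
  simpa using h.isPositive_sub_sum ∅

lemma HasRankOneSum.hasSum_norm_sq {T : H →L[ℂ] H} {φ : ι → H} (h : HasRankOneSum T φ φ) :
    HasSum (fun k => ‖φ k‖ ^ 2) (opTrace T).re := by
  have := Complex.hasSum_re h.hasSum_opTrace
  simpa [inner_self_eq_norm_sq_to_K, ← Complex.ofReal_pow] using this

lemma HasRankOneSum.opTrace_eq {T : H →L[ℂ] H} {φ : ι → H} (h : HasRankOneSum T φ φ) :
    opTrace T = ((∑' k, ‖φ k‖ ^ 2 : ℝ) : ℂ) := by
  rw [h.hasSum_norm_sq.tsum_eq]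
  have := opTrace_nonneg h.isTraceClass h.isPositive
  rw [Complex.le_def] at this
  exact Complex.ext (by simp) (by simpa using this.2.symm)

/-! ### Positive functionals on the trace class operators -/

/-- A positive linear functional on the trace class operators is bounded. -/
lemma TraceClass.exists_bound_of_positive (F : TraceClass H →ₗ[ℂ] ℂ)
    (hF : ∀ T : TraceClass H, T.1.IsPositive → 0 ≤ F T) :
    ∃ C : ℝ, 0 ≤ C ∧ ∀ T : TraceClass H, T.1.IsPositive → (F T).re ≤ C * (opTrace T.1).re := by
  by_contra! hcon
  -- If F is unbounded, choose T j ≥ 0 with F (T j) > 4^j t_j, where t_j is the trace of T j. The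
  -- sum S = ∑ⱼ 2^(-j) T j / t_j is trace class and dominates each of its terms, so F S ≥ 2^(-j) 4^j
  -- = 2^j for every j, which is absurd.
  choose T hTp hT using fun j : ℕ => hcon (4 ^ j) (by positivity)
  choose φ hφ using fun j => (T j).2.exists_hasRankOneSum_self (hTp j)
  set t : ℕ → ℝ := fun j => (opTrace (T j).1).re with ht
  have ht0 : ∀ j, 0 ≤ t j := fun j =>
    (Complex.le_def.1 (opTrace_nonneg (T j).2 (hTp j))).1
  -- Trace zero would force every φ j k, hence T j, to vanish, against the strict inequality in the
  -- choice of T j.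
  have htpos : ∀ j, 0 < t j := by
    intro j
    refine (ht0 j).lt_of_ne fun h0 => ?_
    have h1 : HasSum (fun k => ‖φ j k‖ ^ 2) (t j) := (hφ j).hasSum_norm_sq
    rw [← h0] at h1
    have h2 := (hasSum_zero_iff_of_nonneg fun k => by positivity).1 h1
    have h3 : T j = 0 := by
      apply Subtype.ext
      ext z
      refine ((hφ j).2 z).unique ?_
      have : ∀ k, φ j k = 0 := fun k => by simpa using congrFun h2 k
      simp [this]
    have h4 : (4 : ℝ) ^ j * t j < (F (T j)).re := hT j
    rw [← h0, h3] at h4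
    simp at h4
  have hs : Summable fun p : ℕ × ℕ =>
      ‖(((1 / 2) ^ p.1 / t p.1 : ℝ) : ℂ) • φ p.1 p.2‖ * ‖φ p.1 p.2‖ := by
    have hk : ∀ j, HasSum (fun k => ‖(((1 / 2) ^ j / t j : ℝ) : ℂ) • φ j k‖ * ‖φ j k‖)
        ((1 / 2) ^ j) := by
      intro j
      have h1 := ((hφ j).hasSum_norm_sq).mul_left ((1 / 2) ^ j / t j)
      have h2 : (1 / 2) ^ j / t j * (opTrace (T j).1).re = (1 / 2) ^ j :=
        div_mul_cancel₀ _ (htpos j).ne'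
      rw [h2] at h1
      have h3 : (fun k => ‖(((1 / 2) ^ j / t j : ℝ) : ℂ) • φ j k‖ * ‖φ j k‖) =
          fun k => (1 / 2) ^ j / t j * ‖φ j k‖ ^ 2 := by
        funext k
        rw [norm_smul, Complex.norm_real, Real.norm_of_nonneg (div_nonneg (by positivity) (ht0 j))]
        ring
      rwa [h3]
    refine (summable_prod_of_nonneg (fun _ => by positivity)).2
      ⟨fun j => (hk j).summable, ?_⟩
    simp only [fun j => (hk j).tsum_eq]
    exact summable_geometric_two
  obtain ⟨S, hS⟩ := HasRankOneSum.exists_of_summable hs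
  have hle : ∀ j, (2 : ℝ) ^ j ≤ (F ⟨S, hS.isTraceClass⟩).re := by
    intro j
    have hpos : (S - (((1 / 2) ^ j / t j : ℝ) : ℂ) • (T j).1).IsPositive := by
      refine ContinuousLinearMap.isPositive_of_inner_nonneg fun z => ?_
      have h1 := hS.hasSum_inner z z
      have h2 := ((hφ j).hasSum_inner z z).mul_left (((1 / 2) ^ j / t j : ℝ) : ℂ)
      rw [sub_apply, inner_sub_right, sub_nonneg,
        smul_apply, inner_smul_right]
      have hnn : ∀ p : ℕ × ℕ, 0 ≤ ⟪z, (((1 / 2) ^ p.1 / t p.1 : ℝ) : ℂ) • φ p.1 p.2⟫_ℂ *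
          ⟪φ p.1 p.2, z⟫_ℂ := by
        intro p
        rw [inner_smul_right, mul_assoc]
        have := div_nonneg (pow_nonneg (by norm_num : (0:ℝ) ≤ 1 / 2) p.1) (ht0 p.1)
        exact mul_nonneg (by exact_mod_cast this) (inner_mul_inner_swap_nonneg _ _)
      -- The expansion of the j-th term is the j-th row of the double series for S, and the other
      -- rows contribute nonnegative amounts.
      refine hasSum_le_inj (fun k => (j, k)) (fun a b h => by simpa using h)
        (fun p _ => hnn p) (fun k => ?_) h2 h1
      rw [inner_smul_right, mul_assoc]
    have h1 := hF (⟨S, hS.isTraceClass⟩ - (((1 / 2) ^ j / t j : ℝ) : ℂ) • T j) hpos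
    rw [map_sub, map_smul] at h1
    have h2 := (Complex.le_def.1 h1).1
    simp only [Complex.zero_re, Complex.sub_re, smul_eq_mul, Complex.re_ofReal_mul] at h2
    have h3 : (1 / 2) ^ j / t j * (4 ^ j * t j) = (2 : ℝ) ^ j := by
      have := (htpos j).ne'
      field_simp
      rw [← mul_pow]; norm_num
    have h4 : (1 / 2) ^ j / t j * (4 ^ j * t j) ≤ (1 / 2) ^ j / t j * (F (T j)).re := by
      have := htpos j
      gcongr
      exact (hT j).le
    linarith
  obtain ⟨j, hj⟩ := pow_unbounded_of_one_lt (F ⟨S, hS.isTraceClass⟩).re (by norm_num : (1:ℝ) < 2)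
  exact absurd (hle j) (not_le.2 hj)

lemma TraceClass.rankOne_add_left (x x' y : H) :
    TraceClass.rankOne (x + x') y = TraceClass.rankOne x y + TraceClass.rankOne x' y :=
  Subtype.ext (by simp [TraceClass.coe_rankOne])

lemma TraceClass.rankOne_add_right (x y y' : H) :
    TraceClass.rankOne x (y + y') = TraceClass.rankOne x y + TraceClass.rankOne x y' :=
  Subtype.ext (by simp [TraceClass.coe_rankOne])

lemma TraceClass.rankOne_smul_left (c : ℂ) (x y : H) :
    TraceClass.rankOne (c • x) y = c • TraceClass.rankOne x y :=
  Subtype.ext (by simp [TraceClass.coe_rankOne])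

lemma TraceClass.rankOne_smul_right (c : ℂ) (x y : H) :
    TraceClass.rankOne x (c • y) = star c • TraceClass.rankOne x y :=
  Subtype.ext (by simp [TraceClass.coe_rankOne])

/-- Reduces bounds on functionals at |x⟩⟨y| to bounds at the positive operators |z⟩⟨z|. -/
lemma TraceClass.rankOne_polarization (x y : H) : (4 : ℂ) • TraceClass.rankOne x y =
    TraceClass.rankOne (x + y) (x + y) - TraceClass.rankOne (x - y) (x - y)
      + Complex.I • TraceClass.rankOne (x + Complex.I • y) (x + Complex.I • y)
      - Complex.I • TraceClass.rankOne (x - Complex.I • y) (x - Complex.I • y) := by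
  simp only [sub_eq_add_neg, ← neg_one_smul ℂ (Complex.I • y), ← neg_one_smul ℂ y,
    rankOne_add_left, rankOne_add_right, rankOne_smul_left, rankOne_smul_right, smul_smul]
  have : star Complex.I = -Complex.I := Complex.conj_I
  simp only [this, smul_add, smul_smul, star_neg, star_one]
  match_scalars <;> (ring_nf; try simp; try norm_num)

/-- A positive linear functional on the trace class operators is of the form `T ↦ tr (M T)`. -/
lemma TraceClass.exists_density_of_positive (F : TraceClass H →ₗ[ℂ] ℂ)
    (hF : ∀ T : TraceClass H, T.1.IsPositive → 0 ≤ F T) :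
    ∃ M : H →L[ℂ] H, M.IsPositive ∧ (∀ x y, F (TraceClass.rankOne y x) = ⟪x, M y⟫_ℂ) ∧
      ∀ (T : TraceClass H) (φ : ℕ → H), HasRankOneSum T.1 φ φ →
        HasSum (fun k => ⟪φ k, M (φ k)⟫_ℂ) (F T) := by
  obtain ⟨C, hC0, hC⟩ := TraceClass.exists_bound_of_positive F hF
  have hnorm : ∀ T : TraceClass H, T.1.IsPositive → ‖F T‖ ≤ C * (opTrace T.1).re := by
    intro T hT
    have h1 := Complex.le_def.1 (hF T hT)
    have h2 : F T = ((F T).re : ℂ) := Complex.ext (by simp) (by simpa using h1.2.symm)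
    rw [h2, Complex.norm_real, Real.norm_of_nonneg h1.1]
    exact hC T hT
  have hdiag : ∀ x : H, ‖F (TraceClass.rankOne x x)‖ ≤ C * ‖x‖ ^ 2 := by
    intro x
    refine (hnorm _ (InnerProductSpace.isPositive_rankOne_self x)).trans (le_of_eq ?_)
    rw [TraceClass.coe_rankOne, opTrace_rankOne, inner_self_eq_norm_sq_to_K]
    simp [← Complex.ofReal_pow]
  -- The four vectors in the polarization identity have norm at most 2, so each diagonal value is at
  -- most 4 C; the four of them, divided by 4, give the constant 4 C.
  have hunit : ∀ x y : H, ‖x‖ = 1 → ‖y‖ = 1 → ‖F (TraceClass.rankOne x y)‖ ≤ 4 * C := by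
    intro x y hx hy
    have h4 := congrArg F (TraceClass.rankOne_polarization x y)
    simp only [map_sub, map_add, map_smul, smul_eq_mul] at h4
    have hb : ∀ z : H, ‖z‖ ≤ 2 → ‖F (TraceClass.rankOne z z)‖ ≤ 4 * C := by
      intro z hz
      refine (hdiag z).trans ?_
      have : ‖z‖ ^ 2 ≤ 2 ^ 2 := by gcongr
      nlinarith
    have hIy : ‖Complex.I • y‖ = 1 := by simp [norm_smul, hy]
    have b1 := hb (x + y) ((norm_add_le _ _).trans (by linarith))
    have b2 := hb (x - y) ((norm_sub_le _ _).trans (by linarith))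
    have b3 := hb (x + Complex.I • y) ((norm_add_le _ _).trans (by linarith))
    have b4 := hb (x - Complex.I • y) ((norm_sub_le _ _).trans (by linarith))
    have h5 : ‖(4 : ℂ) * F (TraceClass.rankOne x y)‖ ≤ 4 * C + 4 * C + 4 * C + 4 * C := by
      rw [h4]
      refine (norm_sub_le _ _).trans (add_le_add ((norm_add_le _ _).trans
        (add_le_add ((norm_sub_le _ _).trans (add_le_add b1 b2)) ?_)) ?_)
      · simpa using b3
      · simpa using b4
    rw [norm_mul] at h5
    norm_num at h5
    linarith
  have hbound : ∀ x y : H, ‖F (TraceClass.rankOne y x)‖ ≤ 4 * C * ‖x‖ * ‖y‖ := by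
    intro x y
    rcases eq_or_ne x 0 with rfl | hx
    · have : TraceClass.rankOne y (0 : H) = 0 := Subtype.ext (by simp [TraceClass.coe_rankOne])
      simp [this]
    rcases eq_or_ne y 0 with rfl | hy
    · have : TraceClass.rankOne (0 : H) x = 0 := Subtype.ext (by simp [TraceClass.coe_rankOne])
      simp [this]
    have hx' : x = (‖x‖ : ℂ) • ((‖x‖ : ℂ)⁻¹ • x) := by
      rw [smul_smul, mul_inv_cancel₀ (by simpa using hx), one_smul]
    have hy' : y = (‖y‖ : ℂ) • ((‖y‖ : ℂ)⁻¹ • y) := by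
      rw [smul_smul, mul_inv_cancel₀ (by simpa using hy), one_smul]
    have h1 := hunit ((‖y‖ : ℂ)⁻¹ • y) ((‖x‖ : ℂ)⁻¹ • x)
      (by simp [norm_smul, hy]) (by simp [norm_smul, hx])
    calc ‖F (TraceClass.rankOne y x)‖
        = ‖F (TraceClass.rankOne ((‖y‖ : ℂ) • ((‖y‖ : ℂ)⁻¹ • y))
            ((‖x‖ : ℂ) • ((‖x‖ : ℂ)⁻¹ • x)))‖ := by rw [← hx', ← hy']
      _ = ‖y‖ * (‖x‖ * ‖F (TraceClass.rankOne ((‖y‖ : ℂ)⁻¹ • y) ((‖x‖ : ℂ)⁻¹ • x))‖) := by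
          rw [TraceClass.rankOne_smul_left, TraceClass.rankOne_smul_right, map_smul, map_smul,
            norm_smul, norm_smul]
          simp
      _ ≤ ‖y‖ * (‖x‖ * (4 * C)) := by gcongr
      _ = _ := by ring
  -- The values of F on rank one operators form a bounded sesquilinear form; its Riesz
  -- representation provides the density.
  let B : H →L⋆[ℂ] H →L[ℂ] ℂ := LinearMap.mkContinuous₂
    (LinearMap.mk₂'ₛₗ (starRingEnd ℂ) (RingHom.id ℂ) (fun x y : H => F (TraceClass.rankOne y x))
      (fun x x' y => by rw [TraceClass.rankOne_add_right, map_add])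
      (fun c x y => by rw [TraceClass.rankOne_smul_right, map_smul]; rfl)
      (fun x y y' => by rw [TraceClass.rankOne_add_left, map_add])
      (fun c x y => by rw [TraceClass.rankOne_smul_left, map_smul]; rfl)) (4 * C) hbound
  have hM : ∀ x y, F (TraceClass.rankOne y x) =
      ⟪x, (InnerProductSpace.continuousLinearMapOfBilin B).adjoint y⟫_ℂ := by
    intro x y
    rw [ContinuousLinearMap.adjoint_inner_right,
      InnerProductSpace.continuousLinearMapOfBilin_apply]
    rfl
  refine ⟨(InnerProductSpace.continuousLinearMapOfBilin B).adjoint, ?_, hM, fun T φ hφ => ?_⟩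
  · refine ContinuousLinearMap.isPositive_of_inner_nonneg fun x => ?_
    rw [← hM]
    exact hF _ (InnerProductSpace.isPositive_rankOne_self x)
  -- The remainder of the expansion of T is positive and its trace tends to 0. Boundedness of F on
  -- positive operators then makes F of the remainder tend to 0, so that F is determined by its
  -- values on rank one operators.
  · have h1 : Filter.Tendsto (fun s : Finset ℕ => C * ((opTrace T.1).re - ∑ k ∈ s, ‖φ k‖ ^ 2))
        Filter.atTop (nhds 0) := by
      have := ((tendsto_const_nhds (x := (opTrace T.1).re)).sub
        (show Filter.Tendsto _ Filter.atTop _ from hφ.hasSum_norm_sq)).const_mul C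
      simpa using this
    refine tendsto_iff_norm_sub_tendsto_zero.2 (squeeze_zero (fun _ => norm_nonneg _) ?_ h1)
    intro s
    have hp := hφ.isPositive_sub_sum s
    let R : TraceClass H := T - ∑ k ∈ s, TraceClass.rankOne (φ k) (φ k)
    have hR : R.1 = T.1 - ∑ k ∈ s, InnerProductSpace.rankOne ℂ (φ k) (φ k) := by
      simp [R, TraceClass.coe_rankOne]
    have h2 := hnorm R (by rw [hR]; exact hp)
    have h3 : F R = F T - ∑ k ∈ s, F (TraceClass.rankOne (φ k) (φ k)) := by simp [R]
    have h4 : opTrace R.1 = opTrace T.1 - ∑ k ∈ s, ⟪φ k, φ k⟫_ℂ := by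
      have := map_sub (TraceClass.trace H) T (∑ k ∈ s, TraceClass.rankOne (φ k) (φ k))
      rw [map_sum] at this
      simpa [R, TraceClass.trace_apply, TraceClass.coe_rankOne, opTrace_rankOne,
        -inner_self_eq_norm_sq_to_K] using this
    rw [h3, h4] at h2
    simp only [hM] at h2
    rw [norm_sub_rev]
    refine h2.trans (le_of_eq ?_)
    simp [inner_self_eq_norm_sq_to_K, ← Complex.ofReal_pow]

end Positivity

/-! ### Maps in Kraus form -/

section Kraus

variable {H K : HilbSp.{u}} {ι κ : Type*} {V : ι → H →L[ℂ] K}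

lemma summable_kraus (hV : Summable fun l => ‖V l‖ ^ 2) (T : H →L[ℂ] H) :
    Summable fun l => V l ∘L T ∘L (V l).adjoint := by
  refine Summable.of_norm_bounded (hV.mul_right ‖T‖) fun l => ?_
  calc ‖V l ∘L T ∘L (V l).adjoint‖ ≤ ‖V l‖ * (‖T‖ * ‖(V l).adjoint‖) :=
        (ContinuousLinearMap.opNorm_comp_le _ _).trans
          (mul_le_mul_of_nonneg_left (ContinuousLinearMap.opNorm_comp_le _ _) (norm_nonneg _))
    _ = ‖V l‖ ^ 2 * ‖T‖ := by
        rw [LinearIsometryEquiv.norm_map]; ring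

lemma hasSum_inner_kraus (hV : Summable fun l => ‖V l‖ ^ 2) (T : H →L[ℂ] H) (x y : K) :
    HasSum (fun l => ⟪(V l).adjoint x, T ((V l).adjoint y)⟫_ℂ)
      ⟪x, (∑' l, V l ∘L T ∘L (V l).adjoint) y⟫_ℂ := by
  have h1 := (innerSL ℂ x).hasSum
    ((ContinuousLinearMap.apply ℂ K y).hasSum (summable_kraus hV T).hasSum)
  simpa [ContinuousLinearMap.adjoint_inner_left] using h1

/-- Applying every Vₗ to every term of the expansion gives a family dominated by ‖Vₗ‖² ‖x k‖ ‖y k‖,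
a product of two summable families. Besides showing that the image is trace class, the explicit
expansion allows its trace to be read off. -/
lemma HasRankOneSum.kraus (hV : Summable fun l => ‖V l‖ ^ 2) {T : H →L[ℂ] H} {x y : κ → H}
    (h : HasRankOneSum T x y) :
    HasRankOneSum (∑' l, V l ∘L T ∘L (V l).adjoint) (fun p : ι × κ => V p.1 (x p.2))
      (fun p => V p.1 (y p.2)) := by
  have hs : Summable fun p : ι × κ => ‖V p.1 (x p.2)‖ * ‖V p.1 (y p.2)‖ := by
    refine Summable.of_nonneg_of_le (fun p => by positivity) (fun p => ?_)
      (hV.mul_of_nonneg h.1 (fun _ => by positivity) (fun _ => by positivity))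
    calc ‖V p.1 (x p.2)‖ * ‖V p.1 (y p.2)‖ ≤ (‖V p.1‖ * ‖x p.2‖) * (‖V p.1‖ * ‖y p.2‖) := by
          gcongr <;> exact ContinuousLinearMap.le_opNorm _ _
      _ = _ := by ring
  obtain ⟨S, hS⟩ := HasRankOneSum.exists_of_summable hs
  have : ∑' l, V l ∘L T ∘L (V l).adjoint = S := by
    ext z
    refine ext_inner_left ℂ fun w => ?_
    refine (hasSum_inner_kraus hV T w z).unique ?_
    refine (hS.hasSum_inner w z).prod_fiberwise fun l => ?_
    simpa [ContinuousLinearMap.adjoint_inner_left, ContinuousLinearMap.adjoint_inner_right]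
      using h.hasSum_inner ((V l).adjoint w) ((V l).adjoint z)
  rwa [this]

/-- The map `T ↦ ∑ₗ Vₗ T Vₗ†` on trace class operators, if `∑ₗ ‖Vₗ‖² < ∞`. -/
def TraceClass.kraus (V : ι → H →L[ℂ] K) (hV : Summable fun l => ‖V l‖ ^ 2) :
    TraceClass H →ₗ[ℂ] TraceClass K where
  toFun T := ⟨∑' l, V l ∘L T.1 ∘L (V l).adjoint, by
    obtain ⟨x, y, h⟩ := T.2
    exact (HasRankOneSum.kraus (T := T.1) hV h).isTraceClass⟩
  map_add' S T := by
    apply Subtype.ext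
    simp only [Submodule.coe_add, ContinuousLinearMap.add_comp, ContinuousLinearMap.comp_add]
    exact (summable_kraus hV S.1).tsum_add (summable_kraus hV T.1)
  map_smul' c T := by
    apply Subtype.ext
    simp only [Submodule.coe_smul, ContinuousLinearMap.smul_comp, ContinuousLinearMap.comp_smul,
      RingHom.id_apply]
    exact (summable_kraus hV T.1).tsum_const_smul c

lemma TraceClass.isPositive_kraus (hV : Summable fun l => ‖V l‖ ^ 2) {T : TraceClass H}
    (hT : T.1.IsPositive) : (TraceClass.kraus V hV T).1.IsPositive := by
  refine ContinuousLinearMap.isPositive_of_inner_nonneg fun x => ?_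
  exact (hasSum_inner_kraus hV T.1 x x).nonneg fun l => hT.inner_nonneg_right _

end Kraus

/-! ### Trace functionals and measure-and-prepare operations -/

section QuantumOps

variable {H K : HilbSp.{u}}

lemma QuantumOp.isPositive (F : QuantumOp H K) {T : TraceClass H} (hT : T.1.IsPositive) :
    (F.toFun T).1.IsPositive := by
  refine ContinuousLinearMap.isPositive_of_inner_nonneg fun y => ?_
  have := F.completelyPositive 1 (fun _ _ => T)
    (fun x => by simpa using hT.inner_nonneg_right (x 0)) (fun _ => y)
  simpa using this

/-- The positive functional `T ↦ tr (F T)`. -/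
def QuantumOp.traceFunctional (F : QuantumOp H K) : TraceClass H →ₗ[ℂ] ℂ :=
  TraceClass.trace K ∘ₗ F.toFun

lemma QuantumOp.traceFunctional_apply (F : QuantumOp H K) (T : TraceClass H) :
    F.traceFunctional T = opTrace (F.toFun T).1 := rfl

lemma QuantumOp.traceFunctional_nonneg (F : QuantumOp H K) {T : TraceClass H}
    (hT : T.1.IsPositive) : 0 ≤ F.traceFunctional T :=
  opTrace_nonneg (F.toFun T).2 (F.isPositive hT)

/-- The functional `T ↦ tr (M T)`. -/
def TraceClass.expect (M : H →L[ℂ] H) : TraceClass H →ₗ[ℂ] ℂ where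
  toFun T := opTrace (M ∘L T.1)
  map_add' S T := by
    have := map_add (TraceClass.trace H) ⟨M ∘L S.1, S.2.comp_left M⟩ ⟨M ∘L T.1, T.2.comp_left M⟩
    simpa [TraceClass.trace_apply] using this
  map_smul' c T := by
    have h : M ∘L (c • T).1 = c • (M ∘L T.1) := by ext; simp
    rw [h]
    exact map_smul (TraceClass.trace H) c ⟨M ∘L T.1, T.2.comp_left M⟩

lemma TraceClass.expect_apply (M : H →L[ℂ] H) (T : TraceClass H) :
    TraceClass.expect M T = opTrace (M ∘L T.1) := rfl

lemma TraceClass.expect_id (T : TraceClass H) :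
    TraceClass.expect (ContinuousLinearMap.id ℂ H) T = opTrace T.1 := rfl

lemma TraceClass.expect_sum {α : Type*} (s : Finset α) (M : α → H →L[ℂ] H) (T : TraceClass H) :
    TraceClass.expect (∑ a ∈ s, M a) T = ∑ a ∈ s, TraceClass.expect (M a) T := by
  have := map_sum (TraceClass.trace H) (fun a => (⟨M a ∘L T.1, T.2.comp_left _⟩ : TraceClass H)) s
  rw [TraceClass.trace_apply] at this
  simp only [TraceClass.expect_apply]
  refine Eq.trans ?_ this
  congr 1
  ext z
  simp

lemma TraceClass.expect_rankOne (M : H →L[ℂ] H) (x y : H) :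
    TraceClass.expect M (TraceClass.rankOne x y) = ⟪y, M x⟫_ℂ := by
  rw [TraceClass.expect_apply, TraceClass.coe_rankOne]
  exact ((hasRankOneSum_rankOne x y).comp_left M).hasSum_opTrace.unique (hasSum_unique _)

/-- `T ↦ tr (M T) |Ψ⟩⟨Ψ|`: a measurement of the effect `M`, followed by the preparation of `Ψ`. -/
def QuantumOp.measurePrepare (M : H →L[ℂ] H) (hM : M.IsPositive) (Ψ : K) : QuantumOp H K where
  toFun := (TraceClass.expect M).smulRight (TraceClass.rankOne Ψ Ψ)
  completelyPositive := by
    intro n T hT y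
    obtain ⟨S, hS, rfl⟩ := hM.exists_sqrt
    obtain ⟨w, b, -⟩ := exists_hilbertBasis ℂ H
    have htr : ∀ i j, HasSum (fun k => ⟪S (b k), (T i j).1 (S (b k))⟫_ℂ)
        (TraceClass.expect (S ∘L S) (T i j)) := by
      intro i j
      have h1 := hasSum_inner_opTrace b ((T i j).2.conj S S)
      rw [opTrace_comp_comm (T i j).2] at h1
      have h2 : ∀ k, ⟪S (b k), (T i j).1 (S (b k))⟫_ℂ =
          ⟪b k, (S ∘L (T i j).1 ∘L S) (b k)⟫_ℂ := fun k => by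
        rw [ContinuousLinearMap.comp_apply, ← ContinuousLinearMap.adjoint_inner_left S, hS]; rfl
      simp only [h2]
      exact h1
    -- Since tr(S² T) = ∑ₖ ⟪S bₖ, T S bₖ⟫, the block form of the image is a series of block forms of
    -- T, evaluated at the vectors ⟪Ψ, y i⟫ • S bₖ. Each of them is nonnegative by assumption.
    have hsum : HasSum (fun k => ∑ i, ∑ j, ⟪⟪Ψ, y i⟫_ℂ • S (b k),
        (T i j).1 (⟪Ψ, y j⟫_ℂ • S (b k))⟫_ℂ)
        (∑ i, ∑ j, ⟪y i, (TraceClass.expect (S ∘L S) (T i j) •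
          InnerProductSpace.rankOne ℂ Ψ Ψ) (y j)⟫_ℂ) := by
      refine hasSum_sum fun i _ => hasSum_sum fun j _ => ?_
      have h1 := (htr i j).mul_left (⟪y i, Ψ⟫_ℂ * ⟪Ψ, y j⟫_ℂ)
      have h2 : ⟪y i, (TraceClass.expect (S ∘L S) (T i j) •
          InnerProductSpace.rankOne ℂ Ψ Ψ) (y j)⟫_ℂ =
          ⟪y i, Ψ⟫_ℂ * ⟪Ψ, y j⟫_ℂ * TraceClass.expect (S ∘L S) (T i j) := by
        rw [smul_apply, inner_smul_right, InnerProductSpace.rankOne_apply, inner_smul_right]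
        ring
      have h3 : ∀ k, ⟪⟪Ψ, y i⟫_ℂ • S (b k), (T i j).1 (⟪Ψ, y j⟫_ℂ • S (b k))⟫_ℂ =
          ⟪y i, Ψ⟫_ℂ * ⟪Ψ, y j⟫_ℂ * ⟪S (b k), (T i j).1 (S (b k))⟫_ℂ := fun k => by
        rw [map_smul, inner_smul_left, inner_smul_right, inner_conj_symm, mul_assoc]
      simp only [h2, h3]
      exact h1
    exact hsum.nonneg fun k => hT _

lemma QuantumOp.coe_measurePrepare (M : H →L[ℂ] H) (hM : M.IsPositive) (Ψ : K)
    (T : TraceClass H) : ((QuantumOp.measurePrepare M hM Ψ).toFun T).1 =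
      opTrace (M ∘L T.1) • InnerProductSpace.rankOne ℂ Ψ Ψ := rfl

lemma QuantumOp.inner_measurePrepare (M : H →L[ℂ] H) (hM : M.IsPositive) (Ψ : K)
    (T : TraceClass H) (x y : K) : ⟪x, ((QuantumOp.measurePrepare M hM Ψ).toFun T).1 y⟫_ℂ =
      opTrace (M ∘L T.1) * (⟪x, Ψ⟫_ℂ * ⟪Ψ, y⟫_ℂ) := by
  rw [QuantumOp.coe_measurePrepare, smul_apply, inner_smul_right,
    InnerProductSpace.rankOne_apply, inner_smul_right]
  ring

lemma QuantumOp.opTrace_measurePrepare (M : H →L[ℂ] H) (hM : M.IsPositive) (Ψ : K)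
    (T : TraceClass H) : opTrace ((QuantumOp.measurePrepare M hM Ψ).toFun T).1 =
      opTrace (M ∘L T.1) * ⟪Ψ, Ψ⟫_ℂ := by
  have := map_smul (TraceClass.trace K) (opTrace (M ∘L T.1)) (TraceClass.rankOne Ψ Ψ)
  rw [TraceClass.trace_apply, TraceClass.trace_apply, TraceClass.coe_rankOne,
    opTrace_rankOne] at this
  exact this

end QuantumOps

/-! ### Finite products of series -/

section ProductSums

/-- A product of absolutely convergent series is the series of the products. -/
lemma hasSum_pi_prod : ∀ {n : ℕ} {κ : Type} {f : Fin n → κ → ℂ} {a : Fin n → ℂ},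
    (∀ i, Summable fun k => ‖f i k‖) → (∀ i, HasSum (f i) (a i)) →
    (Summable fun k : Fin n → κ => ‖∏ i, f i (k i)‖) ∧
      HasSum (fun k : Fin n → κ => ∏ i, f i (k i)) (∏ i, a i) := by
  intro n
  induction n with
  | zero =>
    intro κ f a _ _
    simp only [Finset.univ_eq_empty, Finset.prod_empty]
    exact ⟨(hasSum_unique _).summable, hasSum_unique _⟩
  | succ n ih =>
    intro κ f a hf ha
    obtain ⟨h1, h2⟩ := ih (f := fun i => f i.succ) (fun i => hf _) (fun i => ha i.succ)
    have key : ∀ p : κ × (Fin n → κ), ∏ i, f i (Fin.consEquiv (fun _ : Fin (n + 1) => κ) p i) =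
        f 0 p.1 * ∏ i : Fin n, f i.succ (p.2 i) := by
      intro p
      simp [Fin.consEquiv, Fin.prod_univ_succ]
    have hn : Summable fun p : κ × (Fin n → κ) => f 0 p.1 * ∏ i : Fin n, f i.succ (p.2 i) :=
      summable_mul_of_summable_norm (f := f 0)
        (g := fun k : Fin n → κ => ∏ i : Fin n, f i.succ (k i)) (hf 0) h1
    have key' : (fun k : Fin (n + 1) → κ => ∏ i, f i (k i)) ∘
        (Fin.consEquiv (fun _ : Fin (n + 1) => κ)) =
        fun p => f 0 p.1 * ∏ i : Fin n, f i.succ (p.2 i) := funext key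
    constructor
    -- For complex families summability and absolute summability agree, so the norm may be dropped.
    · refine Summable.norm ?_
      rw [← (Fin.consEquiv (fun _ : Fin (n + 1) => κ)).summable_iff, key']
      exact hn
    · rw [← (Fin.consEquiv (fun _ : Fin (n + 1) => κ)).hasSum_iff, key', Fin.prod_univ_succ]
      exact HasSum.mul (f := f 0) (g := fun k : Fin n → κ => ∏ i : Fin n, f i.succ (k i))
        (ha 0) h2 hn

end ProductSums

/-! ### Tensor products of operators -/

section TensorOps

namespace HilbSp

variable {ι : Type} [Fintype ι] {H : ι → HilbSp.{u}}

lemma tensor_ext_left {K : HilbSp.{u}} {S T : HilbSp.tensor H →L[ℂ] K}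
    (h : ∀ x, S (tprod x) = T (tprod x)) : S = T :=
  ContinuousLinearMap.eq_of_dense_family (dense_span_tprod H) h

lemma tensor_ext {S T : HilbSp.tensor H →L[ℂ] HilbSp.tensor H}
    (h : ∀ x y, ⟪tprod x, S (tprod y)⟫_ℂ = ⟪tprod x, T (tprod y)⟫_ℂ) : S = T :=
  ContinuousLinearMap.eq_of_inner_dense_family (dense_span_tprod H) (dense_span_tprod H) h

lemma inner_tensorMap (A : ∀ i, H i →L[ℂ] H i) (x y : ∀ i, H i) :
    ⟪tprod x, tensorMap A (tprod y)⟫_ℂ = ∏ i, ⟪x i, A i (y i)⟫_ℂ := by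
  rw [tensorMap_tprod, inner_tprod]

lemma norm_tprod (x : ∀ i, H i) : ‖tprod x‖ = ∏ i, ‖x i‖ := by
  have h1 := inner_tprod x x
  simp only [inner_self_eq_norm_sq_to_K] at h1
  have h2 : ‖tprod x‖ ^ 2 = (∏ i, ‖x i‖) ^ 2 := by
    rw [← Finset.prod_pow]
    apply Complex.ofReal_injective
    push_cast
    exact h1
  exact (sq_eq_sq₀ (norm_nonneg _) (Finset.prod_nonneg fun _ _ => norm_nonneg _)).1 h2

lemma tensorMap_id : tensorMap (fun i => ContinuousLinearMap.id ℂ (H i)) =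
    ContinuousLinearMap.id ℂ (HilbSp.tensor H) :=
  tensor_ext_left fun x => by rw [tensorMap_tprod]; rfl

lemma tensorMap_comp (A B : ∀ i, H i →L[ℂ] H i) :
    tensorMap A ∘L tensorMap B = tensorMap (fun i => A i ∘L B i) :=
  tensor_ext_left fun x => by
    rw [ContinuousLinearMap.comp_apply, tensorMap_tprod, tensorMap_tprod, tensorMap_tprod]; rfl

lemma tensorMap_adjoint (A : ∀ i, H i →L[ℂ] H i) :
    (tensorMap A).adjoint = tensorMap (fun i => (A i).adjoint) :=
  tensor_ext fun x y => by
    rw [ContinuousLinearMap.adjoint_inner_right, tensorMap_tprod, inner_tprod, inner_tensorMap]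
    simp only [ContinuousLinearMap.adjoint_inner_right]

/-- With self-adjoint square roots Sᵢ of the Aᵢ, the tensor product of the Aᵢ is (⨂ Sᵢ)† (⨂ Sᵢ). -/
lemma tensorMap_isPositive {A : ∀ i, H i →L[ℂ] H i} (hA : ∀ i, (A i).IsPositive) :
    (tensorMap A).IsPositive := by
  choose S hS hSS using fun i => (hA i).exists_sqrt
  have h := ContinuousLinearMap.isPositive_adjoint_comp_self (tensorMap S)
  rw [tensorMap_adjoint, tensorMap_comp] at h
  simpa only [hS, hSS] using h

lemma tensorMap_smul (c : ι → ℂ) (A : ∀ i, H i →L[ℂ] H i) :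
    tensorMap (fun i => c i • A i) = (∏ i, c i) • tensorMap A :=
  tensor_ext fun x y => by
    rw [smul_apply, inner_smul_right, inner_tensorMap, inner_tensorMap, ← Finset.prod_mul_distrib]
    simp only [smul_apply, inner_smul_right]

/-- Distributivity of a product of sums, applied to the matrix elements on elementary tensors. -/
lemma sum_tensorMap [DecidableEq ι] {α : ι → Type*} [∀ i, Fintype (α i)]
    (A : ∀ i, α i → H i →L[ℂ] H i) :
    ∑ a : ∀ i, α i, tensorMap (fun i => A i (a i)) = tensorMap (fun i => ∑ a, A i a) :=
  tensor_ext fun x y => by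
    simp only [sum_apply, inner_sum, inner_tensorMap]
    rw [Finset.prod_univ_sum, Fintype.piFinset_univ]

end HilbSp

/-- Multiplying out the expansions of the factors gives a series over multi-indices. It converges
absolutely because its norms multiply, and its matrix elements on elementary tensors are the right
ones. -/
lemma HasRankOneSum.tensorMap {n : ℕ} {κ : Type} {H : Fin n → HilbSp.{u}}
    {A : ∀ i, H i →L[ℂ] H i} {x y : ∀ i, κ → H i} (h : ∀ i, HasRankOneSum (A i) (x i) (y i)) :
    HasRankOneSum (HilbSp.tensorMap A) (fun k : Fin n → κ => HilbSp.tprod fun i => x i (k i))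
      (fun k => HilbSp.tprod fun i => y i (k i)) := by
  have hs : Summable fun k : Fin n → κ => ‖HilbSp.tprod fun i => x i (k i)‖ *
      ‖HilbSp.tprod fun i => y i (k i)‖ := by
    have h1 := (hasSum_pi_prod (f := fun i k => ((‖x i k‖ * ‖y i k‖ : ℝ) : ℂ))
      (fun i => by simpa using (h i).1)
      (fun i => (Complex.hasSum_ofReal.2 (h i).1.hasSum))).1
    refine h1.congr fun k => ?_
    rw [HilbSp.norm_tprod, HilbSp.norm_tprod, ← Finset.prod_mul_distrib, norm_prod]
    refine Finset.prod_congr rfl fun i _ => ?_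
    rw [Complex.norm_real, Real.norm_of_nonneg (by positivity)]
  obtain ⟨S, hS⟩ := HasRankOneSum.exists_of_summable hs
  have : HilbSp.tensorMap A = S := by
    refine HilbSp.tensor_ext fun w z => ?_
    have h1 := (hasSum_pi_prod (f := fun i k => ⟪w i, x i k⟫_ℂ * ⟪y i k, z i⟫_ℂ)
      (a := fun i => ⟪w i, A i (z i)⟫_ℂ) (fun i => ?_) (fun i => (h i).hasSum_inner _ _)).2
    · rw [HilbSp.inner_tensorMap]
      refine h1.unique ?_
      have h2 := hS.hasSum_inner (HilbSp.tprod w) (HilbSp.tprod z)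
      simpa only [HilbSp.inner_tprod, ← Finset.prod_mul_distrib] using h2
    · refine Summable.of_nonneg_of_le (fun _ => norm_nonneg _) (fun k => ?_)
        ((h i).1.mul_left (‖w i‖ * ‖z i‖))
      rw [norm_mul]
      calc ‖⟪w i, x i k⟫_ℂ‖ * ‖⟪y i k, z i⟫_ℂ‖ ≤ (‖w i‖ * ‖x i k‖) * (‖y i k‖ * ‖z i‖) := by
            gcongr <;> exact norm_inner_le_norm _ _
        _ = _ := by ring
  rwa [this]

/-- The trace read off from the product expansion is a sum over multi-indices of ∏ᵢ ⟪yᵢ, xᵢ⟫, which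
factorizes. -/
lemma HilbSp.opTrace_tensorMap {n : ℕ} {H : Fin n → HilbSp.{u}} {A : ∀ i, H i →L[ℂ] H i}
    (hA : ∀ i, IsTraceClass (H i) (A i)) :
    IsTraceClass (HilbSp.tensor H) (HilbSp.tensorMap A) ∧
      opTrace (HilbSp.tensorMap A) = ∏ i, opTrace (A i) := by
  choose x y h using hA
  have h : ∀ i, HasRankOneSum (A i) (x i) (y i) := h
  have h1 := HasRankOneSum.tensorMap h
  refine ⟨h1.isTraceClass, h1.hasSum_opTrace.unique ?_⟩
  simp only [HilbSp.inner_tprod]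
  refine (hasSum_pi_prod (fun i => ?_) (fun i => (h i).hasSum_opTrace)).2
  refine Summable.of_nonneg_of_le (fun _ => norm_nonneg _) (fun k => ?_) (h i).1
  rw [mul_comm]
  exact norm_inner_le_norm _ _

end TensorOps

/-! ### Purification with local ancillas -/

section Purification

/-- The Hilbert space `ℓ²(ℕ)`. -/
def HilbSp.ell2 : HilbSp.{u} := { carrier := lp (fun _ : ULift.{u} ℕ => ℂ) 2 }

lemma HilbSp.exists_orthonormal_ell2 : ∃ e : ℕ → HilbSp.ell2.{u}, Orthonormal ℂ e := by
  let b : HilbertBasis (ULift.{u} ℕ) ℂ (lp (fun _ : ULift.{u} ℕ => ℂ) 2) :=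
    ⟨LinearIsometryEquiv.refl ℂ _⟩
  exact ⟨fun k => b (ULift.up k), b.orthonormal.comp _ ULift.up_injective⟩

/-- The pair of Hilbert spaces `H, K` as a family indexed by `Bool`. -/
def HilbSp.pair (H K : HilbSp.{u}) : Bool → HilbSp.{u}
  | true => H
  | false => K

/-- A pair of vectors. -/
def HilbSp.pairVec {H K : HilbSp.{u}} (x : H) (y : K) : ∀ b, HilbSp.pair H K b
  | true => x
  | false => y

/-- A pair of operators. -/
def HilbSp.pairOp {H K : HilbSp.{u}} (A : H →L[ℂ] H) (B : K →L[ℂ] K) :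
    ∀ b, HilbSp.pair H K b →L[ℂ] HilbSp.pair H K b
  | true => A
  | false => B

/-- The operator `A ⊗ 1` on `H ⊗ ℓ²`. -/
def HilbSp.ampliate {H : HilbSp.{u}} (A : H →L[ℂ] H) :
    HilbSp.tensor (HilbSp.pair H HilbSp.ell2.{u}) →L[ℂ] HilbSp.tensor (HilbSp.pair H HilbSp.ell2.{u}) :=
  HilbSp.tensorMap (HilbSp.pairOp A (ContinuousLinearMap.id ℂ _))

variable {H : HilbSp.{u}}

lemma HilbSp.ampliate_isPositive {A : H →L[ℂ] H} (hA : A.IsPositive) :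
    (HilbSp.ampliate A).IsPositive := by
  refine HilbSp.tensorMap_isPositive fun b => ?_
  cases b
  · exact ContinuousLinearMap.isPositive_one
  · exact hA

lemma HilbSp.ampliate_id : HilbSp.ampliate (ContinuousLinearMap.id ℂ H) =
    ContinuousLinearMap.id ℂ _ := by
  rw [← HilbSp.tensorMap_id, HilbSp.ampliate]
  congr 1
  funext b
  cases b <;> rfl

lemma HilbSp.sum_ampliate {α : Type*} (s : Finset α) (A : α → H →L[ℂ] H) :
    ∑ a ∈ s, HilbSp.ampliate (A a) = HilbSp.ampliate (∑ a ∈ s, A a) := by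
  refine HilbSp.tensor_ext fun x y => ?_
  simp only [HilbSp.ampliate, sum_apply, inner_sum, HilbSp.inner_tensorMap, Fintype.prod_bool]
  let x₁ : H := x true
  let y₁ : H := y true
  change ∑ a ∈ s, ⟪x₁, A a y₁⟫_ℂ * _ = ⟪x₁, (∑ a ∈ s, A a) y₁⟫_ℂ * _
  rw [sum_apply, inner_sum, Finset.sum_mul]
  rfl

/-- Mixtures of vectors are purified by attaching the same ancilla vector to every factor. -/
lemma HilbSp.exists_purification {n : ℕ} (hn : 0 < n) {H : Fin n → HilbSp.{u}}
    {φ : ℕ → HilbSp.tensor H} (hφ : Summable fun k => ‖φ k‖ ^ 2) :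
    ∃ ψ : HilbSp.tensor (fun i => HilbSp.tensor (HilbSp.pair (H i) HilbSp.ell2.{u})),
      ∀ A : ∀ i, H i →L[ℂ] H i, HasSum (fun k => ⟪φ k, HilbSp.tensorMap A (φ k)⟫_ℂ)
        ⟪ψ, HilbSp.tensorMap (fun i => HilbSp.ampliate (A i)) ψ⟫_ℂ := by
  obtain ⟨e, he⟩ := HilbSp.exists_orthonormal_ell2.{u}
  -- The tensor ⨂ᵢ (xᵢ ⊗ eₖ). An ancilla at a single factor would already purify; giving one to each
  -- factor avoids singling out a party.
  let b : ℕ → (∀ i, H i) → HilbSp.tensor (fun i => HilbSp.tensor (HilbSp.pair (H i) HilbSp.ell2.{u})) :=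
    fun k x => HilbSp.tprod fun i => HilbSp.tprod (HilbSp.pairVec (x i) (e k))
  have hb : ∀ j k x y, ⟪b j x, b k y⟫_ℂ =
      (if j = k then 1 else 0) * ⟪HilbSp.tprod x, HilbSp.tprod y⟫_ℂ := by
    intro j k x y
    simp only [b, HilbSp.inner_tprod, Fintype.prod_bool, Finset.prod_mul_distrib]
    have h1 : ∀ i : Fin n, ⟪HilbSp.pairVec (x i) (e j) false, HilbSp.pairVec (y i) (e k) false⟫_ℂ =
        if j = k then 1 else 0 := fun i => orthonormal_iff_ite.1 he j k
    simp only [h1, Finset.prod_const, Finset.card_univ, Fintype.card_fin]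
    -- The ancillas contribute the n-th power of the Kronecker delta. Here n > 0 is essential: for n
    -- = 0 there is no place for an ancilla and the power would be 1.
    rw [mul_comm, ite_pow, one_pow, zero_pow hn.ne']
    rfl
  choose J hJ hJin using fun k => exists_map_of_gram (HilbSp.dense_span_tprod H) (b := b k)
    zero_le_one (fun x y => by rw [hb]; simp)
  have hJJ : ∀ j k (u v : HilbSp.tensor H), ⟪J j u, J k v⟫_ℂ = (if j = k then 1 else 0) * ⟪u, v⟫_ℂ := by
    intro j k u v
    have : (J j).adjoint ∘L J k = (if j = k then (1 : ℂ) else 0) • ContinuousLinearMap.id ℂ _ := by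
      refine HilbSp.tensor_ext fun x y => ?_
      rw [ContinuousLinearMap.comp_apply, ContinuousLinearMap.adjoint_inner_right, hJ, hJ, hb,
        smul_apply, inner_smul_right]
      rfl
    rw [← ContinuousLinearMap.adjoint_inner_right, ← ContinuousLinearMap.comp_apply, this,
      smul_apply, inner_smul_right]
    rfl
  have hcomm : ∀ (A : ∀ i, H i →L[ℂ] H i) k u,
      HilbSp.tensorMap (fun i => HilbSp.ampliate (A i)) (J k u) = J k (HilbSp.tensorMap A u) := by
    intro A k u
    have : HilbSp.tensorMap (fun i => HilbSp.ampliate (A i)) ∘L J k = J k ∘L HilbSp.tensorMap A := by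
      refine HilbSp.tensor_ext_left fun x => ?_
      rw [ContinuousLinearMap.comp_apply, ContinuousLinearMap.comp_apply, HilbSp.tensorMap_tprod,
        hJ, hJ, HilbSp.tensorMap_tprod]
      simp only [b, HilbSp.ampliate, HilbSp.tensorMap_tprod]
      congr 1
      funext i
      congr 1
      funext c
      cases c <;> rfl
    exact congrArg (fun T => T u) this
  let V : ℕ → HilbSp.tensor H →ₗᵢ[ℂ] HilbSp.tensor (fun i => HilbSp.tensor (HilbSp.pair (H i) HilbSp.ell2.{u})) :=
    fun k => (J k).toLinearMap.isometryOfInner (fun u v => by simpa using hJin k u v)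
  have hV : OrthogonalFamily ℂ (fun _ : ℕ => HilbSp.tensor H) V := by
    intro j k hjk u v
    exact (hJJ j k u v).trans (by simp [hjk])
  have hsum := ((hV.summable_iff_norm_sq_summable φ).2 hφ).hasSum
  have hsum : HasSum (fun k => J k (φ k)) (∑' k, J k (φ k)) := hsum
  refine ⟨∑' k, J k (φ k), fun A => ?_⟩
  set ψ := ∑' k, J k (φ k)
  have h1 := (innerSL ℂ ψ).hasSum
    ((HilbSp.tensorMap (fun i => HilbSp.ampliate (A i))).hasSum hsum)
  simp only [innerSL_apply_apply, hcomm] at h1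
  -- The isometries J k have mutually orthogonal ranges, so (J k)† recovers φ k from ψ, and no cross
  -- terms survive.
  have h2 : ∀ k v, ⟪ψ, J k v⟫_ℂ = ⟪φ k, v⟫_ℂ := by
    intro k v
    rw [← ContinuousLinearMap.adjoint_inner_left]
    congr 1
    refine ((J k).adjoint.hasSum hsum).unique ?_
    have h3 : ∀ j, (J k).adjoint (J j (φ j)) = if k = j then φ j else 0 := fun j =>
      ext_inner_left ℂ fun w => by
        rw [ContinuousLinearMap.adjoint_inner_right, hJJ]
        split_ifs <;> simp
    simp only [h3]
    convert hasSum_single k (f := fun j => if k = j then φ j else 0) ?_ using 1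
    · simp
    · intro j hj
      simp [hj.symm]
  simpa only [h2] using h1

end Purification

/-! ### Systems carried by sets of edges -/

namespace CausalGraph

variable {V : Type} [Fintype V] {G : CausalGraph V} {H : G.Edge → HilbSp.{u}}

lemma inner_elementary (S : Finset G.Edge) (x y : ∀ e, H e) :
    ⟪elementary S x, elementary S y⟫_ℂ = ∏ e ∈ S, ⟪x e, y e⟫_ℂ := by
  refine (HilbSp.inner_tprod _ _).trans ?_
  exact Finset.prod_coe_sort S fun e => ⟪x e, y e⟫_ℂ

lemma dense_span_elementary (H : G.Edge → HilbSp.{u}) (S : Finset G.Edge) :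
    Dense (Submodule.span ℂ (Set.range (elementary (H := H) S)) : Set (system H S)) := by
  classical
  have h : Set.range (elementary (H := H) S) = Set.range (HilbSp.tprod (H := fun e : S => H e)) := by
    apply Set.Subset.antisymm
    · rintro _ ⟨x, rfl⟩
      exact ⟨_, rfl⟩
    · rintro _ ⟨x, rfl⟩
      -- Only the vectors on S enter, so a family on S may be extended by zero.
      refine ⟨fun e => if h : e ∈ S then x ⟨e, h⟩ else 0, ?_⟩
      unfold elementary
      congr 1
      funext e
      simp
  rw [h]
  exact HilbSp.dense_span_tprod _

lemma system_ext {S : Finset G.Edge} {A B : system H S →L[ℂ] system H S}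
    (h : ∀ x y, ⟪elementary S x, A (elementary S y)⟫_ℂ = ⟪elementary S x, B (elementary S y)⟫_ℂ) :
    A = B :=
  ContinuousLinearMap.eq_of_inner_dense_family (dense_span_elementary H S)
    (dense_span_elementary H S) h

/-- On the empty system the trace is the only matrix element. -/
lemma opTrace_of_eq_empty {S : Finset G.Edge} (hS : S = ∅) (T : system H S →L[ℂ] system H S)
    (x y : ∀ e, H e) : opTrace T = ⟪elementary S x, T (elementary S y)⟫_ℂ := by
  subst hS
  have hxy : ∀ x y : ∀ e, H e, elementary (∅ : Finset G.Edge) x = elementary ∅ y := by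
    intro x y
    unfold elementary
    congr 1
    funext e
    exact absurd e.2 (Finset.notMem_empty _)
  rw [hxy y x]
  set e := elementary (∅ : Finset G.Edge) x with he
  -- All elementary vectors of the empty system coincide with one unit vector e, which spans a dense
  -- subspace; so T is determined by T e.
  have hid : T = InnerProductSpace.rankOne ℂ (T e) e := by
    refine ContinuousLinearMap.eq_of_dense_family (dense_span_elementary H ∅) fun z => ?_
    rw [hxy z x, InnerProductSpace.rankOne_apply, ← he, he, inner_elementary]
    simp
  conv_lhs => rw [hid]
  exact opTrace_rankOne _ _

lemma isTraceClass_of_eq_empty {S : Finset G.Edge} (hS : S = ∅)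
    (T : system H S →L[ℂ] system H S) : IsTraceClass (system H S) T := by
  subst hS
  set e := elementary (∅ : Finset G.Edge) (fun e => (0 : H e)) with he
  have hid : T = InnerProductSpace.rankOne ℂ (T e) e := by
    refine ContinuousLinearMap.eq_of_dense_family (dense_span_elementary H ∅) fun z => ?_
    have : elementary (∅ : Finset G.Edge) z = e := by
      rw [he]
      unfold elementary
      congr 1
      funext e
      exact absurd e.2 (Finset.notMem_empty _)
    rw [this, InnerProductSpace.rankOne_apply, he, inner_elementary]
    simp
  rw [hid]
  exact (hasRankOneSum_rankOne _ _).isTraceClass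

/-- A stage at which nothing happens and no system is present does not change the trace. -/
lemma IsParallel.opTrace_eq {k : ℕ}
    {g : ∀ v, QuantumOp (system H (G.incoming v)) (system H (G.outgoing v))}
    {F : QuantumOp (system H (G.cut k)) (system H (G.cut (k + 1)))} (hF : IsParallel k g F)
    (hl : G.layer k = ∅) (hp : G.passing k = ∅) (hc : G.cut k = ∅) (hc' : G.cut (k + 1) = ∅)
    (T : TraceClass (system H (G.cut k))) : opTrace (F.toFun T).1 = opTrace T.1 := by
  let e := elementary (G.passing k) (fun e => (0 : H e))
  -- With no node in the layer and trivial systems, T is the "product" of this scalar operator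
  -- alone, and parallelism returns the same scalar on the output side.
  let B : TraceClass (system H (G.passing k)) := opTrace T.1 • TraceClass.rankOne e e
  have hB : ∀ x y : ∀ e, H e,
      ⟪elementary (G.passing k) x, B.1 (elementary (G.passing k) y)⟫_ℂ = opTrace T.1 := by
    intro x y
    have : B.1 = opTrace T.1 • InnerProductSpace.rankOne ℂ e e := rfl
    rw [this, smul_apply, InnerProductSpace.rankOne_apply, inner_smul_right, inner_smul_right,
      inner_elementary, inner_elementary]
    simp [hp]
  have h := hF (fun _ => 0) B T (fun x y => by
    rw [hB, hl, Finset.prod_empty, one_mul, opTrace_of_eq_empty hc _ x y])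
  have h0 := h (fun _ => 0) (fun _ => 0)
  rw [hB, hl, Finset.prod_empty, one_mul, ← opTrace_of_eq_empty hc'] at h0
  exact h0

end CausalGraph

/-! ### Stages and edges of the Bell scenario -/

namespace BellNode

open CausalGraph

variable {n : ℕ}

/-- The edge `s → aᵢ`. -/
def sEdge (i : Fin n) : (bellScenario n).Edge := ⟨(source, outcome i), Adj.source i⟩

/-- The edge `xᵢ → aᵢ`. -/
def xEdge (i : Fin n) : (bellScenario n).Edge := ⟨(setting i, outcome i), Adj.setting i⟩

@[simp] lemma src_sEdge (i : Fin n) : (sEdge i).src = source := rfl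
@[simp] lemma tar_sEdge (i : Fin n) : (sEdge i).tar = outcome i := rfl
@[simp] lemma src_xEdge (i : Fin n) : (xEdge i).src = setting i := rfl
@[simp] lemma tar_xEdge (i : Fin n) : (xEdge i).tar = outcome i := rfl

lemma edge_cases (e : (bellScenario n).Edge) : (∃ i, e = sEdge i) ∨ ∃ i, e = xEdge i := by
  obtain ⟨⟨a, b⟩, h⟩ := e
  cases h with
  | source i => exact Or.inl ⟨i, rfl⟩
  | setting i => exact Or.inr ⟨i, rfl⟩

/-- The family of vectors with values `u i` at `s → aᵢ` and `w i` at `xᵢ → aᵢ`. -/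
def glue {H : (bellScenario n).Edge → HilbSp.{u}} (u : ∀ i, H (sEdge i)) (w : ∀ i, H (xEdge i)) :
    ∀ e, H e
  | ⟨(source, outcome i), _⟩ => u i
  | ⟨(setting i, outcome j), h⟩ =>
    have hij : j = i := by cases h; rfl
    by subst hij; exact w j
  | ⟨(source, source), h⟩ => absurd h (fun h => by cases h)
  | ⟨(source, setting _), h⟩ => absurd h (fun h => by cases h)
  | ⟨(setting _, source), h⟩ => absurd h (fun h => by cases h)
  | ⟨(setting _, setting _), h⟩ => absurd h (fun h => by cases h)
  | ⟨(outcome _, _), h⟩ => absurd h (fun h => by cases h)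

section Glue

variable {H : (bellScenario n).Edge → HilbSp.{u}} (u : ∀ i, H (sEdge i)) (w : ∀ i, H (xEdge i))

@[simp] lemma glue_sEdge (i : Fin n) : glue u w (sEdge i) = u i := rfl
@[simp] lemma glue_xEdge (i : Fin n) : glue u w (xEdge i) = w i := rfl

end Glue

lemma adj_iff (a b : BellNode n) : (bellScenario n).adj a b ↔
    ∃ i, b = outcome i ∧ (a = source ∨ a = setting i) := by
  constructor
  · intro h
    cases h with
    | source i => exact ⟨i, rfl, Or.inl rfl⟩
    | setting i => exact ⟨i, rfl, Or.inr rfl⟩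
  · rintro ⟨i, rfl, rfl | rfl⟩
    · exact Adj.source i
    · exact Adj.setting i

lemma mem_executed_one (v : BellNode n) :
    v ∈ (bellScenario n).executed 1 ↔ ∀ i, v ≠ outcome i := by
  simp only [executed, Finset.mem_filter, Finset.mem_univ, true_and, adj_iff, Finset.notMem_empty]
  constructor
  · rintro h i rfl
    exact h source ⟨i, rfl, Or.inl rfl⟩
  · rintro h u ⟨i, hi, -⟩
    exact h i hi

/-- Nodes without parents belong to every executed set from index 1 on, and they are the only
parents of the outcome nodes. -/
lemma executed_add_two (k : ℕ) : (bellScenario n).executed (k + 2) = Finset.univ := by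
  have h : ∀ k, ∀ v : BellNode n, (∀ i, v ≠ outcome i) → v ∈ (bellScenario n).executed (k + 1) := by
    intro k v hv
    simp only [executed, Finset.mem_filter, Finset.mem_univ, true_and, adj_iff]
    rintro u ⟨i, hi, -⟩
    exact absurd hi (hv i)
  ext v
  simp only [Finset.mem_univ, iff_true]
  rw [executed]
  simp only [Finset.mem_filter, Finset.mem_univ, true_and, adj_iff]
  rintro u ⟨i, -, rfl | rfl⟩ <;> exact h k _ (by simp)

-- Every edge leads from the first layer to the second, so no system ever waits. The identity factor
-- in `IsParallel` is therefore only a scalar.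
@[simp] lemma passing_eq_empty : ∀ k, (bellScenario n).passing k = ∅
  | 0 => by ext; simp [passing, executed]
  | k + 1 => by ext; simp [passing, executed_add_two]

@[simp] lemma cut_zero : (bellScenario n).cut 0 = ∅ := by
  ext; simp [cut, executed]

@[simp] lemma cut_add_two (k : ℕ) : (bellScenario n).cut (k + 2) = ∅ := by
  ext; simp [cut, executed_add_two]

@[simp] lemma layer_add_two (k : ℕ) : (bellScenario n).layer (k + 2) = ∅ := by
  ext; simp [layer, executed_add_two]

lemma cut_one : (bellScenario n).cut 1 = Finset.univ := by
  ext e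
  simp only [cut, Finset.mem_filter, Finset.mem_univ, true_and, mem_executed_one, iff_true]
  rcases edge_cases e with ⟨i, rfl⟩ | ⟨i, rfl⟩ <;> simp

lemma layer_zero : (bellScenario n).layer 0 = insert source (Finset.univ.image setting) := by
  ext v
  simp only [layer, executed, Finset.sdiff_empty, Finset.mem_insert,
    Finset.mem_image, Finset.mem_univ, true_and]
  change v ∈ (bellScenario n).executed 1 ↔ _
  rw [mem_executed_one]
  cases v <;> simp

lemma layer_one : (bellScenario n).layer 1 = Finset.univ.image outcome := by
  ext v
  simp only [layer, executed_add_two 0, Finset.mem_sdiff, Finset.mem_univ, true_and,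
    mem_executed_one, Finset.mem_image]
  cases v <;> simp

lemma prod_layer_zero {M : Type*} [CommMonoid M] (f : BellNode n → M) :
    ∏ v ∈ (bellScenario n).layer 0, f v = f source * ∏ i, f (setting i) := by
  rw [layer_zero, Finset.prod_insert (by simp),
    Finset.prod_image (fun a _ b _ h => by simpa using h)]

lemma prod_layer_one {M : Type*} [CommMonoid M] (f : BellNode n → M) :
    ∏ v ∈ (bellScenario n).layer 1, f v = ∏ i, f (outcome i) := by
  rw [layer_one, Finset.prod_image (fun a _ b _ h => by simpa using h)]

lemma prod_edges {M : Type*} [CommMonoid M] (f : (bellScenario n).Edge → M) :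
    ∏ e, f e = (∏ i, f (sEdge i)) * ∏ i, f (xEdge i) := by
  classical
  have hs : Function.Injective (sEdge (n := n)) := fun i j h => by
    have := congrArg Edge.tar h; simpa using this
  have hx : Function.Injective (xEdge (n := n)) := fun i j h => by
    have := congrArg Edge.tar h; simpa using this
  have hu : (Finset.univ : Finset (bellScenario n).Edge) =
      Finset.univ.image sEdge ∪ Finset.univ.image xEdge := by
    ext e
    rcases edge_cases e with ⟨i, rfl⟩ | ⟨i, rfl⟩ <;> simp
  rw [hu, Finset.prod_union, Finset.prod_image hs.injOn, Finset.prod_image hx.injOn]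
  rw [Finset.disjoint_left]
  simp only [Finset.mem_image, Finset.mem_univ, true_and, not_exists]
  rintro _ ⟨i, rfl⟩ j h
  have := congrArg Edge.src h
  simp at this

@[simp] lemma incoming_source : (bellScenario n).incoming source = ∅ := by
  ext e
  simp only [incoming, Finset.mem_filter, Finset.mem_univ, true_and, Finset.notMem_empty, iff_false]
  rcases edge_cases e with ⟨i, rfl⟩ | ⟨i, rfl⟩ <;> simp

@[simp] lemma incoming_setting (i : Fin n) : (bellScenario n).incoming (setting i) = ∅ := by
  ext e
  simp only [incoming, Finset.mem_filter, Finset.mem_univ, true_and, Finset.notMem_empty, iff_false]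
  rcases edge_cases e with ⟨i, rfl⟩ | ⟨i, rfl⟩ <;> simp

@[simp] lemma outgoing_outcome (i : Fin n) : (bellScenario n).outgoing (outcome i) = ∅ := by
  ext e
  simp only [outgoing, Finset.mem_filter, Finset.mem_univ, true_and, Finset.notMem_empty, iff_false]
  rcases edge_cases e with ⟨i, rfl⟩ | ⟨i, rfl⟩ <;> simp

lemma prod_incoming_outcome {M : Type*} [CommMonoid M] (i : Fin n)
    (f : (bellScenario n).Edge → M) :
    ∏ e ∈ (bellScenario n).incoming (outcome i), f e = f (sEdge i) * f (xEdge i) := by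
  classical
  rw [incoming, Finset.prod_filter, prod_edges]
  simp

lemma prod_outgoing_source {M : Type*} [CommMonoid M] (f : (bellScenario n).Edge → M) :
    ∏ e ∈ (bellScenario n).outgoing source, f e = ∏ i, f (sEdge i) := by
  classical
  rw [outgoing, Finset.prod_filter, prod_edges]
  simp

lemma prod_outgoing_setting {M : Type*} [CommMonoid M] (i : Fin n)
    (f : (bellScenario n).Edge → M) :
    ∏ e ∈ (bellScenario n).outgoing (setting i), f e = f (xEdge i) := by
  classical
  rw [outgoing, Finset.prod_filter, prod_edges]
  simp

/-! ### Maps between the systems of the Bell scenario -/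

section Maps

variable (H : (bellScenario n).Edge → HilbSp.{u})

/-- The outgoing system of the source is `⨂ᵢ H (s → aᵢ)`. -/
lemma exists_readSource : ∃ U : system H ((bellScenario n).outgoing source) →L[ℂ]
      HilbSp.tensor (fun i => H (sEdge i)),
    (∀ x, U (elementary _ x) = HilbSp.tprod fun i => x (sEdge i)) ∧
    (∀ x : ∀ e, H e, U.adjoint (HilbSp.tprod fun i => x (sEdge i)) = elementary _ x) ∧
    U.adjoint ∘L U = ContinuousLinearMap.id ℂ _ ∧ U ∘L U.adjoint = ContinuousLinearMap.id ℂ _ := by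
  have hd := dense_span_elementary H ((bellScenario n).outgoing source)
  obtain ⟨U, hU, hin⟩ := exists_map_of_gram hd
    (b := fun x => HilbSp.tprod fun i => x (sEdge i)) zero_le_one (fun x y => by
      rw [inner_elementary, prod_outgoing_source, HilbSp.inner_tprod]; simp)
  have hU' : ∀ x : ∀ e, H e, U.adjoint (HilbSp.tprod fun i => x (sEdge i)) = elementary _ x := by
    intro x
    refine ContinuousLinearMap.adjoint_apply_eq_of_dense_family hd fun y => ?_
    rw [hU, inner_elementary, prod_outgoing_source, HilbSp.inner_tprod]
  refine ⟨U, hU, hU', ?_, ?_⟩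
  · refine ContinuousLinearMap.eq_of_dense_family hd fun x => ?_
    rw [ContinuousLinearMap.comp_apply, hU, hU']; rfl
  · refine HilbSp.tensor_ext_left fun x => ?_
    have h1 := hU' (glue x 0)
    have h2 := hU (glue x 0)
    simp only [glue_sEdge] at h1 h2
    rw [ContinuousLinearMap.comp_apply, h1, h2]; rfl

/-- The outgoing system of `xᵢ` is `H (xᵢ → aᵢ)`. -/
lemma exists_readSetting (i : Fin n) :
    ∃ R : system H ((bellScenario n).outgoing (setting i)) →L[ℂ] H (xEdge i),
    (∀ x, R (elementary _ x) = x (xEdge i)) ∧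
    (∀ x : ∀ e, H e, R.adjoint (x (xEdge i)) = elementary _ x) ∧
    R.adjoint ∘L R = ContinuousLinearMap.id ℂ _ ∧ R ∘L R.adjoint = ContinuousLinearMap.id ℂ _ := by
  have hd := dense_span_elementary H ((bellScenario n).outgoing (setting i))
  obtain ⟨U, hU, hin⟩ := exists_map_of_gram hd
    (b := fun x => x (xEdge i)) zero_le_one (fun x y => by
      rw [inner_elementary, prod_outgoing_setting]; simp)
  have hU' : ∀ x : ∀ e, H e, U.adjoint (x (xEdge i)) = elementary _ x := by
    intro x
    refine ContinuousLinearMap.adjoint_apply_eq_of_dense_family hd fun y => ?_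
    rw [hU, inner_elementary, prod_outgoing_setting]
  refine ⟨U, hU, hU', ?_, ?_⟩
  · refine ContinuousLinearMap.eq_of_dense_family hd fun x => ?_
    rw [ContinuousLinearMap.comp_apply, hU, hU']; rfl
  · ext z
    have h1 := hU' (glue 0 (Pi.single i z))
    have h2 := hU (glue 0 (Pi.single i z))
    simp only [glue_xEdge, Pi.single_eq_same] at h1 h2
    rw [ContinuousLinearMap.comp_apply, h1, h2]; rfl

/-- Attaching fixed vectors at the edges `xᵢ → aᵢ`. -/
lemma exists_attachSettings (w : ∀ i, H (xEdge i)) :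
    ∃ V : HilbSp.tensor (fun i => H (sEdge i)) →L[ℂ] system H ((bellScenario n).cut 1),
    (∀ u, V (HilbSp.tprod u) = elementary _ (glue u w)) ∧
    (∀ y : ∀ e, H e, V.adjoint (elementary _ y) =
      (∏ i, ⟪w i, y (xEdge i)⟫_ℂ) • HilbSp.tprod fun i => y (sEdge i)) ∧
    ‖V‖ ≤ ∏ i, ‖w i‖ := by
  have hd := HilbSp.dense_span_tprod (fun i => H (sEdge i))
  have hprod : ∀ x y : ∀ e, H e, ⟪elementary ((bellScenario n).cut 1) x, elementary _ y⟫_ℂ =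
      (∏ i, ⟪x (sEdge i), y (sEdge i)⟫_ℂ) * ∏ i, ⟪x (xEdge i), y (xEdge i)⟫_ℂ := by
    intro x y
    rw [inner_elementary, cut_one, prod_edges]
  obtain ⟨V, hV, hin⟩ := exists_map_of_gram hd (c := ∏ i, ‖w i‖ ^ 2)
    (b := fun u => elementary ((bellScenario n).cut 1) (glue u w)) (by positivity) (fun x y => by
      rw [hprod, HilbSp.inner_tprod]
      simp only [glue_sEdge, glue_xEdge, inner_self_eq_norm_sq_to_K]
      push_cast
      exact mul_comm _ _)
  refine ⟨V, hV, fun y => ?_, ?_⟩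
  · refine ContinuousLinearMap.adjoint_apply_eq_of_dense_family hd fun u => ?_
    rw [hV, hprod, inner_smul_right, HilbSp.inner_tprod]
    simp only [glue_sEdge, glue_xEdge]
    exact mul_comm _ _
  · refine ContinuousLinearMap.opNorm_le_bound _ (by positivity) fun z => ?_
    have h1 := congrArg Complex.re (hin z z)
    simp only [inner_self_eq_norm_sq_to_K] at h1
    have h2 : ‖V z‖ ^ 2 = ((∏ i, ‖w i‖) * ‖z‖) ^ 2 := by
      rw [mul_pow, ← Finset.prod_pow]
      simpa [← Complex.ofReal_pow, ← Complex.ofReal_prod, ← Complex.ofReal_mul] using h1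
    exact ((sq_eq_sq₀ (norm_nonneg _) (by positivity)).1 h2).le

/-- Attaching a fixed vector at the edge `xᵢ → aᵢ`. -/
lemma exists_attachSetting (i : Fin n) (w : H (xEdge i)) :
    ∃ W : H (sEdge i) →L[ℂ] system H ((bellScenario n).incoming (outcome i)),
    (∀ y : ∀ e, H e, W.adjoint (elementary _ y) = ⟪w, y (xEdge i)⟫_ℂ • y (sEdge i)) ∧
    (∀ u v, ⟪W u, W v⟫_ℂ = ⟪w, w⟫_ℂ * ⟪u, v⟫_ℂ) ∧ ‖W‖ ≤ ‖w‖ := by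
  -- The space serves as its own total family, indexed by all its vectors.
  have hd : Dense (Submodule.span ℂ (Set.range fun u : H (sEdge i) => u) : Set (H (sEdge i))) := by
    have : Set.range (fun u : H (sEdge i) => u) = Set.univ := Set.range_id
    rw [this, Submodule.span_univ]
    exact dense_univ
  have hprod : ∀ x y : ∀ e, H e,
      ⟪elementary ((bellScenario n).incoming (outcome i)) x, elementary _ y⟫_ℂ =
      ⟪x (sEdge i), y (sEdge i)⟫_ℂ * ⟪x (xEdge i), y (xEdge i)⟫_ℂ := by
    intro x y
    rw [inner_elementary, prod_incoming_outcome]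
  -- The edges to other parties do not enter the incoming system of party i, so they are filled with
  -- zero vectors.
  obtain ⟨W, hW, hin⟩ := exists_map_of_gram hd (c := ‖w‖ ^ 2)
    (b := fun u => elementary ((bellScenario n).incoming (outcome i))
      (glue (Pi.single i u) (Pi.single i w))) (by positivity) (fun x y => by
      rw [hprod]
      simp only [glue_sEdge, glue_xEdge, Pi.single_eq_same, inner_self_eq_norm_sq_to_K]
      push_cast
      exact mul_comm _ _)
  refine ⟨W, fun y => ?_, fun u v => ?_, ?_⟩
  · refine ContinuousLinearMap.adjoint_apply_eq_of_dense_family hd fun u => ?_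
    rw [hW, hprod, inner_smul_right]
    simp only [glue_sEdge, glue_xEdge, Pi.single_eq_same]
    exact mul_comm _ _
  · rw [hin, inner_self_eq_norm_sq_to_K w]; simp
  · refine ContinuousLinearMap.opNorm_le_bound _ (norm_nonneg _) fun z => ?_
    have h1 := congrArg Complex.re (hin z z)
    simp only [inner_self_eq_norm_sq_to_K] at h1
    have h2 : ‖W z‖ ^ 2 = (‖w‖ * ‖z‖) ^ 2 := by
      rw [mul_pow]
      simpa [← Complex.ofReal_pow, ← Complex.ofReal_mul] using h1
    exact ((sq_eq_sq₀ (norm_nonneg _) (by positivity)).1 h2).le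

end Maps

end BellNode

/-! ### Marginals and the free will equation -/

namespace BellNode

variable {n : ℕ} {O : BellNode n → Type v}

/-- The joint outcome with the given values at the nodes. -/
def assemble (s : O source) (x : ∀ i, O (setting i)) (a : ∀ i, O (outcome i)) : ∀ v, O v
  | source => s
  | setting i => x i
  | outcome i => a i

@[simp] lemma assemble_source (s : O source) (x : ∀ i, O (setting i)) (a : ∀ i, O (outcome i)) :
    assemble s x a source = s := rfl
@[simp] lemma assemble_setting (s : O source) (x : ∀ i, O (setting i)) (a : ∀ i, O (outcome i))
    (i : Fin n) : assemble s x a (setting i) = x i := rfl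
@[simp] lemma assemble_outcome (s : O source) (x : ∀ i, O (setting i)) (a : ∀ i, O (outcome i))
    (i : Fin n) : assemble s x a (outcome i) = a i := rfl

lemma assemble_eta (o : ∀ v, O v) :
    assemble (o source) (fun i => o (setting i)) (fun i => o (outcome i)) = o := by
  funext v
  cases v <;> rfl

variable [∀ v, Fintype (O v)]

lemma sum_outcomes (f : (∀ v, O v) → ℝ) :
    ∑ o, f o = ∑ s, ∑ x : ∀ i, O (setting i), ∑ a : ∀ i, O (outcome i), f (assemble s x a) := by
  let e : (O source × (∀ i, O (setting i)) × (∀ i, O (outcome i))) ≃ (∀ v, O v) :=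
    { toFun := fun p => assemble p.1 p.2.1 p.2.2
      invFun := fun o => (o source, fun i => o (setting i), fun i => o (outcome i))
      left_inv := fun p => rfl
      right_inv := assemble_eta }
  rw [← e.sum_comp]
  simp only [Fintype.sum_prod_type]
  rfl

open Classical in
lemma marginal_source_setting (P : (∀ v, O v) → ℝ) (o : ∀ v, O v) :
    marginal P (Set.range setting ∪ {source}) o =
      ∑ a : ∀ i, O (outcome i), P (assemble (o source) (fun i => o (setting i)) a) := by
  rw [marginal, Finset.sum_filter, sum_outcomes]
  rw [Finset.sum_eq_single (o source)]
  · rw [Finset.sum_eq_single (fun i => o (setting i))]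
    · refine Finset.sum_congr rfl fun a _ => if_pos ?_
      rintro v (⟨i, rfl⟩ | rfl) <;> rfl
    · intro x _ hx
      refine Finset.sum_eq_zero fun a _ => if_neg fun h => hx ?_
      funext i
      exact h (setting i) (Or.inl ⟨i, rfl⟩)
    · simp
  · intro s _ hs
    refine Finset.sum_eq_zero fun x _ => Finset.sum_eq_zero fun a _ => if_neg fun h => hs ?_
    exact h source (Or.inr rfl)
  · simp

lemma marginal_univ (P : (∀ v, O v) → ℝ) (o : ∀ v, O v) : marginal P Set.univ o = P o := by
  classical
  rw [marginal, Finset.sum_filter, Finset.sum_eq_single o]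
  · simp
  · intro o' _ h
    refine if_neg fun h' => h ?_
    funext v
    exact h' v trivial
  · simp

lemma condProb_eq (P : (∀ v, O v) → ℝ) (o : ∀ v, O v) :
    condProb P (Set.range outcome) (Set.range setting ∪ {source}) o =
      P o / marginal P (Set.range setting ∪ {source}) o := by
  have : (Set.range outcome ∪ (Set.range setting ∪ {source}) : Set (BellNode n)) = Set.univ := by
    ext v; cases v <;> simp
  rw [condProb, this, marginal_univ]

lemma marginal_nonneg {P : (∀ v, O v) → ℝ} (hP : ∀ o, 0 ≤ P o) (U : Set (BellNode n))
    (o : ∀ v, O v) : 0 ≤ marginal P U o :=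
  Finset.sum_nonneg fun o' _ => hP o'

lemma le_marginal {P : (∀ v, O v) → ℝ} (hP : ∀ o, 0 ≤ P o) (U : Set (BellNode n))
    (o : ∀ v, O v) : P o ≤ marginal P U o := by
  classical
  exact Finset.single_le_sum (f := P) (fun o' _ => hP o') (by simp)

/-- The marginal at a node depends only on the value at this node. -/
lemma marginal_singleton_congr (P : (∀ v, O v) → ℝ) {v : BellNode n} {o o' : ∀ v, O v}
    (h : o v = o' v) : marginal P {v} o = marginal P {v} o' := by
  rw [marginal, marginal]
  congr 1
  ext o''
  simp [h]

/-- Each joint outcome o' is counted exactly once, for a = o' v. For a normalised P this makes the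
marginal at v a probability vector on `O v`, whatever the reference outcome o. -/
lemma sum_marginal_singleton (P : (∀ v, O v) → ℝ) (v : BellNode n) (o : ∀ v, O v) :
    ∑ a : O v, marginal P {v} (Function.update o v a) = ∑ o, P o := by
  classical
  simp only [marginal, Set.mem_singleton_iff, forall_eq, Function.update_self, Finset.sum_filter]
  rw [Finset.sum_comm]
  refine Finset.sum_congr rfl fun o' _ => ?_
  simp

section Product

variable {P : (∀ v, O v) → ℝ} {p : O source → ℝ} {q : ∀ i, O (setting i) → ℝ}

lemma marginal_source_of_product
    (h : ∀ s x, ∑ a : ∀ i, O (outcome i), P (assemble s x a) = p s * ∏ i, q i (x i))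
    (hq : ∀ i, ∑ x, q i x = 1) (o : ∀ v, O v) : marginal P {source} o = p (o source) := by
  classical
  rw [marginal, Finset.sum_filter, sum_outcomes, Finset.sum_eq_single (o source)]
  · simp only [Set.mem_singleton_iff, forall_eq, assemble_source, if_true, h]
    rw [← Finset.mul_sum, ← Fintype.piFinset_univ, ← Finset.prod_univ_sum]
    simp [hq]
  · intro s _ hs
    simp [hs]
  · simp

lemma marginal_setting_of_product
    (h : ∀ s x, ∑ a : ∀ i, O (outcome i), P (assemble s x a) = p s * ∏ i, q i (x i))
    (hp : ∑ s, p s = 1) (hq : ∀ i, ∑ x, q i x = 1) (i : Fin n) (o : ∀ v, O v) :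
    marginal P {setting i} o = q i (o (setting i)) := by
  classical
  rw [marginal, Finset.sum_filter, sum_outcomes]
  simp only [Set.mem_singleton_iff, forall_eq, assemble_setting]
  have h1 : ∀ s, (∑ x : ∀ i, O (setting i), ∑ a : ∀ i, O (outcome i),
      if x i = o (setting i) then P (assemble s x a) else 0) = p s * q i (o (setting i)) := by
    intro s
    -- The tuples with prescribed i-th entry form a box, over which the sum of products factorizes.
    let t : ∀ j, Finset (O (setting j)) :=
      Function.update (fun _ => Finset.univ) i {o (setting i)}
    have h2 : ∀ x : ∀ i, O (setting i), x ∈ Fintype.piFinset t ↔ x i = o (setting i) := by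
      intro x
      rw [Fintype.mem_piFinset]
      constructor
      · intro hx
        simpa [t] using hx i
      · intro hx j
        rcases eq_or_ne j i with rfl | hj
        · simpa [t] using hx
        · simp [t, hj]
    calc _ = ∑ x ∈ Fintype.piFinset t, p s * ∏ j, q j (x j) := by
          have : Fintype.piFinset t = Finset.univ.filter fun x => x i = o (setting i) := by
            ext x; simp [h2]
          rw [this, Finset.sum_filter]
          refine Finset.sum_congr rfl fun x _ => ?_
          split_ifs
          · exact h s x
          · simp
      _ = p s * ∏ j, ∑ y ∈ t j, q j y := by rw [← Finset.mul_sum, ← Finset.prod_univ_sum]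
      _ = _ := by
          rw [Finset.prod_eq_single i]
          · simp [t]
          · intro j _ hj
            simp [t, hj, hq]
          · simp
  simp only [h1]
  rw [← Finset.sum_mul, hp, one_mul]

/-- If the joint law of source and settings is a product of normalised weights, these weights are
its marginals, and the free will equation repeats the factorization. -/
lemma freeWill_of_product
    (h : ∀ s x, ∑ a : ∀ i, O (outcome i), P (assemble s x a) = p s * ∏ i, q i (x i))
    (hp : ∑ s, p s = 1) (hq : ∀ i, ∑ x, q i x = 1) : FreeWill P := by
  intro o
  rw [marginal_source_setting, h, marginal_source_of_product h hq]
  simp only [marginal_setting_of_product h hp hq]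
  exact mul_comm _ _

end Product

end BellNode

/-! ### From a quantum correlation to a mixture with local effects -/

lemma TraceClass.opTrace_sum {H : HilbSp.{u}} {α : Type*} (s : Finset α) (T : α → TraceClass H) :
    opTrace (∑ a ∈ s, (T a).1) = ∑ a ∈ s, opTrace (T a).1 := by
  have := map_sum (TraceClass.trace H) T s
  rw [TraceClass.trace_apply] at this
  rw [AddSubmonoidClass.coe_finsetSum] at this
  exact this

lemma TraceClass.trace_conj_isometry {H K : HilbSp.{u}} {U : H →L[ℂ] K}
    (hU : U.adjoint ∘L U = ContinuousLinearMap.id ℂ H) (T : TraceClass H) :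
    opTrace (TraceClass.conj U U.adjoint T).1 = opTrace T.1 := by
  have h1 : (TraceClass.conj U U.adjoint T).1 = U ∘L T.1 ∘L U.adjoint := rfl
  rw [h1, opTrace_comp_comm T.2, ← ContinuousLinearMap.comp_assoc, hU]
  rfl

lemma TraceClass.isPositive_conj {H K : HilbSp.{u}} (U : H →L[ℂ] K) {T : TraceClass H}
    (hT : T.1.IsPositive) : (TraceClass.conj U U.adjoint T).1.IsPositive :=
  hT.conj_adjoint U

lemma TraceClass.inner_conj {H K : HilbSp.{u}} (U : H →L[ℂ] K) (T : TraceClass H) (y z : K) :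
    ⟪y, (TraceClass.conj U U.adjoint T).1 z⟫_ℂ = ⟪U.adjoint y, T.1 (U.adjoint z)⟫_ℂ := by
  rw [ContinuousLinearMap.adjoint_inner_left]
  rfl

namespace BellNode

open CausalGraph

variable {n : ℕ}

section AttachStates

variable {H : (bellScenario n).Edge → HilbSp.{u}}

/-- Tensoring with product states on the edges `xᵢ → aᵢ`. -/
lemma exists_attachStates {σ : ∀ i, H (xEdge i) →L[ℂ] H (xEdge i)} {χ : ∀ i, ℕ → H (xEdge i)}
    (hσ : ∀ i, HasRankOneSum (σ i) (χ i) (χ i)) :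
    ∃ Φ : TraceClass (HilbSp.tensor fun i => H (sEdge i)) →ₗ[ℂ]
        TraceClass (system H ((bellScenario n).cut 1)),
      (∀ T, T.1.IsPositive → (Φ T).1.IsPositive) ∧
      ∀ T (x y : ∀ e, H e), ⟪elementary _ x, (Φ T).1 (elementary _ y)⟫_ℂ =
        ⟪HilbSp.tprod fun i => x (sEdge i), T.1 (HilbSp.tprod fun i => y (sEdge i))⟫_ℂ *
          ∏ i, ⟪x (xEdge i), σ i (y (xEdge i))⟫_ℂ := by
  -- As σ i = ∑ₖ |χ i k⟩⟨χ i k|, tensoring with all σ i is a Kraus map: the operator V l attaches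
  -- the vectors χ i (l i), for each multi-index l.
  choose V _ hV hVn using fun l : Fin n → ℕ => exists_attachSettings H (fun i => χ i (l i))
  have hs : Summable fun l => ‖V l‖ ^ 2 := by
    have h1 := (hasSum_pi_prod (f := fun i k => ((‖χ i k‖ * ‖χ i k‖ : ℝ) : ℂ))
      (fun i => by simpa using (hσ i).1)
      (fun i => (Complex.hasSum_ofReal.2 (hσ i).1.hasSum))).1
    refine Summable.of_nonneg_of_le (fun _ => by positivity) (fun l => ?_) h1
    calc ‖V l‖ ^ 2 ≤ (∏ i, ‖χ i (l i)‖) ^ 2 := by gcongr; exact hVn l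
      _ = _ := by
        rw [pow_two, ← Finset.prod_mul_distrib, norm_prod]
        refine Finset.prod_congr rfl fun i _ => ?_
        rw [Complex.norm_real, Real.norm_of_nonneg (by positivity)]
  refine ⟨TraceClass.kraus V hs, fun T hT => TraceClass.isPositive_kraus hs hT, fun T x y => ?_⟩
  have h1 := hasSum_inner_kraus hs T.1 (elementary _ x) (elementary _ y)
  refine h1.unique ?_
  have h2 := (hasSum_pi_prod (f := fun i k => ⟪x (xEdge i), χ i k⟫_ℂ * ⟪χ i k, y (xEdge i)⟫_ℂ)
    (a := fun i => ⟪x (xEdge i), σ i (y (xEdge i))⟫_ℂ) (fun i => ?_)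
    (fun i => (hσ i).hasSum_inner _ _)).2
  · have h3 := h2.mul_left ⟪HilbSp.tprod fun i => x (sEdge i),
      T.1 (HilbSp.tprod fun i => y (sEdge i))⟫_ℂ
    have h4 : ∀ l, ⟪(V l).adjoint (elementary _ x), T.1 ((V l).adjoint (elementary _ y))⟫_ℂ =
        ⟪HilbSp.tprod fun i => x (sEdge i), T.1 (HilbSp.tprod fun i => y (sEdge i))⟫_ℂ *
          ∏ i, (⟪x (xEdge i), χ i (l i)⟫_ℂ * ⟪χ i (l i), y (xEdge i)⟫_ℂ) := by
      intro l
      rw [hV, hV, map_smul, inner_smul_left, inner_smul_right, map_prod,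
        Finset.prod_mul_distrib]
      simp only [inner_conj_symm]
      ring
    simpa only [h4] using h3
  · refine Summable.of_nonneg_of_le (fun _ => norm_nonneg _) (fun k => ?_)
      ((hσ i).1.mul_left (‖x (xEdge i)‖ * ‖y (xEdge i)‖))
    rw [norm_mul]
    calc _ ≤ (‖x (xEdge i)‖ * ‖χ i k‖) * (‖χ i k‖ * ‖y (xEdge i)‖) := by
          gcongr <;> exact norm_inner_le_norm _ _
      _ = _ := by ring

/-- Tensoring with a state on the edge `xᵢ → aᵢ`. -/
lemma exists_attachState (i : Fin n) {σ : H (xEdge i) →L[ℂ] H (xEdge i)} {χ : ℕ → H (xEdge i)}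
    (hσ : HasRankOneSum σ χ χ) :
    ∃ Φ : TraceClass (H (sEdge i)) →ₗ[ℂ]
        TraceClass (system H ((bellScenario n).incoming (outcome i))),
      (∀ T, T.1.IsPositive → (Φ T).1.IsPositive) ∧
      (∀ T (x y : ∀ e, H e), ⟪elementary _ x, (Φ T).1 (elementary _ y)⟫_ℂ =
        ⟪x (sEdge i), T.1 (y (sEdge i))⟫_ℂ * ⟪x (xEdge i), σ (y (xEdge i))⟫_ℂ) ∧
      ∀ u v, opTrace (Φ (TraceClass.rankOne u v)).1 = opTrace σ * ⟪v, u⟫_ℂ := by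
  choose W hW hWin hWn using fun k => exists_attachSetting H i (χ k)
  have hs : Summable fun k => ‖W k‖ ^ 2 := by
    refine Summable.of_nonneg_of_le (fun _ => by positivity) (fun k => ?_) hσ.1
    rw [pow_two]
    gcongr <;> exact hWn k
  refine ⟨TraceClass.kraus W hs, fun T hT => TraceClass.isPositive_kraus hs hT,
    fun T x y => ?_, fun u v => ?_⟩
  · have h1 := hasSum_inner_kraus hs T.1 (elementary _ x) (elementary _ y)
    refine h1.unique ?_
    have h3 := (hσ.hasSum_inner (x (xEdge i)) (y (xEdge i))).mul_left
      ⟪x (sEdge i), T.1 (y (sEdge i))⟫_ℂ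
    have h4 : ∀ k, ⟪(W k).adjoint (elementary _ x), T.1 ((W k).adjoint (elementary _ y))⟫_ℂ =
        ⟪x (sEdge i), T.1 (y (sEdge i))⟫_ℂ *
          (⟪x (xEdge i), χ k⟫_ℂ * ⟪χ k, y (xEdge i)⟫_ℂ) := by
      intro k
      rw [hW, hW, map_smul, inner_smul_left, inner_smul_right, inner_conj_symm]
      ring
    simpa only [h4] using h3
  · have h1 := ((hasRankOneSum_rankOne u v).kraus hs).hasSum_opTrace
    have h2 : HasSum (fun k => ⟪W k v, W k u⟫_ℂ) (opTrace σ * ⟪v, u⟫_ℂ) := by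
      simp only [hWin]
      exact hσ.hasSum_opTrace.mul_right _
    refine h1.unique ?_
    exact ((Equiv.prodPUnit ℕ).hasSum_iff (f := fun k => ⟪W k v, W k u⟫_ℂ)).2 h2

end AttachStates

/-- After the second stage the trace does not change any more. -/
lemma opTrace_final_state {H : (bellScenario n).Edge → HilbSp.{u}}
    {g : ∀ v, QuantumOp (system H ((bellScenario n).incoming v))
      (system H ((bellScenario n).outgoing v))}
    {F : ∀ k, QuantumOp (system H ((bellScenario n).cut k)) (system H ((bellScenario n).cut (k + 1)))}
    {ω : ∀ k, TraceClass (system H ((bellScenario n).cut k))} (hF : ∀ k, IsParallel k g (F k))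
    (hω : ∀ k, ω (k + 1) = (F k).toFun (ω k)) :
    opTrace (ω (Fintype.card (BellNode n))).1 = opTrace (ω 2).1 := by
  have h2 : ∀ k, opTrace (ω (k + 2)).1 = opTrace (ω 2).1 := by
    intro k
    induction k with
    | zero => rfl
    | succ k ih =>
      rw [← ih, hω (k + 2)]
      exact (hF (k + 2)).opTrace_eq (by simp) (by simp) (by simp) (by exact cut_add_two (k + 1)) _
  have hpos : 0 < Fintype.card (BellNode n) := Fintype.card_pos_iff.2 ⟨source⟩
  rcases Nat.lt_or_ge 1 (Fintype.card (BellNode n)) with h | h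
  · obtain ⟨k, hk⟩ := Nat.exists_eq_add_of_le' h
    rw [hk]
    exact h2 k
  -- The value is read off after as many stages as there are nodes. For n = 0 that is a single
  -- stage, and the second one, being empty, can be added without changing the trace.
  · have h1 : Fintype.card (BellNode n) = 1 := by omega
    have : n = 0 := by
      by_contra hn
      have i : Fin n := ⟨0, Nat.pos_of_ne_zero hn⟩
      have := Fintype.card_le_one_iff.1 h source (outcome i)
      simp at this
    subst this
    rw [h1, hω 1]
    refine ((hF 1).opTrace_eq (by rw [layer_one]; rfl) (by simp) ?_ (by simp) _).symm
    rw [cut_one]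
    ext e
    rcases edge_cases e with ⟨i, -⟩ | ⟨i, -⟩ <;> exact i.elim0

section Stages

variable {H : (bellScenario n).Edge → HilbSp.{u}}
    {g : ∀ v, QuantumOp (system H ((bellScenario n).incoming v))
      (system H ((bellScenario n).outgoing v))}

/-- On an empty set of edges, this is the identity. -/
def unitOp (H : (bellScenario n).Edge → HilbSp.{u}) (S : Finset (bellScenario n).Edge) :
    TraceClass (system H S) :=
  TraceClass.rankOne (elementary S fun e => (0 : H e)) (elementary S fun e => (0 : H e))

lemma inner_unitOp {S : Finset (bellScenario n).Edge} (hS : S = ∅) (x y : ∀ e, H e) :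
    ⟪elementary S x, (unitOp H S).1 (elementary S y)⟫_ℂ = 1 := by
  rw [unitOp, TraceClass.coe_rankOne, InnerProductSpace.rankOne_apply, inner_smul_right,
    inner_elementary, inner_elementary, hS]
  simp

lemma unitOp_isPositive (S : Finset (bellScenario n).Edge) : (unitOp H S).1.IsPositive :=
  InnerProductSpace.isPositive_rankOne_self _

lemma opTrace_unitOp {S : Finset (bellScenario n).Edge} (hS : S = ∅) :
    opTrace (unitOp H S).1 = 1 := by
  rw [opTrace_of_eq_empty hS _ (fun _ => 0) (fun _ => 0), inner_unitOp hS]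

/-- The state after the first stage. -/
lemma inner_first_stage
    {F : QuantumOp (system H ((bellScenario n).cut 0)) (system H ((bellScenario n).cut 1))}
    (hF : IsParallel 0 g F) {T : TraceClass (system H ((bellScenario n).cut 0))}
    (hT : T.1 = ContinuousLinearMap.id ℂ _) (y z : ∀ e, H e) :
    ⟪elementary _ y, (F.toFun T).1 (elementary _ z)⟫_ℂ =
      ⟪elementary _ y, ((g source).toFun (unitOp H _)).1 (elementary _ z)⟫_ℂ *
        ∏ i, ⟪elementary _ y, ((g (setting i)).toFun (unitOp H _)).1 (elementary _ z)⟫_ℂ := by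
  have h1 := hF (fun v => unitOp H _) (unitOp H _) T (fun y z => by
    rw [inner_unitOp (passing_eq_empty 0), mul_one, prod_layer_zero, hT,
      inner_unitOp incoming_source]
    simp only [inner_unitOp (incoming_setting _)]
    rw [ContinuousLinearMap.id_apply, inner_elementary]
    simp)
  have h2 := h1 y z
  rw [inner_unitOp (passing_eq_empty 0), mul_one, prod_layer_zero] at h2
  exact h2

/-- The effect of the second stage on product operators. -/
lemma opTrace_second_stage
    {F : QuantumOp (system H ((bellScenario n).cut 1)) (system H ((bellScenario n).cut 2))}
    (hF : IsParallel 1 g F) (A : ∀ i, TraceClass (system H ((bellScenario n).incoming (outcome i))))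
    {T : TraceClass (system H ((bellScenario n).cut 1))}
    (hT : ∀ y z : ∀ e, H e, ⟪elementary _ y, T.1 (elementary _ z)⟫_ℂ =
      ∏ i, ⟪elementary _ y, (A i).1 (elementary _ z)⟫_ℂ) :
    opTrace (F.toFun T).1 = ∏ i, opTrace ((g (outcome i)).toFun (A i)).1 := by
  -- Parallelism quantifies over operators at all nodes, but only those in the layer matter; the
  -- other values are dummies.
  let A' : ∀ v, TraceClass (system H ((bellScenario n).incoming v))
    | source => 0
    | setting _ => 0
    | outcome i => A i
  have h1 := hF A' (unitOp H _) T (fun y z => by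
    rw [inner_unitOp (passing_eq_empty 1), mul_one, prod_layer_one, hT])
  have h2 := h1 (fun _ => 0) (fun _ => 0)
  rw [inner_unitOp (passing_eq_empty 1), mul_one, prod_layer_one] at h2
  rw [opTrace_of_eq_empty (cut_add_two 0) _ (fun _ => 0) (fun _ => 0)]
  refine h2.trans (Finset.prod_congr rfl fun i _ => ?_)
  exact (opTrace_of_eq_empty (outgoing_outcome i) _ _ _).symm

end Stages

/-- A quantum correlation comes from mixtures `∑ₖ |φₖ⟩⟨φₖ|` distributed by the source and effects at
the parties, in which the settings occur with probabilities `q`. -/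
lemma exists_mixture_of_isQuantumCorrelation {O : BellNode n → Type v} [∀ v, Fintype (O v)]
    {P : (∀ v, O v) → ℝ} (hP : (bellScenario n).IsQuantumCorrelation.{u, v} P) :
    ∃ (K : Fin n → HilbSp.{u}) (φ : O source → ℕ → HilbSp.tensor K)
      (E : ∀ i, O (setting i) → O (outcome i) → (K i →L[ℂ] K i))
      (p : O source → ℝ) (q : ∀ i, O (setting i) → ℝ),
      (∀ s, HasSum (fun k => ‖φ s k‖ ^ 2) (p s)) ∧ ∑ s, p s = 1 ∧
      (∀ i, ∑ x, q i x = 1) ∧ (∀ i x a, (E i x a).IsPositive) ∧ (∀ i x, 0 ≤ q i x) ∧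
      (∀ i x, ∑ a, E i x a = (q i x : ℂ) • ContinuousLinearMap.id ℂ (K i)) ∧
      ∀ s x a, HasSum (fun k => ⟪φ s k, HilbSp.tensorMap (fun i => E i (x i) (a i)) (φ s k)⟫_ℂ)
        (P (assemble s x a) : ℂ) := by
  obtain ⟨H, f, hf, hval⟩ := hP
  let I := fun v => unitOp H ((bellScenario n).incoming v)
  have hIpos : ∀ v, (I v).1.IsPositive := fun v => unitOp_isPositive _
  -- At a node without incoming edges an instrument applied to the unit yields the probability
  -- weights of its outcomes.
  have htr1 : ∀ v, (bellScenario n).incoming v = ∅ →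
      ∑ a, (opTrace ((f v a).toFun (I v)).1).re = 1 := by
    intro v hv
    have h1 := hf v (I v)
    rw [TraceClass.opTrace_sum, opTrace_unitOp hv] at h1
    rw [← Complex.re_sum, h1, Complex.one_re]
  obtain ⟨U, hU, hU', hUU, -⟩ := exists_readSource H
  choose R hR hR' hRR _ using exists_readSetting H
  let ρ := fun s => TraceClass.conj U U.adjoint ((f source s).toFun (I source))
  let σ := fun i x => TraceClass.conj (R i) (R i).adjoint ((f (setting i) x).toFun (I (setting i)))
  have hρ : ∀ s, (ρ s).1.IsPositive := fun s =>
    TraceClass.isPositive_conj U ((f source s).isPositive (hIpos _))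
  have hσ : ∀ i x, (σ i x).1.IsPositive := fun i x =>
    TraceClass.isPositive_conj (R i) ((f (setting i) x).isPositive (hIpos _))
  choose φ hφ using fun s => (ρ s).2.exists_hasRankOneSum_self (hρ s)
  choose χ hχ using fun i x => (σ i x).2.exists_hasRankOneSum_self (hσ i x)
  have hσre : ∀ i x, opTrace (σ i x).1 = ((opTrace (σ i x).1).re : ℂ) := by
    intro i x
    have := (hχ i x).opTrace_eq
    rw [this, Complex.ofReal_re]
  choose Φ hΦpos hΦ hΦtr using fun i x => exists_attachState i (hχ i x)
  -- The effect of party i absorbs the state sent by its setting: E represents T ↦ tr f_a(T ⊗ σ).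
  choose E hE hEin _ using fun i x a => TraceClass.exists_density_of_positive
    ((f (outcome i) a).traceFunctional ∘ₗ Φ i x)
    (fun T hT => (f (outcome i) a).traceFunctional_nonneg (hΦpos i x T hT))
  refine ⟨fun i => H (sEdge i), φ, E, fun s => (opTrace (ρ s).1).re,
    fun i x => (opTrace (σ i x).1).re, fun s => (hφ s).hasSum_norm_sq, ?_, fun i => ?_, hE,
    fun i x => ?_, fun i x => ?_, fun s x a => ?_⟩
  · simp only [ρ, TraceClass.trace_conj_isometry hUU]
    exact htr1 source (by simp)
  · simp only [σ, TraceClass.trace_conj_isometry (hRR i)]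
    exact htr1 (setting i) (by simp)
  · exact (Complex.le_def.1 (opTrace_nonneg (σ i x).2 (hσ i x))).1
  -- Matrix elements are values on rank one operators, and there trace preservation gives tr(|v⟩⟨u|
  -- ⊗ σ) = tr(σ) ⟪u, v⟫.
  · refine ContinuousLinearMap.ext fun v => ext_inner_left ℂ fun u => ?_
    rw [sum_apply, inner_sum]
    simp only [← hEin, LinearMap.comp_apply, QuantumOp.traceFunctional_apply]
    rw [← TraceClass.opTrace_sum, hf (outcome i), hΦtr, hσre, smul_apply, inner_smul_right]
    rfl
  · obtain ⟨F, ω, hF, hω0, hω, hp⟩ := hval (assemble s x a)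
    rw [opTrace_final_state hF hω] at hp
    obtain ⟨Ψ, hΨpos, hΨ⟩ := exists_attachStates fun i => hχ i (x i)
    -- The stage `F 1` is prescribed on product operators only, and ρ s need not be one. Its trace
    -- functional nevertheless has a density M, which is fixed by its matrix elements on elementary
    -- tensors; these come from product operators.
    obtain ⟨M, -, hMin, hM⟩ := TraceClass.exists_density_of_positive
      ((F 1).traceFunctional ∘ₗ Ψ)
      (fun T hT => (F 1).traceFunctional_nonneg (hΨpos T hT))
    have hME : M = HilbSp.tensorMap (fun i => E i (x i) (a i)) := by
      refine HilbSp.tensor_ext fun u v => ?_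
      rw [← hMin, HilbSp.inner_tensorMap]
      simp only [← hEin, LinearMap.comp_apply, QuantumOp.traceFunctional_apply]
      refine opTrace_second_stage (hF 1) (fun i => Φ i (x i) (TraceClass.rankOne (v i) (u i)))
        fun y z => ?_
      rw [hΨ, TraceClass.coe_rankOne, InnerProductSpace.rankOne_apply, inner_smul_right,
        HilbSp.inner_tprod, HilbSp.inner_tprod, ← Finset.prod_mul_distrib,
        ← Finset.prod_mul_distrib]
      refine Finset.prod_congr rfl fun i _ => ?_
      rw [hΦ, TraceClass.coe_rankOne, InnerProductSpace.rankOne_apply, inner_smul_right]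
    have hω1 : ω 1 = Ψ (ρ s) := by
      apply Subtype.ext
      refine system_ext fun y z => ?_
      rw [hΨ, hω 0, inner_first_stage (hF 0) hω0]
      congr 1
      · rw [TraceClass.inner_conj, hU', hU']; rfl
      · refine Finset.prod_congr rfl fun i _ => ?_
        rw [TraceClass.inner_conj, hR', hR']; rfl
    have h1 := hM (ρ s) (φ s) (hφ s)
    rw [LinearMap.comp_apply, ← hω1, QuantumOp.traceFunctional_apply, ← hω 1, hp, hME] at h1
    exact h1

end BellNode

/-! ### From a mixture to free will and a pure state model -/

namespace BellNode

open CausalGraph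

variable {n : ℕ} {O : BellNode n → Type v} [∀ v, Fintype (O v)] {P : (∀ v, O v) → ℝ}

section Mixture

variable {K : Fin n → HilbSp.{u}} {φ : O source → ℕ → HilbSp.tensor K}
  {E : ∀ i, O (setting i) → O (outcome i) → (K i →L[ℂ] K i)}
  {p : O source → ℝ} {q : ∀ i, O (setting i) → ℝ}

/-- Summed over all outcomes of the parties, the tensor products of effects give ⨂ᵢ (q i (x i) • 1),
a multiple of the identity, and ∑ₖ ‖φ s k‖² = p s remains. -/
lemma sum_outcomes_of_mixture
    (hφ : ∀ s, HasSum (fun k => ‖φ s k‖ ^ 2) (p s))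
    (hE : ∀ i x, ∑ a, E i x a = (q i x : ℂ) • ContinuousLinearMap.id ℂ (K i))
    (hP : ∀ s x a, HasSum (fun k => ⟪φ s k, HilbSp.tensorMap (fun i => E i (x i) (a i)) (φ s k)⟫_ℂ)
        (P (assemble s x a) : ℂ)) (s : O source) (x : ∀ i, O (setting i)) :
    ∑ a : ∀ i, O (outcome i), P (assemble s x a) = p s * ∏ i, q i (x i) := by
  have h1 := hasSum_sum (s := Finset.univ) fun a _ => hP s x a
  have h2 : ∀ k, ∑ a : ∀ i, O (outcome i),
      ⟪φ s k, HilbSp.tensorMap (fun i => E i (x i) (a i)) (φ s k)⟫_ℂ =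
      ((‖φ s k‖ ^ 2 * ∏ i, q i (x i) : ℝ) : ℂ) := by
    intro k
    rw [← inner_sum, ← sum_apply, HilbSp.sum_tensorMap (fun i a => E i (x i) a)]
    simp only [hE]
    rw [HilbSp.tensorMap_smul, HilbSp.tensorMap_id, smul_apply, inner_smul_right,
      ContinuousLinearMap.id_apply, inner_self_eq_norm_sq_to_K]
    push_cast
    exact mul_comm _ _
  simp only [h2] at h1
  have h3 := h1.unique (Complex.hasSum_ofReal.2 ((hφ s).mul_right (∏ i, q i (x i))))
  exact_mod_cast h3

lemma hasQuantumModel_of_mixture (hsim : P ∈ stdSimplex ℝ (∀ v, O v))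
    (hφ : ∀ s, HasSum (fun k => ‖φ s k‖ ^ 2) (p s)) (hp : ∑ s, p s = 1)
    (hq : ∀ i, ∑ x, q i x = 1) (hEpos : ∀ i x a, (E i x a).IsPositive) (hq0 : ∀ i x, 0 ≤ q i x)
    (hE : ∀ i x, ∑ a, E i x a = (q i x : ℂ) • ContinuousLinearMap.id ℂ (K i))
    (hP : ∀ s x a, HasSum (fun k => ⟪φ s k, HilbSp.tensorMap (fun i => E i (x i) (a i)) (φ s k)⟫_ℂ)
        (P (assemble s x a) : ℂ)) : HasQuantumModel.{u, v} P := by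
  classical
  have hsum := sum_outcomes_of_mixture hφ hE hP
  have hm1 := marginal_source_of_product hsum hq
  have hm2 := marginal_setting_of_product hsum hp hq
  have hp0 : ∀ s, 0 ≤ p s := fun s => (hφ s).nonneg fun k => by positivity
  obtain ⟨o₀⟩ : Nonempty (∀ v, O v) := by
    by_contra h
    rw [not_nonempty_iff] at h
    have := hsim.2
    simp at this
  -- Without parties no ancilla can be attached, but then the empty elementary tensor is a model:
  -- the only conditional probability is P o / P o = 1.
  rcases Nat.eq_zero_or_pos n with rfl | hn
  · refine ⟨fun i => i.elim0, fun _ => HilbSp.tprod fun i => i.elim0, fun i => i.elim0,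
      fun s => ?_, fun i => i.elim0, fun i => i.elim0, fun o _ ho => ?_⟩
    · rw [HilbSp.norm_tprod]; simp
    · rw [condProb_eq, HilbSp.inner_tensorMap, Finset.univ_eq_empty, Finset.prod_empty]
      have h1 : marginal P (Set.range setting ∪ {source}) o = P o := by
        rw [marginal_source_setting, Fintype.sum_unique]
        congr 1
        conv_rhs => rw [← assemble_eta o]
        congr 1
        exact Subsingleton.elim _ _
      have h2 : marginal P (Set.range setting ∪ {source}) o = p (o source) := by
        rw [marginal_source_setting, hsum]; simp
      rw [hm1] at ho
      rw [h1, div_self]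
      · simp
      · rw [← h1, h2]; exact ho.ne'
  · obtain ⟨s₀, hs₀⟩ : ∃ s, p s ≠ 0 := by
      by_contra! h
      simp [h] at hp
    choose ψ hψ using fun s => HilbSp.exists_purification hn (hφ s).summable
    have hψn : ∀ s, ‖ψ s‖ ^ 2 = p s := by
      intro s
      have h1 := hψ s (fun i => ContinuousLinearMap.id ℂ _)
      simp only [HilbSp.ampliate_id, HilbSp.tensorMap_id, ContinuousLinearMap.id_apply,
        inner_self_eq_norm_sq_to_K] at h1
      have h2 := Complex.hasSum_ofReal.2 (hφ s)
      push_cast at h2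
      have h3 := h1.unique h2
      apply Complex.ofReal_injective
      rw [← h3]
      push_cast
      rfl
    -- A source value of probability zero has no vector to normalise; it borrows the one of s₀, as
    -- the model is not tested there.
    let r : O source → O source := fun s => if p s = 0 then s₀ else s
    have hr : ∀ s, p (r s) ≠ 0 := by
      intro s
      by_cases h : p s = 0 <;> simp [r, h, hs₀]
    -- Effects are divided by the weight of the setting. For a setting of weight zero, the POVM that
    -- always answers with the value in o₀ is substituted.
    let E' : ∀ i, O (setting i) → O (outcome i) → (K i →L[ℂ] K i) := fun i x a =>
      if q i x = 0 then (if a = o₀ (outcome i) then ContinuousLinearMap.id ℂ _ else 0)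
      else ((q i x : ℂ)⁻¹) • E i x a
    refine ⟨_, fun s => (((√(p (r s)))⁻¹ : ℝ) : ℂ) • ψ (r s), fun i x a => HilbSp.ampliate (E' i x a),
      fun s => ?_, fun i x a => HilbSp.ampliate_isPositive ?_, fun i x => ?_, fun o ho hs => ?_⟩
    · have h1 : ‖ψ (r s)‖ = √(p (r s)) := by
        rw [← hψn, Real.sqrt_sq (norm_nonneg _)]
      rw [norm_smul, h1, Complex.norm_real, Real.norm_of_nonneg (by positivity)]
      exact inv_mul_cancel₀ (Real.sqrt_ne_zero'.2 ((hp0 _).lt_of_ne (hr s).symm))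
    · simp only [E']
      split_ifs
      · exact ContinuousLinearMap.isPositive_one
      · exact ContinuousLinearMap.isPositive_zero
      · refine (hEpos i x a).smul_of_nonneg ?_
        rw [← Complex.ofReal_inv]
        exact_mod_cast inv_nonneg.2 (hq0 i x)
    · rw [HilbSp.sum_ampliate, ← HilbSp.ampliate_id]
      congr 1
      by_cases h : q i x = 0
      · simp [E', h]
      · simp only [E', h, if_false]
        rw [← Finset.smul_sum, hE, smul_smul, inv_mul_cancel₀ (by exact_mod_cast h), one_smul]
    · rw [hm1] at hs
      simp only [hm2] at ho
      have hrs : r (o source) = o source := by simp [r, hs.ne']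
      have hE' : ∀ i, E' i (o (setting i)) (o (outcome i)) =
          ((q i (o (setting i)) : ℂ)⁻¹) • E i (o (setting i)) (o (outcome i)) := fun i => by
        simp [E', (ho i).ne']
      have h1 := hψ (o source) (fun i => E' i (o (setting i)) (o (outcome i)))
      simp only [hE', HilbSp.tensorMap_smul, smul_apply, inner_smul_right] at h1
      have h2 := (hP (o source) (fun i => o (setting i)) (fun i => o (outcome i))).mul_left
        (∏ i, ((q i (o (setting i)) : ℂ)⁻¹))
      have h3 := h1.unique h2
      rw [assemble_eta] at h3
      rw [condProb_eq, marginal_source_setting, hsum]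
      beta_reduce
      rw [hrs]
      simp only [hE']
      rw [map_smul, inner_smul_left, inner_smul_right, h3, Complex.conj_ofReal, ← mul_assoc,
        ← Complex.ofReal_mul, ← mul_inv, Real.mul_self_sqrt hs.le, Finset.prod_inv_distrib]
      push_cast
      rw [div_eq_mul_inv, mul_inv]
      ring

end Mixture

theorem freeWill_and_hasQuantumModel_of_isQuantumCorrelation (hsim : P ∈ stdSimplex ℝ (∀ v, O v))
    (hP : (bellScenario n).IsQuantumCorrelation.{u, v} P) :
    FreeWill P ∧ HasQuantumModel.{u, v} P := by
  obtain ⟨K, φ, E, p, q, hφ, hp, hq, hEpos, hq0, hE, hP⟩ :=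
    exists_mixture_of_isQuantumCorrelation hP
  exact ⟨freeWill_of_product (sum_outcomes_of_mixture hφ hE hP) hp hq,
    hasQuantumModel_of_mixture hsim hφ hp hq hEpos hq0 hE hP⟩

end BellNode

/-! ### From a quantum model to a diagram with classical registers -/

lemma opTrace_smul {H : HilbSp.{u}} {T : H →L[ℂ] H} (hT : IsTraceClass H T) (c : ℂ) :
    opTrace (c • T) = c * opTrace T :=
  map_smul (TraceClass.trace H) c ⟨T, hT⟩

namespace BellNode

open CausalGraph

variable {n : ℕ} {H : (bellScenario n).Edge → HilbSp.{u}}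

section Parallel

variable {g : ∀ v, QuantumOp (system H ((bellScenario n).incoming v))
      (system H ((bellScenario n).outgoing v))}

lemma inner_of_eq_empty {S : Finset (bellScenario n).Edge} (hS : S = ∅)
    (B : system H S →L[ℂ] system H S) (x y : ∀ e, H e) :
    ⟪elementary S x, B (elementary S y)⟫_ℂ = opTrace B :=
  (opTrace_of_eq_empty hS _ x y).symm

/-- All inputs are trivial, so each operation multiplies a scalar with the projector-like operator
|Ψ⟩⟨Ψ|; the claim reduces to the product form of Ψ on elementary vectors. -/
lemma isParallel_zero {Ψs : system H ((bellScenario n).outgoing source)}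
    {Ψx : ∀ i, system H ((bellScenario n).outgoing (setting i))}
    {Ψ : system H ((bellScenario n).cut 1)}
    (hΨ : ∀ x : ∀ e, H e, ⟪elementary _ x, Ψ⟫_ℂ =
      ⟪elementary _ x, Ψs⟫_ℂ * ∏ i, ⟪elementary _ x, Ψx i⟫_ℂ)
    (hs : g source = QuantumOp.measurePrepare _ ContinuousLinearMap.isPositive_id Ψs)
    (hx : ∀ i, g (setting i) =
      QuantumOp.measurePrepare _ ContinuousLinearMap.isPositive_id (Ψx i)) :
    IsParallel 0 g (QuantumOp.measurePrepare _ ContinuousLinearMap.isPositive_id Ψ) := by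
  intro A B T hT x y
  have h0 := hT x y
  rw [inner_of_eq_empty cut_zero, inner_of_eq_empty (passing_eq_empty 0), prod_layer_zero,
    inner_of_eq_empty incoming_source] at h0
  simp only [inner_of_eq_empty (incoming_setting _)] at h0
  have hΨ' : ∀ x : ∀ e, H e, ⟪Ψ, elementary _ x⟫_ℂ =
      ⟪Ψs, elementary _ x⟫_ℂ * ∏ i, ⟪Ψx i, elementary _ x⟫_ℂ := by
    intro x
    rw [← inner_conj_symm, hΨ, map_mul, map_prod, inner_conj_symm]
    simp only [inner_conj_symm]
  rw [QuantumOp.inner_measurePrepare, inner_of_eq_empty (passing_eq_empty 0), prod_layer_zero]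
  beta_reduce
  rw [hs, QuantumOp.inner_measurePrepare, hΨ, hΨ']
  simp only [hx, QuantumOp.inner_measurePrepare, ContinuousLinearMap.id_comp,
    Finset.prod_mul_distrib]
  rw [h0]
  ring

/-- All outputs are trivial, so the claim is that the trace against N factorizes on product
operators. The scalar c accounts for the factor from the empty passing system. -/
lemma isParallel_one {M : ∀ i, system H ((bellScenario n).incoming (outcome i)) →L[ℂ]
      system H ((bellScenario n).incoming (outcome i))} (hM : ∀ i, (M i).IsPositive)
    {N : system H ((bellScenario n).cut 1) →L[ℂ] system H ((bellScenario n).cut 1)}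
    (hN : N.IsPositive)
    (h : ∀ (A : ∀ i, TraceClass (system H ((bellScenario n).incoming (outcome i))))
      (T : TraceClass (system H ((bellScenario n).cut 1))) (c : ℂ),
      (∀ x y : ∀ e, H e, ⟪elementary _ x, T.1 (elementary _ y)⟫_ℂ =
        (∏ i, ⟪elementary _ x, (A i).1 (elementary _ y)⟫_ℂ) * c) →
      opTrace (N ∘L T.1) = (∏ i, opTrace (M i ∘L (A i).1)) * c)
    (hg : ∀ i, g (outcome i) =
      QuantumOp.measurePrepare (M i) (hM i) (elementary _ fun e => (0 : H e))) :
    IsParallel 1 g (QuantumOp.measurePrepare N hN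
      (elementary ((bellScenario n).cut 2) fun e => (0 : H e))) := by
  intro A B T hT x y
  have h0 := h (fun i => A (outcome i)) T (opTrace B.1) (fun x y => by
    have := hT x y
    rwa [inner_of_eq_empty (passing_eq_empty 1), prod_layer_one] at this)
  rw [QuantumOp.inner_measurePrepare, inner_of_eq_empty (passing_eq_empty 1), prod_layer_one, h0]
  simp only [hg, QuantumOp.inner_measurePrepare, inner_elementary, outgoing_outcome,
    cut_add_two 0, Finset.prod_empty, mul_one]

/-- `HasValue` asks for an operation at every stage, so the empty stages must be supplied too; they
transport a scalar. -/
lemma isParallel_add_two (k : ℕ) : IsParallel (k + 2) g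
    (QuantumOp.measurePrepare _ ContinuousLinearMap.isPositive_id
      (elementary ((bellScenario n).cut (k + 3)) fun e => (0 : H e))) := by
  intro A B T hT x y
  have h0 := hT x y
  rw [inner_of_eq_empty (cut_add_two k), inner_of_eq_empty (passing_eq_empty _),
    layer_add_two, Finset.prod_empty, one_mul] at h0
  rw [QuantumOp.inner_measurePrepare, inner_of_eq_empty (passing_eq_empty _), layer_add_two,
    Finset.prod_empty, one_mul, ContinuousLinearMap.id_comp, h0, inner_elementary,
    inner_elementary, cut_add_two (k + 1)]
  simp

end Parallel

section ProductEffect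

variable {X : Fin n → Type v} [∀ i, Fintype (X i)]
  {e : ∀ i, X i → H (xEdge i)}
  {W : ∀ i, X i → H (sEdge i) →L[ℂ] system H ((bellScenario n).incoming (outcome i))}
  {V : (∀ i, X i) → HilbSp.tensor (fun i => H (sEdge i)) →L[ℂ] system H ((bellScenario n).cut 1)}

/-- The trace against a product effect factorizes on product operators. -/
lemma opTrace_productEffect
    (hW : ∀ i x (y : ∀ e, H e),
      (W i x).adjoint (elementary _ y) = ⟪e i x, y (xEdge i)⟫_ℂ • y (sEdge i))
    (hV : ∀ x u, V x (HilbSp.tprod u) = elementary _ (glue u fun i => e i (x i)))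
    (E : ∀ i, X i → H (sEdge i) →L[ℂ] H (sEdge i))
    (A : ∀ i, TraceClass (system H ((bellScenario n).incoming (outcome i))))
    (T : TraceClass (system H ((bellScenario n).cut 1))) (c : ℂ)
    (hT : ∀ x y : ∀ e, H e, ⟪elementary _ x, T.1 (elementary _ y)⟫_ℂ =
        (∏ i, ⟪elementary _ x, (A i).1 (elementary _ y)⟫_ℂ) * c) :
    opTrace ((∑ x : ∀ i, X i, V x ∘L HilbSp.tensorMap (fun i => E i (x i)) ∘L (V x).adjoint) ∘L
      T.1) = (∏ i, opTrace ((∑ x, W i x ∘L E i x ∘L (W i x).adjoint) ∘L (A i).1)) * c := by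
  -- The hypothesis gives W only through its adjoint; this recovers its values, so that they can be
  -- compared with those of V.
  have hWu : ∀ i (x : ∀ i, X i) u, W i (x i) (u i) =
      elementary ((bellScenario n).incoming (outcome i)) (glue u fun i => e i (x i)) := by
    intro i x u
    refine eq_of_inner_dense_family (dense_span_elementary H _) fun y => ?_
    rw [← ContinuousLinearMap.adjoint_inner_left, hW, inner_smul_left, inner_conj_symm,
      inner_elementary, prod_incoming_outcome]
    exact mul_comm _ _
  -- Fixing the register vectors compresses a product operator to the tensor product of the local
  -- compressions, up to the scalar c.
  have hVT : ∀ x : ∀ i, X i, (V x).adjoint ∘L T.1 ∘L V x =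
      c • HilbSp.tensorMap (fun i => (W i (x i)).adjoint ∘L (A i).1 ∘L W i (x i)) := by
    intro x
    refine HilbSp.tensor_ext fun u v => ?_
    rw [ContinuousLinearMap.comp_apply, ContinuousLinearMap.adjoint_inner_right,
      ContinuousLinearMap.comp_apply, hV, hV, hT, smul_apply, inner_smul_right,
      HilbSp.inner_tensorMap, mul_comm]
    congr 1
    refine Finset.prod_congr rfl fun i _ => ?_
    rw [ContinuousLinearMap.comp_apply, ContinuousLinearMap.adjoint_inner_right,
      ContinuousLinearMap.comp_apply, hWu, hWu]
  have hWA : ∀ i x, IsTraceClass (H (sEdge i)) ((W i x).adjoint ∘L (A i).1 ∘L W i x) :=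
    fun i x => (A i).2.conj _ _
  have hterm : ∀ x : ∀ i, X i,
      TraceClass.expect (V x ∘L HilbSp.tensorMap (fun i => E i (x i)) ∘L (V x).adjoint) T =
      c * ∏ i, TraceClass.expect (W i (x i) ∘L E i (x i) ∘L (W i (x i)).adjoint) (A i) := by
    intro x
    have h1 := opTrace_comp_comm T.2
      (HilbSp.tensorMap (fun i => E i (x i)) ∘L (V x).adjoint) (V x)
    have h2 := fun i => opTrace_comp_comm (A i).2
      (E i (x i) ∘L (W i (x i)).adjoint) (W i (x i))
    have h3 := HilbSp.opTrace_tensorMap fun i => (hWA i (x i)).comp_left (E i (x i))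
    have h5 : (HilbSp.tensorMap (fun i => E i (x i)) ∘L (V x).adjoint) ∘L T.1 ∘L V x =
        c • HilbSp.tensorMap (fun i => E i (x i) ∘L (W i (x i)).adjoint ∘L (A i).1 ∘L W i (x i)) := by
      rw [ContinuousLinearMap.comp_assoc, hVT, ContinuousLinearMap.comp_smul,
        HilbSp.tensorMap_comp]
    calc _ = opTrace ((HilbSp.tensorMap (fun i => E i (x i)) ∘L (V x).adjoint) ∘L T.1 ∘L V x) :=
          h1.symm
      _ = c * ∏ i, opTrace (E i (x i) ∘L (W i (x i)).adjoint ∘L (A i).1 ∘L W i (x i)) := by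
          rw [h5, opTrace_smul h3.1, h3.2]
      _ = _ := by
          congr 1
          exact Finset.prod_congr rfl fun i _ => h2 i
  rw [← TraceClass.expect_apply, TraceClass.expect_sum]
  simp only [hterm, ← TraceClass.expect_apply, TraceClass.expect_sum]
  rw [← Finset.mul_sum, Finset.prod_univ_sum, Fintype.piFinset_univ, mul_comm]

end ProductEffect

/-- A finite-dimensional Hilbert space with an orthonormal basis indexed by a given finite type. -/
lemma exists_register (X : Type v) [Fintype X] [DecidableEq X] :
    ∃ (K : HilbSp.{u}) (e : X → K), (∀ x y, ⟪e x, e y⟫_ℂ = if x = y then 1 else 0) ∧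
      ∀ a b : K, ∑ x, ⟪a, e x⟫_ℂ * ⟪e x, b⟫_ℂ = ⟪a, b⟫_ℂ := by
  -- The index type is lifted so that the space lies in universe `u`, independently of the universe
  -- of X.
  let b := (EuclideanSpace.basisFun (ULift.{u} (Fin (Fintype.card X))) ℂ).reindex
    (Equiv.ulift.trans (Fintype.equivFin X).symm)
  refine ⟨⟨EuclideanSpace ℂ (ULift.{u} (Fin (Fintype.card X)))⟩, b, fun x y => ?_, fun x y => ?_⟩
  · exact orthonormal_iff_ite.1 b.orthonormal x y
  · exact b.sum_inner_mul_inner x y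

/-- The Hilbert spaces at the edges, for given spaces at the edges `s → aᵢ` and `xᵢ → aᵢ`. -/
def edgeSpaces (K L : Fin n → HilbSp.{u}) : (bellScenario n).Edge → HilbSp.{u}
  | ⟨(source, outcome i), _⟩ => K i
  | ⟨(setting i, _), _⟩ => L i
  -- No edge falls under this case; the space is arbitrary.
  | _ => HilbSp.ell2

section Construction

variable {O : BellNode n → Type v} [∀ v, Fintype (O v)] {P : (∀ v, O v) → ℝ}
  {ψ : O source → HilbSp.tensor (fun i => H (sEdge i))}
  {E : ∀ i, O (setting i) → O (outcome i) → (H (sEdge i) →L[ℂ] H (sEdge i))}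
  {e : ∀ i, O (setting i) → H (xEdge i)} {p : O source → ℝ} {q : ∀ i, O (setting i) → ℝ}

/-- The vectors e i x are the classical messages from setting to party. Since they are orthonormal,
a party can read the setting without error, and since they are complete, its conditional
measurements add up to the identity on the full incoming system. -/
lemma isQuantumCorrelation_of_registers [∀ i, DecidableEq (O (setting i))]
    (he : ∀ i x y, ⟪e i x, e i y⟫_ℂ = if x = y then 1 else 0)
    (hec : ∀ i (a b : H (xEdge i)), ∑ x, ⟪a, e i x⟫_ℂ * ⟪e i x, b⟫_ℂ = ⟪a, b⟫_ℂ)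
    (hψ : ∀ s, ‖ψ s‖ = 1) (hEpos : ∀ i x a, (E i x a).IsPositive)
    (hE : ∀ i x, ∑ a, E i x a = ContinuousLinearMap.id ℂ (H (sEdge i)))
    (hp0 : ∀ s, 0 ≤ p s) (hp : ∑ s, p s = 1) (hq0 : ∀ i x, 0 ≤ q i x)
    (hq : ∀ i, ∑ x, q i x = 1)
    (hP : ∀ s x a, (P (assemble s x a) : ℂ) = p s * (∏ i, (q i (x i) : ℂ)) *
      ⟪ψ s, HilbSp.tensorMap (fun i => E i (x i) (a i)) (ψ s)⟫_ℂ) :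
    (bellScenario n).IsQuantumCorrelation.{u, v} P := by
  obtain ⟨U, hU, hU', -, hUU⟩ := exists_readSource H
  choose R hR hR' _ hRR using exists_readSetting H
  choose W hW _ _ using fun i (x : O (setting i)) => exists_attachSetting H i (e i x)
  choose V hV hV' _ using fun x : ∀ i, O (setting i) => exists_attachSettings H fun i => e i (x i)
  -- M is the local effect "read the register, then apply the POVM of the value found". N is the
  -- joint version on the whole cut, needed because a stage is one operation on all systems.
  let M := fun i a => ∑ x, W i x ∘L E i x a ∘L (W i x).adjoint
  let N := fun a : ∀ i, O (outcome i) => ∑ x : ∀ i, O (setting i),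
    V x ∘L HilbSp.tensorMap (fun i => E i (x i) (a i)) ∘L (V x).adjoint
  have hM : ∀ i a, (M i a).IsPositive := fun i a =>
    ContinuousLinearMap.isPositive_sum _ fun x _ => (hEpos i x a).conj_adjoint _
  have hN : ∀ a, (N a).IsPositive := fun a =>
    ContinuousLinearMap.isPositive_sum _ fun x _ =>
      (HilbSp.tensorMap_isPositive fun i => hEpos i _ _).conj_adjoint _
  -- The square roots give the prepared rank one operators the traces p s and q i x.
  let Ψs := fun s => ((√(p s) : ℝ) : ℂ) • U.adjoint (ψ s)
  let Ψx := fun i x => ((√(q i x) : ℝ) : ℂ) • (R i).adjoint (e i x)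
  let Ψ := fun s (x : ∀ i, O (setting i)) =>
    (((√(p s) : ℝ) : ℂ) * ∏ i, ((√(q i (x i)) : ℝ) : ℂ)) • V x (ψ s)
  let f : ∀ v, O v → QuantumOp (system H ((bellScenario n).incoming v))
      (system H ((bellScenario n).outgoing v))
    | source => fun s => QuantumOp.measurePrepare _ ContinuousLinearMap.isPositive_id (Ψs s)
    | setting i => fun x => QuantumOp.measurePrepare _ ContinuousLinearMap.isPositive_id (Ψx i x)
    | outcome i => fun a => QuantumOp.measurePrepare (M i a) (hM i a)
        (elementary _ fun e => (0 : H e))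
  have hΨsn : ∀ s, ⟪Ψs s, Ψs s⟫_ℂ = p s := by
    intro s
    simp only [Ψs]
    rw [inner_smul_left, inner_smul_right, Complex.conj_ofReal,
      ContinuousLinearMap.adjoint_inner_left, ← ContinuousLinearMap.comp_apply, hUU,
      ContinuousLinearMap.id_apply, inner_self_eq_norm_sq_to_K, hψ, ← mul_assoc,
      ← Complex.ofReal_mul, Real.mul_self_sqrt (hp0 s)]
    simp
  have hΨxn : ∀ i x, ⟪Ψx i x, Ψx i x⟫_ℂ = q i x := by
    intro i x
    simp only [Ψx]
    rw [inner_smul_left, inner_smul_right, Complex.conj_ofReal,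
      ContinuousLinearMap.adjoint_inner_left, ← ContinuousLinearMap.comp_apply, hRR,
      ContinuousLinearMap.id_apply, he, ← mul_assoc,
      ← Complex.ofReal_mul, Real.mul_self_sqrt (hq0 i x)]
    simp
  -- Summing over a first removes the POVM, and completeness of the register basis removes the sum
  -- over x.
  have hMsum : ∀ i, ∑ a, M i a = ContinuousLinearMap.id ℂ _ := by
    intro i
    refine system_ext fun y z => ?_
    have h1 : ∀ x a, ⟪elementary _ y, (W i x ∘L E i x a ∘L (W i x).adjoint) (elementary _ z)⟫_ℂ =
        ⟪y (xEdge i), e i x⟫_ℂ * ⟪e i x, z (xEdge i)⟫_ℂ *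
          ⟪y (sEdge i), E i x a (z (sEdge i))⟫_ℂ := by
      intro x a
      rw [ContinuousLinearMap.comp_apply, ← ContinuousLinearMap.adjoint_inner_left,
        ContinuousLinearMap.comp_apply, hW, hW, map_smul, inner_smul_left, inner_smul_right,
        inner_conj_symm, mul_assoc]
    simp only [M, sum_apply, inner_sum, h1]
    rw [Finset.sum_comm]
    simp only [← Finset.mul_sum]
    have h2 : ∀ x, ∑ a, ⟪y (sEdge i), E i x a (z (sEdge i))⟫_ℂ = ⟪y (sEdge i), z (sEdge i)⟫_ℂ := by
      intro x
      rw [← inner_sum, ← sum_apply, hE, ContinuousLinearMap.id_apply]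
    simp only [h2]
    rw [← Finset.sum_mul, hec, ContinuousLinearMap.id_apply, inner_elementary,
      prod_incoming_outcome, mul_comm]
  have hΨ : ∀ s x (y : ∀ e, H e), ⟪elementary _ y, Ψ s x⟫_ℂ =
      ⟪elementary _ y, Ψs s⟫_ℂ * ∏ i, ⟪elementary _ y, Ψx i (x i)⟫_ℂ := by
    intro s x y
    have h1 : ∀ i, ⟪elementary _ y, Ψx i (x i)⟫_ℂ =
        ((√(q i (x i)) : ℝ) : ℂ) * ⟪y (xEdge i), e i (x i)⟫_ℂ := by
      intro i
      simp only [Ψx]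
      rw [inner_smul_right, ContinuousLinearMap.adjoint_inner_right, hR]
    simp only [h1, Ψ, Ψs]
    rw [inner_smul_right, inner_smul_right, ContinuousLinearMap.adjoint_inner_right, hU,
      ← ContinuousLinearMap.adjoint_inner_left, hV', inner_smul_left, map_prod,
      Finset.prod_mul_distrib]
    simp only [inner_conj_symm]
    ring
  -- Distinct setting tuples differ at some party, whose register vectors are then orthogonal.
  have hVV : ∀ x x', (V x').adjoint ∘L V x =
      if x' = x then ContinuousLinearMap.id ℂ _ else 0 := by
    intro x x'
    refine HilbSp.tensor_ext_left fun u => ?_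
    rw [ContinuousLinearMap.comp_apply, hV, hV']
    simp only [glue_sEdge, glue_xEdge, he]
    split_ifs with h
    · simp [h]
    · obtain ⟨i, hi⟩ := Function.ne_iff.1 h
      rw [Finset.prod_eq_zero (Finset.mem_univ i) (if_neg hi), zero_smul]
      rfl
  have hNΨ : ∀ s x a, ⟪Ψ s x, N a (Ψ s x)⟫_ℂ = P (assemble s x a) := by
    intro s x a
    have h1 : ∀ φ, N a (V x φ) = V x (HilbSp.tensorMap (fun i => E i (x i) (a i)) φ) := by
      intro φ
      simp only [N, sum_apply, ContinuousLinearMap.comp_apply]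
      have h2 : ∀ x', (V x').adjoint (V x φ) = if x' = x then φ else 0 := by
        intro x'
        rw [← ContinuousLinearMap.comp_apply, hVV]
        split_ifs <;> rfl
      simp only [h2]
      rw [Finset.sum_eq_single x]
      · rw [if_pos rfl]
      · intro x' _ hx'
        rw [if_neg hx', map_zero, map_zero]
      · simp
    simp only [Ψ]
    rw [map_smul, inner_smul_left, inner_smul_right, h1, ← ContinuousLinearMap.adjoint_inner_right,
      ← ContinuousLinearMap.comp_apply, hVV, if_pos rfl, ContinuousLinearMap.id_apply, hP,
      ← mul_assoc]
    congr 1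
    rw [map_mul, map_prod]
    simp only [Complex.conj_ofReal]
    rw [mul_mul_mul_comm, ← Finset.prod_mul_distrib, ← Complex.ofReal_mul,
      Real.mul_self_sqrt (hp0 s)]
    congr 1
    refine Finset.prod_congr rfl fun i _ => ?_
    rw [← Complex.ofReal_mul, Real.mul_self_sqrt (hq0 _ _)]
  refine ⟨H, f, ?_, ?_⟩
  · intro v T
    rw [TraceClass.opTrace_sum]
    cases v with
    | source =>
      simp only [f, QuantumOp.opTrace_measurePrepare, ContinuousLinearMap.id_comp, hΨsn]
      rw [← Finset.mul_sum, ← Complex.ofReal_sum, hp, Complex.ofReal_one, mul_one]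
    | setting i =>
      simp only [f, QuantumOp.opTrace_measurePrepare, ContinuousLinearMap.id_comp, hΨxn]
      rw [← Finset.mul_sum, ← Complex.ofReal_sum, hq, Complex.ofReal_one, mul_one]
    | outcome i =>
      simp only [f, QuantumOp.opTrace_measurePrepare, inner_elementary, outgoing_outcome,
        Finset.prod_empty, mul_one, ← TraceClass.expect_apply]
      rw [← TraceClass.expect_sum, hMsum, TraceClass.expect_id]
  · intro o
    let F : ∀ k, QuantumOp (system H ((bellScenario n).cut k)) (system H ((bellScenario n).cut (k + 1)))
      | 0 => QuantumOp.measurePrepare _ ContinuousLinearMap.isPositive_id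
          (Ψ (o source) fun i => o (setting i))
      | 1 => QuantumOp.measurePrepare (N fun i => o (outcome i)) (hN _)
          (elementary ((bellScenario n).cut 2) fun e => (0 : H e))
      | k + 2 => QuantumOp.measurePrepare _ ContinuousLinearMap.isPositive_id
          (elementary ((bellScenario n).cut (k + 3)) fun e => (0 : H e))
    let ω : ∀ k, TraceClass (system H ((bellScenario n).cut k)) := fun k =>
      Nat.rec ⟨ContinuousLinearMap.id ℂ _, isTraceClass_of_eq_empty cut_zero _⟩
        (fun k T => (F k).toFun T) k
    have hF : ∀ k, IsParallel k (fun v => f v (o v)) (F k)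
      | 0 => isParallel_zero (hΨ _ _) rfl fun i => rfl
      | 1 => isParallel_one (fun i => hM i (o (outcome i))) (hN _) (fun A T c hT =>
          opTrace_productEffect hW hV (fun i x => E i x (o (outcome i))) A T c hT) fun i => rfl
      | k + 2 => isParallel_add_two k
    have hω : ∀ k, ω (k + 1) = (F k).toFun (ω k) := fun k => rfl
    refine ⟨F, ω, hF, rfl, hω, ?_⟩
    have h1 : (ω 1).1 = InnerProductSpace.rankOne ℂ (Ψ (o source) fun i => o (setting i))
        (Ψ (o source) fun i => o (setting i)) := by
      have h2 : (ω 1).1 = opTrace (ContinuousLinearMap.id ℂ _ ∘L (ω 0).1) • _ := rfl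
      have h3 : opTrace (ContinuousLinearMap.id ℂ (system H ((bellScenario n).cut 0)) ∘L (ω 0).1) =
          1 := by
        rw [ContinuousLinearMap.id_comp, opTrace_of_eq_empty cut_zero _ (fun _ => 0) (fun _ => 0)]
        change ⟪_, ContinuousLinearMap.id ℂ _ _⟫_ℂ = 1
        rw [ContinuousLinearMap.id_apply, inner_elementary, cut_zero, Finset.prod_empty]
      rw [h2, h3, one_smul]
      rfl
    have h4 : ω 1 = TraceClass.rankOne (Ψ (o source) fun i => o (setting i))
        (Ψ (o source) fun i => o (setting i)) := Subtype.ext h1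
    rw [opTrace_final_state hF hω, show ω 2 = (F 1).toFun (ω 1) from rfl, h4]
    refine (QuantumOp.opTrace_measurePrepare _ (hN _) _ _).trans ?_
    rw [← TraceClass.expect_apply, TraceClass.expect_rankOne, hNΨ, assemble_eta, inner_elementary,
      cut_add_two 0, Finset.prod_empty, mul_one]

end Construction

/-- The weights of source and settings are the single-node marginals, made into functions of one
value by updating a reference outcome o₀. By free will their product is the denominator of the
conditional probability. -/
theorem isQuantumCorrelation_of_freeWill_of_hasQuantumModel {O : BellNode n → Type v}
    [∀ v, Fintype (O v)] {P : (∀ v, O v) → ℝ} (hsim : P ∈ stdSimplex ℝ (∀ v, O v))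
    (hfree : FreeWill P) (hmodel : HasQuantumModel.{u, v} P) :
    (bellScenario n).IsQuantumCorrelation.{u, v} P := by
  classical
  obtain ⟨K, ψ, E, hψ, hEpos, hE, hmod⟩ := hmodel
  choose L e he hec using fun i => exists_register.{u, v} (O (setting i))
  obtain ⟨o₀⟩ : Nonempty (∀ v, O v) := by
    by_contra h
    rw [not_nonempty_iff] at h
    have := hsim.2
    simp at this
  refine isQuantumCorrelation_of_registers (H := edgeSpaces K L) (ψ := ψ) (E := E) (e := e)
    (p := fun s => marginal P {source} (Function.update o₀ source s))
    (q := fun i x => marginal P {setting i} (Function.update o₀ (setting i) x))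
    he hec hψ hEpos hE (fun s => marginal_nonneg hsim.1 _ _)
    ((sum_marginal_singleton P source o₀).trans hsim.2) (fun i x => marginal_nonneg hsim.1 _ _)
    (fun i => (sum_marginal_singleton P (setting i) o₀).trans hsim.2) fun s x a => ?_
  have h1 : marginal P {source} (Function.update o₀ source s) =
      marginal P {source} (assemble s x a) :=
    marginal_singleton_congr P (by simp)
  have h2 : ∀ i, marginal P {setting i} (Function.update o₀ (setting i) (x i)) =
      marginal P {setting i} (assemble s x a) :=
    fun i => marginal_singleton_congr P (by simp)
  simp only [h1, h2]
  have h3 := hmod (assemble s x a)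
  have h4 := hfree (assemble s x a)
  by_cases hpos : (∀ i, 0 < marginal P {setting i} (assemble s x a)) ∧
      0 < marginal P {source} (assemble s x a)
  · have h5 := h3 hpos.1 hpos.2
    have h6 : (∏ i, marginal P {setting i} (assemble s x a)) *
        marginal P {source} (assemble s x a) ≠ 0 :=
      (mul_pos (Finset.prod_pos fun i _ => hpos.1 i) hpos.2).ne'
    refine Eq.trans ?_ (congrArg _ h5)
    rw [condProb_eq, h4, ← Complex.ofReal_prod, ← Complex.ofReal_mul, ← Complex.ofReal_mul]
    congr 1
    rw [mul_comm (marginal P {source} _), mul_div_cancel₀ _ h6]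
  -- If some weight vanishes the model is silent, but P is bounded by the joint marginal of settings
  -- and source, which free will makes zero; both sides vanish.
  · have h5 : (∏ i, marginal P {setting i} (assemble s x a)) *
        marginal P {source} (assemble s x a) = 0 := by
      rw [not_and_or, not_forall] at hpos
      rcases hpos with ⟨i, hi⟩ | hs
      · rw [Finset.prod_eq_zero (Finset.mem_univ i)
          (le_antisymm (not_lt.1 hi) (marginal_nonneg hsim.1 _ _)), zero_mul]
      · rw [le_antisymm (not_lt.1 hs) (marginal_nonneg hsim.1 _ _), mul_zero]
    have h6 : P (assemble s x a) = 0 :=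
      le_antisymm ((le_marginal hsim.1 _ _).trans (h4.trans h5).le) (hsim.1 _)
    rw [h6, ← Complex.ofReal_prod, ← Complex.ofReal_mul, mul_comm (marginal P {source} _), h5]
    simp

end BellNode

end

theorem mainTheorem5 (n : ℕ) (O : BellNode n → Type v) [∀ v, Fintype (O v)]
    (P : (∀ v, O v) → ℝ) (hP : P ∈ stdSimplex ℝ (∀ v, O v)) :
    (bellScenario n).IsQuantumCorrelation.{u, v} P ↔
      BellNode.FreeWill P ∧ BellNode.HasQuantumModel.{u, v} P :=
  ⟨BellNode.freeWill_and_hasQuantumModel_of_isQuantumCorrelation hP,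
    fun h => BellNode.isQuantumCorrelation_of_freeWill_of_hasQuantumModel hP h.1 h.2⟩
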